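/- Let $n\ge 2$, let $\Omega,\Omega^*\subset\mathbb R^n$ be bounded domains, and let $f\in C^{1,1}_{\rm loc}(\Omega)$ and $g\in C^{1,1}(\Omega^*)$ (that is, $g\in C^1$, with $g$ and $Dg$ bounded and $Dg$ Lipschitz in $\Omega^*$). Suppose that $f$ and $g$ have positive upper and lower bounds on $\Omega$ and $\Omega^*$ respectively, and that $\int_\Omega f=\int_{\Omega^*}g$. For $\varepsilon\in(0,1]$ let $c_\varepsilon(x,y)=\sqrt{\varepsilon^2+|x-y|^2}$. A function $u$ is $c_\varepsilon$-concave on $\Omega$ if $u(x)=\inf_{y\in\Omega^*}\big(c_\varepsilon(x,y)-\varphi(y)\big)$ for all $x\in\Omega$, for some $\varphi:\Omega^*\to\mathbb R\cup\{-\infty\}$. Given $u$, put $$L=\frac{\varepsilon}{\sqrt{1-|Du|^2}},\quad T_\varepsilon(x)=x-L(x)Du(x),\quad A_{ij}=\frac1L(\delta_{ij}-u_iu_j),\quad w_{ij}=A_{ij}-u_{ij},\quad W=\sum_{i,j}A^{ij}w_{ij},$$ where $(A^{ij})=A^{-1}$. Let $u\in C^{3,1}_{\rm loc}(\Omega)$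 be any $c_\varepsilon$-concave function with $T_\varepsilon(\Omega)\subset\Omega^*$ that solves $$\det(w_{ij})=\frac{\varepsilon^2}{L^{n+2}}\,\frac{f}{g\circ T_\varepsilon}\quad\text{in }\Omega .$$ Then at every point of $\Omega$ the mapping $T_\varepsilon$ is differentiable, the matrices $A$ and $w$ are positive definite, the Jacobian matrix satisfies $DT_\varepsilon=A^{-1}w$, and it is diagonalizable over $\mathbb R$ with positive eigenvalues $\lambda_1,\dots,\lambda_n$ whose sum is $W$. Moreover, for every $d>0$ there is a constant $C>0$, depending only on $n$, $d$, $f$ and $g$ (together with their domains $\Omega$ and $\Omega^*$), such that for every $\varepsilon\in(0,1]$, every such $u$ and every $\Omega'\subset\subset\Omega$ with $\mathrm{dist}(\Omega',\partial\Omega)\ge d$, $$C^{-1}\le\min_i\lambda_i\le\max_i\lambda_i\le C\quad\text{in }\Omega'.$$ -/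

import Mathlib

namespace MongeApprox

/-- `ℝⁿ` with its Euclidean norm. -/
abbrev E (n : ℕ) : Type := EuclideanSpace ℝ (Fin n)

/-- The `i`-th standard basis vector of `ℝⁿ`. -/
noncomputable def e {n : ℕ} (i : Fin n) : E n := EuclideanSpace.single i 1

/-- A bounded domain: a nonempty, connected, open and bounded set. -/
def IsBoundedDomain {n : ℕ} (Ω : Set (E n)) : Prop :=
  IsOpen Ω ∧ IsConnected Ω ∧ Bornology.IsBounded Ω

/-- `Ω' ⊂⊂ Ω`. -/
def CompactlyContained {n : ℕ} (Ω' Ω : Set (E n)) : Prop :=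
  IsCompact (closure Ω') ∧ closure Ω' ⊆ Ω

/-- The function `h` has positive lower and upper bounds on `Ω`. -/
def HasPositiveBounds {n : ℕ} (Ω : Set (E n)) (h : E n → ℝ) : Prop :=
  ∃ m M : ℝ, 0 < m ∧ ∀ x ∈ Ω, m ≤ h x ∧ h x ≤ M

/-- `C^{k,1}_loc(Ω)`: the function is `C^k` in the open set `Ω` and its derivative of order `k` is
locally Lipschitz in `Ω`. -/
def IsLocallyCk1 {n : ℕ} (k : ℕ) (Ω : Set (E n)) (h : E n → ℝ) : Prop :=
  ContDiffOn ℝ k h Ω ∧ LocallyLipschitzOn Ω (iteratedFDeriv ℝ k h)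

/-- `C^{k,1}(Ω)` with finite norm: the function is `C^k` in the open set `Ω`, its derivatives up to
order `k` are bounded in `Ω`, and its derivative of order `k` is Lipschitz in `Ω`. -/
def IsCk1 {n : ℕ} (k : ℕ) (Ω : Set (E n)) (h : E n → ℝ) : Prop :=
  ContDiffOn ℝ k h Ω ∧
    ∃ K : NNReal, (∀ j ≤ k, ∀ x ∈ Ω, ‖iteratedFDeriv ℝ j h x‖ ≤ K) ∧
      LipschitzOnWith K (iteratedFDeriv ℝ k h) Ω

/-- The cost `c_ε(x, y) = √(ε² + |x - y|²)`. -/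
noncomputable def cost {n : ℕ} (ε : ℝ) (x y : E n) : ℝ :=
  Real.sqrt (ε ^ 2 + ‖x - y‖ ^ 2)

/-- `u` is `c_ε`-concave on `Ω` with respect to `Ωs`, that is
`u(x) = inf_{y ∈ Ωs} (c_ε(x, y) - φ(y))` in `Ω` for some `φ : Ωs → ℝ ∪ {-∞}`.
Here `S` is the set where `φ > -∞`. -/
def IsCConcave {n : ℕ} (ε : ℝ) (Ω Ωs : Set (E n)) (u : E n → ℝ) : Prop :=
  ∃ S ⊆ Ωs, ∃ φ : E n → ℝ, ∀ x ∈ Ω, IsGLB ((fun y => cost ε x y - φ y) '' S) (u x)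

/-- `L = ε / √(1 - |Du|²)`. -/
noncomputable def L {n : ℕ} (ε : ℝ) (u : E n → ℝ) (x : E n) : ℝ :=
  ε / Real.sqrt (1 - ‖gradient u x‖ ^ 2)

/-- The mapping `T_ε(x) = x - L(x) Du(x)`. -/
noncomputable def T {n : ℕ} (ε : ℝ) (u : E n → ℝ) (x : E n) : E n :=
  x - L ε u x • gradient u x

/-- The Hessian matrix `D²u(x)`. -/
noncomputable def hess {n : ℕ} (u : E n → ℝ) (x : E n) : Matrix (Fin n) (Fin n) ℝ :=
  Matrix.of fun i j => fderiv ℝ (fderiv ℝ u) x (e i) (e j)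

/-- The matrix `A_ij = (δ_ij - u_i u_j) / L`, which is `D²_{x^i x^j} c_ε(x, T(x))`. -/
noncomputable def A {n : ℕ} (ε : ℝ) (u : E n → ℝ) (x : E n) : Matrix (Fin n) (Fin n) ℝ :=
  Matrix.of fun i j =>
    1 / L ε u x * ((if i = j then 1 else 0) - gradient u x i * gradient u x j)

/-- The matrix `w_ij = A_ij - D²_ij u`. -/
noncomputable def w {n : ℕ} (ε : ℝ) (u : E n → ℝ) (x : E n) : Matrix (Fin n) (Fin n) ℝ :=
  A ε u x - hess u x

/-- The function `W = ∑ A^{αβ} w_αβ`, where `A^{αβ}` are the entries of the inverse of `A`. -/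
noncomputable def W {n : ℕ} (ε : ℝ) (u : E n → ℝ) (x : E n) : ℝ :=
  ∑ α, ∑ β, (A ε u x)⁻¹ α β * w ε u x α β

/-- The Jacobian matrix of `T_ε`, with entries `∂_j T^i`. -/
noncomputable def jacobian {n : ℕ} (ε : ℝ) (u : E n → ℝ) (x : E n) :
    Matrix (Fin n) (Fin n) ℝ :=
  Matrix.of fun i j => fderiv ℝ (T ε u) x (e j) i

/-- `u ∈ C^{3,1}(Ω)` is a `c_ε`-concave solution, with `T_ε : Ω → Ωs`, of the equation
`det w = ε² / L^{n+2} · f / (g ∘ T_ε)` in `Ω`. -/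
structure IsCConcaveSolution {n : ℕ} (ε : ℝ) (Ω Ωs : Set (E n)) (f g u : E n → ℝ) : Prop where
  regular : IsLocallyCk1 3 Ω u
  cConcave : IsCConcave ε Ω Ωs u
  mapsTo : Set.MapsTo (T ε u) Ω Ωs
  equation : ∀ x ∈ Ω,
    (w ε u x).det = ε ^ 2 / L ε u x ^ (n + 2) * (f x / g (T ε u x))

end MongeApprox

/-! Why it holds. By `c_ε`-concavity each point `x` has a contact point `y`, at which `c_ε(·,y) - u`
is minimal. The first-order condition gives `y = T(x)` and `L = c_ε(x,y)`; the second-order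
condition says that `w` is nonnegative, and since the equation makes `det w` positive, `w` is
positive definite. Differentiating `D_x c_ε(x,T(x)) = Du` gives `A · DT = w`, because the cost
depends on `x - y` only. Hence `DT = A⁻¹w` has positive eigenvalues. As `det A = ε²/L^{n+2}`, their
product is `f/(g∘T)`, which is bounded above and below independently of `ε`. A lower bound therefore
follows from an upper bound for the largest eigenvalue (`div_pow_le_of_prod`).

The upper bound is of Pogorelov type. On a ball of radius `r` about `c`, maximize `ζ² w(a,a)/A(a,a)`
with `ζ = r² - |x-c|²` over points and directions (`exists_max_quotient`). With the maximizing
eigenvector frozen, `D²u(ξ,ξ)` is touched from below by the explicit function `A(ξ,ξ)(1 - M/ζ²)`.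
Work in a basis that is orthonormal for `A` and diagonal for `w` (`Frame`). The equation is `log det
w = Q`, and `log det` is concave (`log_det_le`), so differentiating twice along `ξ` gives a
differential inequality for the touching function (`Frame.second_derivative_log_det`). The second
derivatives of `A` contribute the good term `κ²(1-λ_m)² ∑ 1/λ_i` with `κ² = L/ε²`. All third
derivatives of `u` paired with the `1/λ_i` are removed by the once differentiated equation and the
first-order condition at the maximum (`cancel_third`). Every remaining term is at most of size `κ²`,
so dividing by `κ²` leaves an inequality free of `ε` (`le_of_cancel_third`,
`Frame.estimate_at_max`). Together with the bound on the product of the eigenvalues it bounds `λ_m`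
(`eigenvalue_le`).

Since `u` is only `C^{3,1}` and `f`, `g` only `C^{1,1}`, neither side can be differentiated twice
classically. Second difference quotients replace second derivatives, and the inequality is obtained
in the viscosity sense (`sum_hess_le_of_touching`, `C11At.secondDiff_comp_le`). -/

open Filter Topology
open scoped RealInnerProductSpace MatrixOrder

namespace MongeApprox

/-! ### Second-order calculus along curves; second difference quotients -/

section SecondOrder

variable {V F G : Type*} [NormedAddCommGroup V] [NormedSpace ℝ V] [NormedAddCommGroup F]
  [NormedSpace ℝ F] [NormedAddCommGroup G] [InnerProductSpace ℝ G]

/-- The curve `f` has value `a`, first derivative `b` and second derivative `c` at `0`. -/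
def Jet2 (f : ℝ → F) (a b c : F) : Prop :=
  f 0 = a ∧ ∃ f1 : ℝ → F, (∀ᶠ τ in 𝓝 (0 : ℝ), HasDerivAt f (f1 τ) τ) ∧ f1 0 = b ∧
    HasDerivAt f1 c 0

namespace Jet2

theorem hasDerivAt {f : ℝ → F} {a b c : F} (h : Jet2 f a b c) : HasDerivAt f b 0 := by
  obtain ⟨-, f1, h1, h2, -⟩ := h
  exact h2 ▸ h1.self_of_nhds

/-- This is how Fréchet derivatives get computed: `ContDiffAt.jet2` supplies one jet along a line,
the product and chain rules another, and the two must agree. -/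
theorem unique {f : ℝ → F} {a b c a' b' c' : F} (h : Jet2 f a b c) (h' : Jet2 f a' b' c') :
    a = a' ∧ b = b' ∧ c = c' := by
  refine ⟨h.1.symm.trans h'.1, h.hasDerivAt.unique h'.hasDerivAt, ?_⟩
  obtain ⟨-, f1, h1, -, h3⟩ := h
  obtain ⟨-, f2, h1', -, h3'⟩ := h'
  have : f2 =ᶠ[𝓝 0] f1 := by
    filter_upwards [h1, h1'] with τ h h' using h'.unique h
  exact h3.unique (h3'.congr_of_eventuallyEq this.symm)

theorem congr {f g : ℝ → F} {a b c : F} (h : Jet2 f a b c) (hfg : g =ᶠ[𝓝 0] f) :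
    Jet2 g a b c := by
  obtain ⟨h0, f1, h1, h2, h3⟩ := h
  refine ⟨hfg.self_of_nhds.trans h0, f1, ?_, h2, h3⟩
  filter_upwards [h1, hfg.eventually_nhds] with τ h h' using h.congr_of_eventuallyEq h'

theorem const (a : F) : Jet2 (fun _ => a) a 0 0 :=
  ⟨rfl, fun _ => 0, Eventually.of_forall fun _ => hasDerivAt_const _ _, rfl,
    hasDerivAt_const _ _⟩

theorem line (x v : F) : Jet2 (fun τ : ℝ => x + τ • v) x v 0 := by
  refine ⟨by simp, fun _ => v, Eventually.of_forall fun τ => ?_, rfl, hasDerivAt_const _ _⟩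
  simpa using ((hasDerivAt_id τ).smul_const v).const_add x

theorem add {f g : ℝ → F} {a b c a' b' c' : F} (h : Jet2 f a b c) (h' : Jet2 g a' b' c') :
    Jet2 (fun τ => f τ + g τ) (a + a') (b + b') (c + c') := by
  obtain ⟨h0, f1, h1, h2, h3⟩ := h
  obtain ⟨h0', g1, h1', h2', h3'⟩ := h'
  refine ⟨by simp only [h0, h0'], fun τ => f1 τ + g1 τ, ?_, by simp only [h2, h2'], h3.add h3'⟩
  filter_upwards [h1, h1'] with τ h h' using h.add h'

theorem sub {f g : ℝ → F} {a b c a' b' c' : F} (h : Jet2 f a b c) (h' : Jet2 g a' b' c') :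
    Jet2 (fun τ => f τ - g τ) (a - a') (b - b') (c - c') := by
  obtain ⟨h0, f1, h1, h2, h3⟩ := h
  obtain ⟨h0', g1, h1', h2', h3'⟩ := h'
  refine ⟨by simp only [h0, h0'], fun τ => f1 τ - g1 τ, ?_, by simp only [h2, h2'], h3.sub h3'⟩
  filter_upwards [h1, h1'] with τ h h' using h.sub h'

theorem smul {f : ℝ → ℝ} {g : ℝ → F} {a b c : ℝ} {a' b' c' : F} (h : Jet2 f a b c)
    (h' : Jet2 g a' b' c') :
    Jet2 (fun τ => f τ • g τ) (a • a') (b • a' + a • b') (c • a' + (2 * b) • b' + a • c') := by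
  have hb := h.hasDerivAt
  have hb' := h'.hasDerivAt
  obtain ⟨h0, f1, h1, h2, h3⟩ := h
  obtain ⟨h0', g1, h1', h2', h3'⟩ := h'
  refine ⟨by simp only [h0, h0'], fun τ => f τ • g1 τ + f1 τ • g τ, ?_, ?_, ?_⟩
  · filter_upwards [h1, h1'] with τ h h' using h.smul h'
  · simp only [h0, h0', h2, h2', add_comm]
  · refine ((hb.smul h3').add (h3.smul hb')).congr_deriv ?_
    simp only [h0, h0', h2, h2']
    module

theorem mul {f g : ℝ → ℝ} {a b c a' b' c' : ℝ} (h : Jet2 f a b c) (h' : Jet2 g a' b' c') :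
    Jet2 (fun τ => f τ * g τ) (a * a') (b * a' + a * b') (c * a' + 2 * b * b' + a * c') := by
  simpa only [smul_eq_mul] using h.smul h'

theorem inner {f g : ℝ → G} {a b c a' b' c' : G} (h : Jet2 f a b c) (h' : Jet2 g a' b' c') :
    Jet2 (fun τ => ⟪f τ, g τ⟫) ⟪a, a'⟫ (⟪b, a'⟫ + ⟪a, b'⟫) (⟪c, a'⟫ + 2 * ⟪b, b'⟫ + ⟪a, c'⟫) := by
  have hb := h.hasDerivAt
  have hb' := h'.hasDerivAt
  obtain ⟨h0, f1, h1, h2, h3⟩ := h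
  obtain ⟨h0', g1, h1', h2', h3'⟩ := h'
  refine ⟨by simp only [h0, h0'], fun τ => ⟪f τ, g1 τ⟫ + ⟪f1 τ, g τ⟫, ?_, ?_, ?_⟩
  · filter_upwards [h1, h1'] with τ h h' using h.inner ℝ h'
  · simp only [h0, h0', h2, h2', add_comm]
  · refine ((hb.inner ℝ h3').add (h3.inner ℝ hb')).congr_deriv ?_
    simp only [h0, h0', h2, h2']
    ring

theorem comp {φ φ1 : ℝ → ℝ} {f : ℝ → ℝ} {a b c φ2 : ℝ} (h : Jet2 f a b c)
    (h1 : ∀ᶠ y in 𝓝 a, HasDerivAt φ (φ1 y) y) (h2 : HasDerivAt φ1 φ2 a) :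
    Jet2 (fun τ => φ (f τ)) (φ a) (φ1 a * b) (φ2 * b ^ 2 + φ1 a * c) := by
  have hb := h.hasDerivAt
  obtain ⟨h0, f1, h1', h2', h3'⟩ := h
  refine ⟨by simp only [h0], fun τ => φ1 (f τ) * f1 τ, ?_, by simp only [h0, h2'], ?_⟩
  · have : Tendsto f (𝓝 0) (𝓝 a) := h0 ▸ hb.continuousAt.tendsto
    filter_upwards [this.eventually h1, h1'] with τ h h' using h.comp τ h'
  · subst h0
    refine ((h2.comp (0 : ℝ) hb).mul h3').congr_deriv ?_
    simp only [h2', Function.comp]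
    ring

theorem log {f : ℝ → ℝ} {a b c : ℝ} (h : Jet2 f a b c) (ha : 0 < a) :
    Jet2 (fun τ => Real.log (f τ)) (Real.log a) (b / a) (c / a - (b / a) ^ 2) := by
  have h1 : ∀ᶠ y in 𝓝 a, HasDerivAt Real.log (y⁻¹) y := by
    filter_upwards [lt_mem_nhds ha] with y hy using Real.hasDerivAt_log hy.ne'
  have h2 : HasDerivAt (fun y : ℝ => y⁻¹) (-(a ^ 2)⁻¹) a := hasDerivAt_inv ha.ne'
  convert h.comp h1 h2 using 1
  · field_simp
  · field_simp; ring

theorem sqrt {f : ℝ → ℝ} {a b c s : ℝ} (h : Jet2 f a b c) (hs : 0 < s) (ha : a = s ^ 2) :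
    Jet2 (fun τ => Real.sqrt (f τ)) s (b / (2 * s)) (c / (2 * s) - b ^ 2 / (4 * s ^ 3)) := by
  have ha0 : 0 < a := by rw [ha]; positivity
  have hsq : Real.sqrt a = s := by rw [ha, Real.sqrt_sq hs.le]
  have h1 : ∀ᶠ y in 𝓝 a, HasDerivAt Real.sqrt (1 / (2 * Real.sqrt y)) y := by
    filter_upwards [lt_mem_nhds ha0] with y hy using Real.hasDerivAt_sqrt hy.ne'
  have h2 : HasDerivAt (fun y : ℝ => 1 / (2 * Real.sqrt y)) (-1 / (4 * s ^ 3)) a := by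
    have := ((Real.hasDerivAt_sqrt ha0.ne').const_mul 2).inv (by positivity)
    simp only [one_div]
    refine this.congr_deriv ?_
    rw [hsq]
    field_simp
    norm_num
  have := h.comp h1 h2
  rw [hsq] at this
  convert this using 1
  · field_simp
  · field_simp; ring

theorem inv {f : ℝ → ℝ} {a b c : ℝ} (h : Jet2 f a b c) (ha : a ≠ 0) :
    Jet2 (fun τ => (f τ)⁻¹) a⁻¹ (-b / a ^ 2) (2 * b ^ 2 / a ^ 3 - c / a ^ 2) := by
  have h1 : ∀ᶠ y in 𝓝 a, HasDerivAt (fun y : ℝ => y⁻¹) (-(y ^ 2)⁻¹) y := by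
    filter_upwards [isOpen_ne.mem_nhds ha] with y hy using hasDerivAt_inv hy
  have h2 : HasDerivAt (fun y : ℝ => -(y ^ 2)⁻¹) (2 / a ^ 3) a := by
    refine (((hasDerivAt_pow 2 a).inv (pow_ne_zero 2 ha)).neg).congr_deriv ?_
    field_simp
    norm_num
    ring
  convert h.comp h1 h2 using 1
  · field_simp
  · field_simp; ring

theorem nonneg_of_isLocalMin {f : ℝ → ℝ} {a b c : ℝ} (h : Jet2 f a b c)
    (hmin : IsLocalMin f 0) : b = 0 ∧ 0 ≤ c := by
  have hb := h.hasDerivAt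
  have hb0 : b = 0 := hmin.hasDerivAt_eq_zero hb
  refine ⟨hb0, ?_⟩
  by_contra! hc
  obtain ⟨h0, f1, h1, h2, h3⟩ := h
  have hd : deriv f =ᶠ[𝓝 0] f1 := by
    filter_upwards [h1] with τ h using h.deriv
  have hdd : deriv (deriv f) 0 = c := by rw [hd.deriv_eq, h3.deriv]
  -- A negative second derivative would make `0` a local maximum too; then `f` is locally constant
  -- and its second derivative is zero.
  have hmax := isLocalMax_of_deriv_deriv_neg (hdd ▸ hc) (by rw [hb.deriv, hb0]) hb.continuousAt
  have hconst : f =ᶠ[𝓝 0] fun _ => f 0 := by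
    filter_upwards [hmin, hmax] with τ h h' using le_antisymm h' h
  have : deriv f =ᶠ[𝓝 0] fun _ => 0 := by
    filter_upwards [hconst.eventually_nhds] with τ h
    rw [EventuallyEq.deriv_eq h, deriv_const]
  rw [this.deriv_eq, deriv_const] at hdd
  exact hc.ne hdd.symm

end Jet2

theorem eventually_add_smul {x : V} (ζ : V) {P : V → Prop} (h : ∀ᶠ y in 𝓝 x, P y) :
    ∀ᶠ τ in 𝓝 (0 : ℝ), P (x + τ • ζ) := by
  have : Tendsto (fun τ : ℝ => x + τ • ζ) (𝓝 0) (𝓝 x) := by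
    have : Continuous fun τ : ℝ => x + τ • ζ := by fun_prop
    simpa using this.tendsto 0
  exact this.eventually h

theorem ContDiffAt.jet2 {h : V → F} {x : V} (hh : ContDiffAt ℝ 2 h x) (ζ : V) :
    Jet2 (fun τ : ℝ => h (x + τ • ζ)) (h x) (fderiv ℝ h x ζ) (fderiv ℝ (fderiv ℝ h) x ζ ζ) := by
  have hl : ∀ τ : ℝ, HasDerivAt (fun τ : ℝ => x + τ • ζ) ζ τ := fun τ => by
    simpa using ((hasDerivAt_id τ).smul_const ζ).const_add x
  refine ⟨by simp, fun τ => fderiv ℝ h (x + τ • ζ) ζ, ?_, by simp, ?_⟩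
  · have : ∀ᶠ y in 𝓝 x, DifferentiableAt ℝ h y := by
      filter_upwards [hh.eventually (by simp)] with y hy using hy.differentiableAt (by simp)
    filter_upwards [eventually_add_smul ζ this] with τ hτ
    exact hτ.hasFDerivAt.comp_hasDerivAt τ (hl τ)
  · have h1 : ContDiffAt ℝ 1 (fderiv ℝ h) x := hh.fderiv_right (by norm_num)
    have h2 : HasFDerivAt (fderiv ℝ h) (fderiv ℝ (fderiv ℝ h) x) (x + (0 : ℝ) • ζ) := by
      simpa using (h1.differentiableAt (by simp)).hasFDerivAt
    have := h2.comp_hasDerivAt (0 : ℝ) (hl 0)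
    simpa using this.clm_apply (hasDerivAt_const (0 : ℝ) ζ)

theorem second_fderiv_nonneg_of_isLocalMin {h : V → ℝ} {x : V} (hh : ContDiffAt ℝ 2 h x)
    (hmin : IsLocalMin h x) (ζ : V) : 0 ≤ fderiv ℝ (fderiv ℝ h) x ζ ζ := by
  refine ((ContDiffAt.jet2 hh ζ).nonneg_of_isLocalMin ?_).2
  filter_upwards [eventually_add_smul ζ hmin] with τ hτ
  simpa using hτ

theorem tendsto_difference_quotient {h : V → F} {x : V} (hh : ContDiffAt ℝ 1 h x) (ξ : V) :
    Tendsto (fun z : V × ℝ => z.2⁻¹ • (h (z.1 + z.2 • ξ) - h z.1)) (𝓝 x ×ˢ 𝓝[≠] 0)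
      (𝓝 (fderiv ℝ h x ξ)) := by
  have hs := hh.hasStrictFDerivAt (by simp)
  rw [Metric.tendsto_nhds]
  intro δ hδ
  have hc : 0 < δ / (2 * (‖ξ‖ + 1)) := by positivity
  have h1 := hs.isLittleO.def hc
  have ht : Tendsto (fun z : V × ℝ => (z.1 + z.2 • ξ, z.1)) (𝓝 x ×ˢ 𝓝[≠] 0) (𝓝 (x, x)) := by
    have : Continuous fun z : V × ℝ => (z.1 + z.2 • ξ, z.1) := by fun_prop
    have h2 := this.tendsto (x, 0)
    simp only [zero_smul, add_zero, nhds_prod_eq] at h2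
    rw [nhds_prod_eq]
    exact h2.mono_left (Filter.prod_mono le_rfl nhdsWithin_le_nhds)
  have hne : ∀ᶠ z : V × ℝ in 𝓝 x ×ˢ 𝓝[≠] 0, z.2 ≠ 0 :=
    tendsto_snd.eventually eventually_mem_nhdsWithin
  filter_upwards [ht.eventually h1, hne] with z hz hz0
  simp only [add_sub_cancel_left, map_smul] at hz
  rw [dist_eq_norm]
  have : z.2⁻¹ • (h (z.1 + z.2 • ξ) - h z.1) - fderiv ℝ h x ξ =
      z.2⁻¹ • (h (z.1 + z.2 • ξ) - h z.1 - z.2 • fderiv ℝ h x ξ) := by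
    rw [smul_sub z.2⁻¹ _ (z.2 • _), smul_smul, inv_mul_cancel₀ hz0, one_smul]
  rw [this, norm_smul, norm_inv]
  have hz1 : 0 < ‖z.2‖ := norm_pos_iff.2 hz0
  rw [norm_smul] at hz
  calc ‖z.2‖⁻¹ * _ ≤ ‖z.2‖⁻¹ * (δ / (2 * (‖ξ‖ + 1)) * (‖z.2‖ * ‖ξ‖)) := by gcongr
    _ = δ / 2 * (‖ξ‖ / (‖ξ‖ + 1)) := by field_simp
    _ ≤ δ / 2 * 1 := by
        gcongr
        rw [div_le_one (by positivity)]; linarith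
    _ < δ := by linarith

/-- The second difference quotient of `h` in the direction `ξ`. -/
noncomputable def secondDiff (h : V → F) (ξ : V) (z : V × ℝ) : F :=
  (z.2 ^ 2)⁻¹ • (h (z.1 + z.2 • ξ) + h (z.1 - z.2 • ξ) - (2 : ℝ) • h z.1)

/-- The limit is joint in base point and step, because it is applied at minimizers that move with
the step. Near `x` the map `Dh - Q` has a small Lipschitz constant `κ`, so subtracting `τ² Q(ξ,ξ)`
from the symmetric sum leaves a curve with small derivative. -/
theorem tendsto_secondDiff {h : V → F} {x : V} (hh : ContDiffAt ℝ 2 h x) (ξ : V) :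
    Tendsto (secondDiff h ξ) (𝓝 x ×ˢ 𝓝[≠] 0) (𝓝 (fderiv ℝ (fderiv ℝ h) x ξ ξ)) := by
  set Q := fderiv ℝ (fderiv ℝ h) x with hQ
  rw [Metric.tendsto_nhds]
  intro δ hδ
  set κ := δ / (4 * (‖ξ‖ ^ 2 + 1)) with hκ
  have hκ0 : 0 < κ := by positivity
  have h1 : ContDiffAt ℝ 1 (fderiv ℝ h) x := hh.fderiv_right (by norm_num)
  have hcont := (h1.fderiv_right (m := 0) (by norm_num)).continuousAt
  have hev : ∀ᶠ y in 𝓝 x, DifferentiableAt ℝ h y ∧ DifferentiableAt ℝ (fderiv ℝ h) y ∧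
      ‖fderiv ℝ (fderiv ℝ h) y - Q‖ ≤ κ := by
    have hn := tendsto_iff_norm_sub_tendsto_zero.1 hcont.tendsto
    filter_upwards [hh.eventually (by simp), hn.eventually_le_const hκ0] with y hy hy'
    refine ⟨hy.differentiableAt (by simp),
      (hy.fderiv_right (m := 1) (by norm_num)).differentiableAt (by simp), hy'⟩
  obtain ⟨ρ, hρ, hball⟩ := Metric.eventually_nhds_iff_ball.1 hev
  have hx : ∀ᶠ z : V × ℝ in 𝓝 x ×ˢ 𝓝[≠] 0, z.1 ∈ Metric.ball x (ρ / 2) :=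
    tendsto_fst.eventually (Metric.ball_mem_nhds _ (by positivity))
  have ht : ∀ᶠ z : V × ℝ in 𝓝 x ×ˢ 𝓝[≠] 0, |z.2| * ‖ξ‖ < ρ / 2 := by
    have : Tendsto (fun t : ℝ => |t| * ‖ξ‖) (𝓝[≠] 0) (𝓝 0) := by
      have : Continuous fun t : ℝ => |t| * ‖ξ‖ := by fun_prop
      simpa using (this.tendsto 0).mono_left nhdsWithin_le_nhds
    exact tendsto_snd.eventually (this.eventually (gt_mem_nhds (by positivity)))
  have hne : ∀ᶠ z : V × ℝ in 𝓝 x ×ˢ 𝓝[≠] 0, z.2 ≠ 0 :=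
    tendsto_snd.eventually eventually_mem_nhdsWithin
  filter_upwards [hx, ht, hne] with z hz hzt hz0
  obtain ⟨y, t⟩ := z
  simp only at hz hzt hz0
  have hmem : ∀ τ ∈ Set.Icc (-|t|) |t|, y + τ • ξ ∈ Metric.ball x ρ := by
    intro τ hτ
    have h2 : ‖τ • ξ‖ < ρ / 2 := by
      rw [norm_smul, Real.norm_eq_abs]
      have := abs_le.2 hτ
      exact lt_of_le_of_lt (by gcongr) hzt
    rw [mem_ball_iff_norm] at hz ⊢
    calc ‖y + τ • ξ - x‖ = ‖(y - x) + τ • ξ‖ := by congr 1; abel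
      _ ≤ ‖y - x‖ + ‖τ • ξ‖ := norm_add_le _ _
      _ < ρ := by linarith
  have hmem' : ∀ τ ∈ Set.Icc (-|t|) |t|, y - τ • ξ ∈ Metric.ball x ρ := by
    intro τ hτ
    have := hmem (-τ) ⟨by linarith [hτ.2], by linarith [hτ.1]⟩
    simpa [sub_eq_add_neg] using this
  have hG : ∀ a ∈ Metric.ball x ρ, ∀ b ∈ Metric.ball x ρ,
      ‖(fderiv ℝ h b - Q b) - (fderiv ℝ h a - Q a)‖ ≤ κ * ‖b - a‖ := by
    intro a ha b hb
    refine (convex_ball x ρ).norm_image_sub_le_of_norm_hasFDerivWithin_le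
      (f := fun y => fderiv ℝ h y - Q y) (f' := fun y => fderiv ℝ (fderiv ℝ h) y - Q)
      (fun y hy => ?_) (fun y hy => (hball y hy).2.2) ha hb
    exact ((hball y hy).2.1.hasFDerivAt.sub Q.hasFDerivAt).hasFDerivWithinAt
  have hφ : ‖(h (y + t • ξ) + h (y - t • ξ) - (t ^ 2) • Q ξ ξ) -
      (h (y + (0 : ℝ) • ξ) + h (y - (0 : ℝ) • ξ) - ((0 : ℝ) ^ 2) • Q ξ ξ)‖ ≤
      (2 * κ * |t| * ‖ξ‖ ^ 2) * ‖t - 0‖ := by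
    refine (convex_Icc (-|t|) |t|).norm_image_sub_le_of_norm_hasDerivWithin_le
      (f := fun τ : ℝ => h (y + τ • ξ) + h (y - τ • ξ) - (τ ^ 2) • Q ξ ξ)
      (f' := fun τ : ℝ => fderiv ℝ h (y + τ • ξ) ξ - fderiv ℝ h (y - τ • ξ) ξ - (2 * τ) • Q ξ ξ)
      (fun τ hτ => ?_) (fun τ hτ => ?_) (by simp) (abs_le.1 le_rfl)
    · have l1 : HasDerivAt (fun τ : ℝ => y + τ • ξ) ξ τ := by
        simpa using ((hasDerivAt_id τ).smul_const ξ).const_add y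
      have l2 : HasDerivAt (fun τ : ℝ => y - τ • ξ) (-ξ) τ := by
        simpa using ((hasDerivAt_id τ).smul_const ξ).const_sub y
      have d1 := (hball _ (hmem τ hτ)).1.hasFDerivAt.comp_hasDerivAt τ l1
      have d2 := (hball _ (hmem' τ hτ)).1.hasFDerivAt.comp_hasDerivAt τ l2
      have d3 := (hasDerivAt_pow 2 τ).smul_const (Q ξ ξ)
      have := (d1.add d2).sub d3
      refine (this.congr_deriv ?_).hasDerivWithinAt
      simp [sub_eq_add_neg]
    · have h3 := hG _ (hmem' τ hτ) _ (hmem τ hτ)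
      have e1 : y + τ • ξ - (y - τ • ξ) = (2 * τ) • ξ := by module
      have e2 : fderiv ℝ h (y + τ • ξ) ξ - fderiv ℝ h (y - τ • ξ) ξ - (2 * τ) • Q ξ ξ =
          ((fderiv ℝ h (y + τ • ξ) - Q (y + τ • ξ)) - (fderiv ℝ h (y - τ • ξ) - Q (y - τ • ξ))) ξ := by
        simp only [sub_apply, map_add, map_sub, map_smul,
          add_apply, smul_apply]
        module
      rw [e2]
      refine (ContinuousLinearMap.le_opNorm _ _).trans ?_
      rw [e1, norm_smul, Real.norm_eq_abs, abs_mul, abs_two] at h3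
      have := abs_le.2 hτ
      calc _ ≤ (κ * (2 * |τ| * ‖ξ‖)) * ‖ξ‖ := by gcongr
        _ ≤ (κ * (2 * |t| * ‖ξ‖)) * ‖ξ‖ := by gcongr
        _ = _ := by ring
  have ht2 : 0 < t ^ 2 := by positivity
  rw [dist_eq_norm, secondDiff]
  have e3 : (t ^ 2)⁻¹ • (h (y + t • ξ) + h (y - t • ξ) - (2 : ℝ) • h y) - Q ξ ξ =
      (t ^ 2)⁻¹ • ((h (y + t • ξ) + h (y - t • ξ) - (t ^ 2) • Q ξ ξ) -
      (h (y + (0 : ℝ) • ξ) + h (y - (0 : ℝ) • ξ) - ((0 : ℝ) ^ 2) • Q ξ ξ)) := by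
    have : Q ξ ξ = (t ^ 2)⁻¹ • (t ^ 2) • Q ξ ξ := by
      rw [smul_smul, inv_mul_cancel₀ ht2.ne', one_smul]
    conv_lhs => rw [this]
    rw [← smul_sub]
    congr 1
    simp
    module
  rw [e3, norm_smul, norm_inv, Real.norm_eq_abs, abs_of_pos ht2]
  calc (t ^ 2)⁻¹ * _ ≤ (t ^ 2)⁻¹ * ((2 * κ * |t| * ‖ξ‖ ^ 2) * ‖t - 0‖) := by gcongr
    _ = (t ^ 2)⁻¹ * (|t| ^ 2) * (2 * κ * ‖ξ‖ ^ 2) := by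
      rw [sub_zero, Real.norm_eq_abs]; ring
    _ = δ / 2 * (‖ξ‖ ^ 2 / (‖ξ‖ ^ 2 + 1)) := by
      rw [sq_abs, inv_mul_cancel₀ ht2.ne', hκ]
      field_simp
      norm_num
    _ ≤ δ / 2 * 1 := by
      gcongr
      rw [div_le_one (by positivity)]; linarith
    _ < δ := by linarith

end SecondOrder

end MongeApprox

namespace MongeApprox

/-! ### Passing from difference quotients to an inequality for a touching function -/

section SecondDiff
variable {V F : Type*} [NormedAddCommGroup V] [NormedSpace ℝ V] [NormedAddCommGroup F]
  [NormedSpace ℝ F]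

theorem hasFDerivAt_secondDiff {h : V → F} {x ξ : V} {t : ℝ} (h0 : DifferentiableAt ℝ h x)
    (h1 : DifferentiableAt ℝ h (x + t • ξ)) (h2 : DifferentiableAt ℝ h (x - t • ξ)) :
    HasFDerivAt (fun y => secondDiff h ξ (y, t)) (secondDiff (fderiv ℝ h) ξ (x, t)) x := by
  have a1 : HasFDerivAt (fun y => h (y + t • ξ)) (fderiv ℝ h (x + t • ξ)) x :=
    (hasFDerivAt_comp_add_right (t • ξ)).2 h1.hasFDerivAt
  have a2 : HasFDerivAt (fun y => h (y - t • ξ)) (fderiv ℝ h (x - t • ξ)) x :=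
    (hasFDerivAt_comp_sub (t • ξ)).2 h2.hasFDerivAt
  exact ((a1.add a2).sub (h0.hasFDerivAt.const_smul (2 : ℝ))).const_smul ((t ^ 2)⁻¹)

theorem fderiv_fderiv_secondDiff {h : V → F} {x ξ : V} {t : ℝ} (h0 : ContDiffAt ℝ 2 h x)
    (h1 : ContDiffAt ℝ 2 h (x + t • ξ)) (h2 : ContDiffAt ℝ 2 h (x - t • ξ)) (v w : V) :
    fderiv ℝ (fderiv ℝ (fun y => secondDiff h ξ (y, t))) x v w =
      secondDiff (fun y => fderiv ℝ (fderiv ℝ h) y v w) ξ (x, t) := by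
  have key : ∀ y, ContDiffAt ℝ 2 h y → DifferentiableAt ℝ (fderiv ℝ h) y := fun y hy =>
    (hy.fderiv_right (m := 1) (by norm_num)).differentiableAt (by simp)
  have key2 : ∀ y, ContDiffAt ℝ 2 h y → ∀ᶠ z in 𝓝 y, DifferentiableAt ℝ h z := fun y hy => by
    filter_upwards [hy.eventually (by simp)] with z hz using hz.differentiableAt (by simp)
  have c1 : Tendsto (fun y => y + t • ξ) (𝓝 x) (𝓝 (x + t • ξ)) :=
    (continuous_id.add continuous_const).tendsto x
  have c2 : Tendsto (fun y => y - t • ξ) (𝓝 x) (𝓝 (x - t • ξ)) :=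
    (continuous_id.sub continuous_const).tendsto x
  have hev : fderiv ℝ (fun y => secondDiff h ξ (y, t)) =ᶠ[𝓝 x]
      fun y => secondDiff (fderiv ℝ h) ξ (y, t) := by
    filter_upwards [key2 x h0, c1.eventually (key2 _ h1), c2.eventually (key2 _ h2)] with y b0 b1 b2
      using (hasFDerivAt_secondDiff b0 b1 b2).fderiv
  rw [hev.fderiv_eq, (hasFDerivAt_secondDiff (key _ h0) (key _ h1) (key _ h2)).fderiv]
  simp [secondDiff]

theorem ContDiffAt.secondDiff {h : V → F} {x ξ : V} {t : ℝ} {k : WithTop ℕ∞}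
    (h0 : ContDiffAt ℝ k h x) (h1 : ContDiffAt ℝ k h (x + t • ξ))
    (h2 : ContDiffAt ℝ k h (x - t • ξ)) :
    ContDiffAt ℝ k (fun y => MongeApprox.secondDiff h ξ (y, t)) x := by
  have a1 : ContDiffAt ℝ k (fun y => h (y + t • ξ)) x :=
    ContDiffAt.comp x (f := fun y => y + t • ξ) h1 (by fun_prop)
  have a2 : ContDiffAt ℝ k (fun y => h (y - t • ξ)) x :=
    ContDiffAt.comp x (f := fun y => y - t • ξ) h2 (by fun_prop)
  exact ((a1.add a2).sub (h0.const_smul (2 : ℝ))).const_smul ((t ^ 2)⁻¹)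

end SecondDiff

/-- Factor `a = DᵀD`: the sum becomes a sum of values of `B` on the diagonal, one for each row of
`D`. -/
theorem sum_mul_bilin_nonneg {n : ℕ} {a : Matrix (Fin n) (Fin n) ℝ} (ha : a.PosSemidef)
    (B : E n →L[ℝ] E n →L[ℝ] ℝ) (hB : ∀ v, 0 ≤ B v v) :
    0 ≤ ∑ i, ∑ j, a i j * B (e i) (e j) := by
  obtain ⟨D, rfl⟩ := CStarAlgebra.nonneg_iff_eq_star_mul_self.1 ha.nonneg
  rw [Matrix.star_eq_conjTranspose]
  have : ∑ i, ∑ j, (D.conjTranspose * D) i j * B (e i) (e j) =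
      ∑ k, B (∑ i, D k i • e i) (∑ j, D k j • e j) := by
    simp only [Matrix.mul_apply, Matrix.conjTranspose_apply, star_trivial, map_sum, map_smul,
      sum_apply, smul_apply, smul_eq_mul, Finset.sum_mul,
      Finset.mul_sum]
    rw [Finset.sum_congr rfl fun i _ => Finset.sum_comm, Finset.sum_comm]
    refine Finset.sum_congr rfl fun k _ => ?_
    rw [Finset.sum_comm]
    refine Finset.sum_congr rfl fun i _ => Finset.sum_congr rfl fun j _ => ?_
    ring
  rw [this]
  exact Finset.sum_nonneg fun k _ => hB _

theorem hasFDerivAt_norm_sub_pow_four {n : ℕ} (x₀ x : E n) :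
    HasFDerivAt (fun y : E n => ‖y - x₀‖ ^ 4)
      ((‖x - x₀‖ ^ 2) • ((4 : ℝ) • innerSL ℝ (x - x₀))) x := by
  have h1 : HasFDerivAt (fun y : E n => ‖y - x₀‖ ^ 2) (2 • innerSL ℝ (x - x₀)) x := by
    simpa using ((hasFDerivAt_id x).sub_const x₀).norm_sq
  have h2 := h1.pow 2
  have e1 : (fun y : E n => ‖y - x₀‖ ^ 4) = fun y => (‖y - x₀‖ ^ 2) ^ 2 := by
    funext y; ring
  rw [e1]
  refine h2.congr_fderiv ?_
  ext v
  simp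
  ring

theorem fderiv_fderiv_norm_sub_pow_four {n : ℕ} (x₀ : E n) :
    fderiv ℝ (fderiv ℝ (fun y : E n => ‖y - x₀‖ ^ 4)) x₀ = 0 := by
  have h0 : fderiv ℝ (fun y : E n => ‖y - x₀‖ ^ 4) =
      fun x => (‖x - x₀‖ ^ 2) • ((4 : ℝ) • innerSL ℝ (x - x₀)) :=
    funext fun x => (hasFDerivAt_norm_sub_pow_four x₀ x).fderiv
  have h1 : HasFDerivAt (fun y : E n => ‖y - x₀‖ ^ 2) (2 • innerSL ℝ (x₀ - x₀)) x₀ := by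
    simpa using ((hasFDerivAt_id x₀).sub_const x₀).norm_sq
  have h2 : HasFDerivAt (fun y : E n => (4 : ℝ) • innerSL ℝ (y - x₀)) ((4 : ℝ) • innerSL ℝ) x₀ := by
    have := (innerSL ℝ (E := E n)).hasFDerivAt.comp x₀ ((hasFDerivAt_id x₀).sub_const x₀)
    exact this.const_smul (4 : ℝ)
  have h3 := h1.smul h2
  rw [h0]
  have := h3.fderiv
  simp only [sub_self] at this
  rw [show (fun x : E n => ‖x - x₀‖ ^ 2 • (4 : ℝ) • innerSL ℝ (x - x₀)) =
    ((fun y : E n => ‖y - x₀‖ ^ 2) • fun y : E n => (4 : ℝ) • innerSL ℝ (y - x₀)) from rfl, this]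
  ext v w
  simp

theorem ContDiffAt.hess {n : ℕ} {u : E n → ℝ} {x : E n} {k : WithTop ℕ∞}
    (hu : ContDiffAt ℝ (k + 2) u x) (v w : E n) :
    ContDiffAt ℝ k (fun y => fderiv ℝ (fderiv ℝ u) y v w) x := by
  have h1 : ContDiffAt ℝ (k + 1) (fderiv ℝ u) x :=
    hu.fderiv_right (by rw [add_assoc]; norm_num)
  have h2 : ContDiffAt ℝ k (fderiv ℝ (fderiv ℝ u)) x := h1.fderiv_right le_rfl
  exact (h2.clm_apply contDiffAt_const).clm_apply contDiffAt_const

/-- If the second difference quotients of `u` in the direction `ξ` are supersolutions of a linear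
elliptic equation, then `D²u ξ ξ` is a viscosity supersolution of the limit equation. -/
theorem sum_hess_le_of_touching {n : ℕ} {x₀ ξ : E n} {u ψ : E n → ℝ}
    {a : E n → Matrix (Fin n) (Fin n) ℝ} {R : ℝ}
    (hu : ∀ᶠ x in 𝓝 x₀, ContDiffAt ℝ 2 u x) (hψ : ContDiffAt ℝ 2 ψ x₀)
    (hle : ∀ᶠ x in 𝓝 x₀, ψ x ≤ fderiv ℝ (fderiv ℝ u) x ξ ξ)
    (heq : ψ x₀ = fderiv ℝ (fderiv ℝ u) x₀ ξ ξ)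
    (ha : ∀ᶠ x in 𝓝 x₀, (a x).PosSemidef) (hac : ContinuousAt a x₀)
    (hR : ∀ δ > 0, ∀ᶠ z in 𝓝 x₀ ×ˢ 𝓝[≠] 0,
      ∑ i, ∑ j, a z.1 i j * secondDiff (fun x => hess u x i j) ξ z ≤ R + δ) :
    ∑ i, ∑ j, a x₀ i j * hess ψ x₀ i j ≤ R := by
  -- The quartic makes the contact strict, which forces the approximate minimizers to converge to
  -- `x₀`, and it leaves the Hessian at `x₀` unchanged.
  set ψ' : E n → ℝ := fun x => ψ x - ‖x - x₀‖ ^ 4 with hψ'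
  have hN : ContDiff ℝ 2 (fun x : E n => ‖x - x₀‖ ^ 4) := by
    have : (fun y : E n => ‖y - x₀‖ ^ 4) = fun y => (‖y - x₀‖ ^ 2) ^ 2 := by
      funext y; ring
    rw [this]
    exact ((contDiff_id.sub contDiff_const).norm_sq ℝ).pow 2
  have hψ'C : ContDiffAt ℝ 2 ψ' x₀ := hψ.sub hN.contDiffAt
  have hev := ((hu.and hle).and (ha.and (hψ.eventually (by simp))))
  obtain ⟨r, hr, hball⟩ := Metric.eventually_nhds_iff_ball.1 hev
  set ρ := r / 3 with hρ
  have hρ0 : 0 < ρ := by positivity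
  set t : ℕ → ℝ := fun k => ρ / ((k + 1) * (‖ξ‖ + 1)) with ht
  have ht0 : ∀ k, 0 < t k := fun k => by positivity
  have htξ : ∀ k, ‖t k • ξ‖ ≤ ρ := by
    intro k
    rw [norm_smul, Real.norm_eq_abs, abs_of_pos (ht0 k), ht]
    simp only
    rw [div_mul_eq_mul_div, div_le_iff₀ (by positivity)]
    have : (0 : ℝ) ≤ k := Nat.cast_nonneg k
    have h2 : ‖ξ‖ ≤ (k + 1) * (‖ξ‖ + 1) := by nlinarith [norm_nonneg ξ]
    gcongr
  have httend : Tendsto t atTop (𝓝[≠] 0) := by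
    refine tendsto_nhdsWithin_iff.2 ⟨?_, Eventually.of_forall fun k => (ht0 k).ne'⟩
    have : Tendsto (fun k : ℕ => ρ / (‖ξ‖ + 1) * (1 / ((k : ℝ) + 1))) atTop
        (𝓝 (ρ / (‖ξ‖ + 1) * 0)) :=
      tendsto_one_div_add_atTop_nhds_zero_nat.const_mul _
    rw [mul_zero] at this
    refine this.congr fun k => ?_
    simp only [ht]
    field_simp
  have hin : ∀ x ∈ Metric.closedBall x₀ ρ, x ∈ Metric.ball x₀ r := fun x hx =>
    Metric.closedBall_subset_ball (by rw [hρ]; linarith) hx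
  have hinp : ∀ k, ∀ x ∈ Metric.closedBall x₀ ρ, x + t k • ξ ∈ Metric.ball x₀ r := by
    intro k x hx
    rw [mem_closedBall_iff_norm] at hx
    rw [mem_ball_iff_norm]
    calc ‖x + t k • ξ - x₀‖ = ‖(x - x₀) + t k • ξ‖ := by congr 1; abel
      _ ≤ ‖x - x₀‖ + ‖t k • ξ‖ := norm_add_le _ _
      _ < r := by linarith [htξ k]
  have hinm : ∀ k, ∀ x ∈ Metric.closedBall x₀ ρ, x - t k • ξ ∈ Metric.ball x₀ r := by
    intro k x hx
    rw [mem_closedBall_iff_norm] at hx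
    rw [mem_ball_iff_norm]
    calc ‖x - t k • ξ - x₀‖ = ‖(x - x₀) - t k • ξ‖ := by congr 1; abel
      _ ≤ ‖x - x₀‖ + ‖t k • ξ‖ := norm_sub_le _ _
      _ < r := by linarith [htξ k]
  have hψ'r : ∀ x ∈ Metric.ball x₀ r, ContDiffAt ℝ 2 ψ' x := fun x hx =>
    (hball x hx).2.2.sub hN.contDiffAt
  have hΦC : ∀ k, ∀ x ∈ Metric.closedBall x₀ ρ,
      ContDiffAt ℝ 2 (fun y => secondDiff u ξ (y, t k) - ψ' y) x := fun k x hx =>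
    (ContDiffAt.secondDiff (hball x (hin x hx)).1.1 (hball _ (hinp k x hx)).1.1
      (hball _ (hinm k x hx)).1.1).sub (hψ'r x (hin x hx))
  have hmin : ∀ k, ∃ x ∈ Metric.closedBall x₀ ρ,
      IsMinOn (fun y => secondDiff u ξ (y, t k) - ψ' y) (Metric.closedBall x₀ ρ) x := fun k =>
    (isCompact_closedBall x₀ ρ).exists_isMinOn ⟨x₀, Metric.mem_closedBall_self hρ0.le⟩
      fun x hx => (hΦC k x hx).continuousAt.continuousWithinAt
  choose X hXmem hXmin using hmin
  obtain ⟨y, hy, φ, hφ, hlim⟩ := (isCompact_closedBall x₀ ρ).tendsto_subseq hXmem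
  have htφ : Tendsto (fun k => t (φ k)) atTop (𝓝[≠] 0) := httend.comp hφ.tendsto_atTop
  -- Comparing the value at each minimizer with the value at `x₀` and passing to the limit gives `‖y
  -- - x₀‖⁴ ≤ 0`.
  have hy0 : y = x₀ := by
    have l1 : Tendsto (fun k => secondDiff u ξ (X (φ k), t (φ k)) - ψ' (X (φ k))) atTop
        (𝓝 (fderiv ℝ (fderiv ℝ u) y ξ ξ - ψ' y)) :=
      ((tendsto_secondDiff (hball y (hin y hy)).1.1 ξ).comp (hlim.prodMk htφ)).sub
        ((hψ'r y (hin y hy)).continuousAt.tendsto.comp hlim)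
    have hx0 : x₀ ∈ Metric.closedBall x₀ ρ := Metric.mem_closedBall_self hρ0.le
    have l2 : Tendsto (fun k => secondDiff u ξ (x₀, t (φ k)) - ψ' x₀) atTop
        (𝓝 (fderiv ℝ (fderiv ℝ u) x₀ ξ ξ - ψ' x₀)) :=
      ((tendsto_secondDiff (hball x₀ (hin x₀ hx0)).1.1 ξ).comp
        (tendsto_const_nhds.prodMk htφ)).sub tendsto_const_nhds
    have h3 := le_of_tendsto_of_tendsto' l1 l2 fun k => hXmin (φ k) hx0
    have h4 := (hball y (hin y hy)).1.2
    simp only [hψ', sub_self, norm_zero, heq] at h3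
    have h5 : ‖y - x₀‖ ^ 4 ≤ 0 := by
      norm_num at h3
      linarith
    have h6 : ‖y - x₀‖ = 0 := by
      have := le_antisymm h5 (by positivity)
      exact pow_eq_zero_iff (by norm_num) |>.1 this
    exact sub_eq_zero.1 (norm_eq_zero.1 h6)
  subst hy0
  have hessψ' : ∀ x ∈ Metric.ball y r, ∀ i j,
      ContinuousAt (fun x => fderiv ℝ (fderiv ℝ ψ') x (e i) (e j)) x := fun x hx i j =>
    (ContDiffAt.hess (k := 0) (by simpa using hψ'r x hx) (e i) (e j)).continuousAt
  have hess0 : ∀ i j, fderiv ℝ (fderiv ℝ ψ') y (e i) (e j) = hess ψ y i j := by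
    intro i j
    have h1 : fderiv ℝ ψ' =ᶠ[𝓝 y] fun x => fderiv ℝ ψ x - fderiv ℝ (fun x => ‖x - y‖ ^ 4) x := by
      filter_upwards [hψ.eventually (by simp)] with x hx
      exact fderiv_sub (hx.differentiableAt (by simp))
        (hN.contDiffAt.differentiableAt (by simp))
    rw [h1.fderiv_eq]
    have h2 := fderiv_sub (f := fderiv ℝ ψ) (g := fderiv ℝ (fun x => ‖x - y‖ ^ 4)) (x := y)
      ((hψ.fderiv_right (m := 1) (by norm_num)).differentiableAt (by simp))
      ((hN.contDiffAt.fderiv_right (m := 1) (by norm_num)).differentiableAt (by simp))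
    change fderiv ℝ (fderiv ℝ ψ - fderiv ℝ (fun x => ‖x - y‖ ^ 4)) y (e i) (e j) = _
    rw [h2, fderiv_fderiv_norm_sub_pow_four, sub_zero]
    rfl
  have hx0 : y ∈ Metric.ball y r := Metric.mem_ball_self hr
  refine le_of_forall_pos_le_add fun δ hδ => ?_
  have hconv : Tendsto (fun k => ∑ i, ∑ j, a (X (φ k)) i j *
      fderiv ℝ (fderiv ℝ ψ') (X (φ k)) (e i) (e j)) atTop
      (𝓝 (∑ i, ∑ j, a y i j * hess ψ y i j)) := by
    refine tendsto_finsetSum _ fun i _ => tendsto_finsetSum _ fun j _ => ?_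
    refine Tendsto.mul ?_ ?_
    · exact (((continuous_apply_apply i j).tendsto _).comp hac.tendsto).comp hlim
    · rw [← hess0]
      exact (hessψ' y hx0 i j).tendsto.comp hlim
  refine le_of_tendsto hconv ?_
  have hint : ∀ᶠ k in atTop, X (φ k) ∈ Metric.ball y ρ :=
    hlim.eventually (Metric.ball_mem_nhds _ hρ0)
  filter_upwards [hint, (hlim.prodMk htφ).eventually (hR δ hδ)] with k hk hRk
  have hk' := hin _ (hXmem (φ k))
  have hloc : IsLocalMin (fun y => secondDiff u ξ (y, t (φ k)) - ψ' y) (X (φ k)) :=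
    (hXmin (φ k)).isLocalMin (mem_of_superset (Metric.isOpen_ball.mem_nhds hk)
      Metric.ball_subset_closedBall)
  have hsd : ContDiffAt ℝ 2 (fun y => secondDiff u ξ (y, t (φ k))) (X (φ k)) :=
    ContDiffAt.secondDiff (hball _ hk').1.1 (hball _ (hinp (φ k) _ (hXmem (φ k)))).1.1
      (hball _ (hinm (φ k) _ (hXmem (φ k)))).1.1
  -- At the minimizer the quotient minus `ψ'` is `C²`, so the classical second derivative test
  -- applies although `u` need not have fourth derivatives.
  have hnn := sum_mul_bilin_nonneg (hball _ hk').2.1 _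
    (second_fderiv_nonneg_of_isLocalMin (hΦC (φ k) _ (hXmem (φ k))) hloc)
  have hsplit : ∀ v w, fderiv ℝ (fderiv ℝ (fun y => secondDiff u ξ (y, t (φ k)) - ψ' y))
      (X (φ k)) v w = secondDiff (fun y => fderiv ℝ (fderiv ℝ u) y v w) ξ (X (φ k), t (φ k)) -
        fderiv ℝ (fderiv ℝ ψ') (X (φ k)) v w := by
    intro v w
    rw [← fderiv_fderiv_secondDiff (hball _ hk').1.1
      (hball _ (hinp (φ k) _ (hXmem (φ k)))).1.1 (hball _ (hinm (φ k) _ (hXmem (φ k)))).1.1]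
    have h1 : fderiv ℝ (fun y => secondDiff u ξ (y, t (φ k)) - ψ' y) =ᶠ[𝓝 (X (φ k))]
        fderiv ℝ (fun y => secondDiff u ξ (y, t (φ k))) - fderiv ℝ ψ' := by
      filter_upwards [hsd.eventually (by simp), (hψ'r _ hk').eventually (by simp)] with x hx hx'
      exact fderiv_sub (hx.differentiableAt (by simp)) (hx'.differentiableAt (by simp))
    rw [h1.fderiv_eq, fderiv_sub
      ((hsd.fderiv_right (m := 1) (by norm_num)).differentiableAt (by simp))
      (((hψ'r _ hk').fderiv_right (m := 1) (by norm_num)).differentiableAt (by simp))]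
    rfl
  simp only [hsplit, mul_sub, Finset.sum_sub_distrib] at hnn
  have hRk' : ∑ i, ∑ j, a (X (φ k)) i j *
      secondDiff (fun y => fderiv ℝ (fderiv ℝ u) y (e i) (e j)) ξ (X (φ k), t (φ k)) ≤ R + δ := hRk
  linarith

end MongeApprox

namespace MongeApprox

/-! ### Simultaneous diagonalization and concavity of `log det` -/

section Frame

open Matrix

variable {n : ℕ} {A w P : Matrix (Fin n) (Fin n) ℝ} {lam : Fin n → ℝ}

/-- Simultaneous diagonalization of two positive definite matrices. -/
theorem exists_frame (hA : A.PosDef) (hw : w.PosDef) :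
    ∃ (P : Matrix (Fin n) (Fin n) ℝ) (lam : Fin n → ℝ),
      Pᵀ * A * P = 1 ∧ Pᵀ * w * P = diagonal lam ∧ ∀ i, 0 < lam i := by
  -- With `A = BᵀB`, the matrix `B⁻ᵀ w B⁻¹` is positive definite; if the orthogonal matrix `U`
  -- diagonalizes it, then `P = B⁻¹U` serves for both forms.
  obtain ⟨B, hB⟩ := CStarAlgebra.nonneg_iff_eq_star_mul_self.1 hA.posSemidef.nonneg
  rw [star_eq_conjTranspose, conjTranspose_eq_transpose_of_trivial] at hB
  have hBu : IsUnit B.det := by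
    have := hA.det_pos
    rw [hB, det_mul, det_transpose] at this
    exact isUnit_iff_ne_zero.2 fun h => by simp [h] at this
  have hBB : B * B⁻¹ = 1 := mul_nonsing_inv B hBu
  have hBB' : B⁻¹ᵀ * Bᵀ = 1 := by rw [← transpose_mul, hBB, transpose_one]
  have hS : (B⁻¹ᵀ * w * B⁻¹).PosDef := by
    have := hw.conjTranspose_mul_mul_same (B := B⁻¹) (mulVec_injective_iff_isUnit.2 (by
      rw [isUnit_iff_isUnit_det]
      exact isUnit_nonsing_inv_det B hBu))
    rwa [conjTranspose_eq_transpose_of_trivial] at this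
  set S := B⁻¹ᵀ * w * B⁻¹ with hSdef
  set U : Matrix (Fin n) (Fin n) ℝ :=
    (hS.isHermitian.eigenvectorUnitary).1 with hU
  have hUU : Uᵀ * U = 1 := by
    have := Unitary.coe_star_mul_self hS.isHermitian.eigenvectorUnitary
    rwa [star_eq_conjTranspose, conjTranspose_eq_transpose_of_trivial] at this
  have hspec : S = U * diagonal hS.isHermitian.eigenvalues * Uᵀ := by
    have := hS.isHermitian.spectral_theorem
    rw [Unitary.conjStarAlgAut_apply, star_eq_conjTranspose,
      conjTranspose_eq_transpose_of_trivial] at this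
    exact this
  have hpos := hS.eigenvalues_pos
  generalize hS.isHermitian.eigenvalues = lam at hspec hpos
  refine ⟨B⁻¹ * U, lam, ?_, ?_, hpos⟩
  · calc (B⁻¹ * U)ᵀ * A * (B⁻¹ * U) = Uᵀ * (B⁻¹ᵀ * Bᵀ) * (B * B⁻¹) * U := by
          rw [hB, transpose_mul]; simp only [Matrix.mul_assoc]
      _ = 1 := by rw [hBB, hBB', Matrix.mul_one, Matrix.mul_one, hUU]
  · calc (B⁻¹ * U)ᵀ * w * (B⁻¹ * U) = Uᵀ * S * U := by
          rw [hSdef, transpose_mul]; simp only [Matrix.mul_assoc]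
      _ = (Uᵀ * U) * diagonal lam * (Uᵀ * U) := by
          rw [hspec]; simp only [Matrix.mul_assoc]
      _ = _ := by rw [hUU, Matrix.one_mul, Matrix.mul_one]

theorem frame_inv (h1 : Pᵀ * A * P = 1) : A⁻¹ = P * Pᵀ := by
  refine inv_eq_left_inv ?_
  rw [Matrix.mul_assoc]
  exact mul_eq_one_comm.1 h1

theorem frame_inv_diagonal (h2 : Pᵀ * w * P = diagonal lam) (hlam : ∀ i, 0 < lam i) :
    w⁻¹ = P * diagonal (fun i => (lam i)⁻¹) * Pᵀ := by
  refine inv_eq_left_inv ?_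
  have : diagonal (fun i => (lam i)⁻¹) * (Pᵀ * w) * P = 1 := by
    rw [Matrix.mul_assoc, h2, diagonal_mul_diagonal, ← diagonal_one]
    congr 1
    funext i
    exact inv_mul_cancel₀ (hlam i).ne'
  have := mul_eq_one_comm.1 this
  simpa only [Matrix.mul_assoc] using this

theorem frame_inv_mul (h1 : Pᵀ * A * P = 1) (h2 : Pᵀ * w * P = diagonal lam) :
    A⁻¹ * w * P = P * diagonal lam := by
  rw [frame_inv h1, ← h2]
  simp only [Matrix.mul_assoc]

theorem frame_isUnit (h1 : Pᵀ * A * P = 1) : IsUnit P.det := by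
  have := congrArg det h1
  rw [det_mul, det_one] at this
  exact .of_mul_eq_one_right _ this

theorem frame_det (h1 : Pᵀ * A * P = 1) (h2 : Pᵀ * w * P = diagonal lam) :
    w.det = A.det * ∏ i, lam i := by
  have e1 := congrArg det h1
  have e2 := congrArg det h2
  rw [det_mul, det_mul, det_transpose] at e1 e2
  rw [det_one] at e1
  rw [det_diagonal] at e2
  rw [← e2]
  linear_combination (-w.det) * e1

theorem trace_frame (h2 : Pᵀ * w * P = diagonal lam) : (P * Pᵀ * w).trace = ∑ i, lam i := by
  rw [Matrix.mul_assoc, Matrix.trace_mul_comm, h2, trace_diagonal]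

theorem sum_mul_eq_trace (M X : Matrix (Fin n) (Fin n) ℝ) :
    ∑ i, ∑ j, M i j * X i j = (M * Xᵀ).trace := by
  simp [Matrix.trace, Matrix.mul_apply]

/-- Concavity of `log det` on positive definite matrices. -/
theorem log_det_le {w w' : Matrix (Fin n) (Fin n) ℝ} (hw : w.PosDef) (hw' : w'.PosDef) :
    Real.log w'.det ≤ Real.log w.det + ∑ i, ∑ j, w⁻¹ i j * (w' i j - w i j) := by
  -- In a basis orthonormal for `w` and diagonal for `w'` the claim is `∑ log λ_i ≤ ∑ (λ_i - 1)`.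
  obtain ⟨P, lam, h1, h2, hlam⟩ := exists_frame hw hw'
  have hsum : ∑ i, ∑ j, w⁻¹ i j * (w' i j - w i j) = ∑ i, (lam i - 1) := by
    have e1 := sum_mul_eq_trace w⁻¹ w'
    have e2 := sum_mul_eq_trace w⁻¹ w
    have t1 : w'ᵀ = w' := by simpa using hw'.isHermitian.eq
    have t2 : wᵀ = w := by simpa using hw.isHermitian.eq
    rw [t1, frame_inv h1, trace_frame h2] at e1
    rw [t2, nonsing_inv_mul _ (isUnit_iff_ne_zero.2 hw.det_pos.ne')] at e2
    simp only [mul_sub, Finset.sum_sub_distrib]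
    rw [e2, ← e1, frame_inv h1]
    simp
  rw [hsum, frame_det h1 h2, Real.log_mul hw.det_pos.ne' (Finset.prod_pos fun i _ => hlam i).ne',
    Real.log_prod (fun i _ => (hlam i).ne')]
  gcongr with i
  exact Real.log_le_sub_one_of_pos (hlam i)

theorem exists_basis_of_frame (h1 : Pᵀ * A * P = 1) (h2 : Pᵀ * w * P = diagonal lam) :
    ∃ b : Module.Basis (Fin n) ℝ (Fin n → ℝ), ∀ i, (A⁻¹ * w).mulVec (b i) = lam i • b i := by
  have hP := frame_isUnit h1
  have hinv : Invertible P := P.invertibleOfIsUnitDet hP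
  refine ⟨(Pi.basisFun ℝ (Fin n)).map (toLin'OfInv (M := P⁻¹) (M' := P)
    (nonsing_inv_mul P hP) (mul_nonsing_inv P hP)), fun i => ?_⟩
  have hb : ((Pi.basisFun ℝ (Fin n)).map (toLin'OfInv (M := P⁻¹) (M' := P)
    (nonsing_inv_mul P hP) (mul_nonsing_inv P hP))) i = P *ᵥ Pi.single i 1 := by
    simp [toLin'OfInv]
  rw [hb, mulVec_mulVec, frame_inv_mul h1 h2, ← mulVec_mulVec, diagonal_mulVec_single, mul_one,
    ← mulVec_smul, ← Pi.single_smul, smul_eq_mul, mul_one]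

theorem eigenvalue_mem_frame (h1 : Pᵀ * A * P = 1) (h2 : Pᵀ * w * P = diagonal lam) {μ : ℝ}
    (hμ : Module.End.HasEigenvalue (toLin' (A⁻¹ * w)) μ) : ∃ j, μ = lam j := by
  obtain ⟨v, hv⟩ := hμ.exists_hasEigenvector
  have hv1 := hv.apply_eq_smul
  rw [toLin'_apply] at hv1
  have hP := frame_isUnit h1
  set y := P⁻¹ *ᵥ v with hy
  have hPy : P *ᵥ y = v := by
    rw [hy, mulVec_mulVec, mul_nonsing_inv P hP, one_mulVec]
  have hd : diagonal lam *ᵥ y = μ • y := by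
    have : P *ᵥ (diagonal lam *ᵥ y) = P *ᵥ (μ • y) := by
      rw [mulVec_mulVec, ← frame_inv_mul h1 h2, ← mulVec_mulVec, hPy, hv1, mulVec_smul, hPy]
    have := congrArg (P⁻¹ *ᵥ ·) this
    simpa only [mulVec_mulVec, nonsing_inv_mul_cancel_left _ _ hP, nonsing_inv_mul P hP,
      one_mulVec] using this
  have hy0 : y ≠ 0 := fun h => hv.2 (by rw [← hPy, h, mulVec_zero])
  obtain ⟨j, hj⟩ := Function.ne_iff.1 hy0
  refine ⟨j, ?_⟩
  have := congrFun hd j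
  rw [mulVec_diagonal, Pi.smul_apply, smul_eq_mul] at this
  exact (mul_right_cancel₀ hj this).symm

end Frame

end MongeApprox

namespace MongeApprox

/-! ### The matrices as bilinear forms -/

section Coordinates

variable {n : ℕ}

theorem sum_smul_e (v : E n) : ∑ i, v i • e i = v := by
  ext j
  simp [e, Pi.single_apply]

theorem inner_e (v : E n) (i : Fin n) : ⟪v, e i⟫ = v i := by
  simp [e, EuclideanSpace.inner_single_right]

theorem e_apply (i j : Fin n) : (e i : E n) j = if j = i then 1 else 0 := by
  simp [e]

/-- The bilinear form on `ℝⁿ` with matrix `M`. -/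
noncomputable def bil (M : Matrix (Fin n) (Fin n) ℝ) (a b : E n) : ℝ :=
  ∑ i, ∑ j, M i j * (a i * b j)

theorem inner_eq_sum (a b : E n) : ⟪a, b⟫ = ∑ i, a i * b i := by
  simp [PiLp.inner_apply, mul_comm]

theorem bil_e (M : Matrix (Fin n) (Fin n) ℝ) (i j : Fin n) : bil M (e i) (e j) = M i j := by
  simp [bil, e_apply]

theorem bil_hess (u : E n → ℝ) (x a b : E n) :
    bil (hess u x) a b = fderiv ℝ (fderiv ℝ u) x a b := by
  conv_rhs => rw [← sum_smul_e a, ← sum_smul_e b]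
  simp only [map_sum, map_smul, sum_apply, smul_apply, smul_eq_mul, bil, hess, Matrix.of_apply,
    Finset.mul_sum]
  rw [Finset.sum_comm]
  refine Finset.sum_congr rfl fun i _ => Finset.sum_congr rfl fun j _ => ?_
  ring

theorem bil_A (ε : ℝ) (u : E n → ℝ) (x a b : E n) :
    bil (A ε u x) a b =
      (⟪a, b⟫ - ⟪gradient u x, a⟫ * ⟪gradient u x, b⟫) / L ε u x := by
  have h1 : ⟪a, b⟫ = ∑ i, ∑ j, (if i = j then (1 : ℝ) else 0) * (a i * b j) := by
    simp [inner_eq_sum]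
  have h2 : ⟪gradient u x, a⟫ * ⟪gradient u x, b⟫ =
      ∑ i, ∑ j, (gradient u x i * gradient u x j) * (a i * b j) := by
    rw [inner_eq_sum, inner_eq_sum, Finset.sum_mul_sum]
    refine Finset.sum_congr rfl fun i _ => Finset.sum_congr rfl fun j _ => ?_
    ring
  rw [h1, h2, ← Finset.sum_sub_distrib, Finset.sum_div]
  simp only [← Finset.sum_sub_distrib, Finset.sum_div]
  refine Finset.sum_congr rfl fun i _ => Finset.sum_congr rfl fun j _ => ?_
  simp only [A, Matrix.of_apply]
  ring

theorem bil_sub (M N : Matrix (Fin n) (Fin n) ℝ) (a b : E n) :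
    bil (M - N) a b = bil M a b - bil N a b := by
  simp only [bil, Matrix.sub_apply, sub_mul, Finset.sum_sub_distrib]

theorem bil_w (ε : ℝ) (u : E n → ℝ) (x a b : E n) :
    bil (w ε u x) a b = bil (A ε u x) a b - fderiv ℝ (fderiv ℝ u) x a b := by
  rw [w, bil_sub, bil_hess]

theorem dotProduct_mulVec_eq_bil (M : Matrix (Fin n) (Fin n) ℝ) (v : Fin n → ℝ) :
    star v ⬝ᵥ M.mulVec v = bil M (WithLp.toLp 2 v) (WithLp.toLp 2 v) := by
  simp only [dotProduct, Matrix.mulVec, bil, star_trivial, Finset.mul_sum]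
  refine Finset.sum_congr rfl fun i _ => Finset.sum_congr rfl fun j _ => ?_
  ring

/-- `A` is a multiple of a rank-one perturbation of the identity. -/
theorem det_A (ε : ℝ) (u : E n → ℝ) (x : E n) :
    (A ε u x).det = (1 / L ε u x) ^ n * (1 - ‖gradient u x‖ ^ 2) := by
  have h : A ε u x = (1 / L ε u x) • (1 + Matrix.replicateCol Unit (-(gradient u x).ofLp) *
      Matrix.replicateRow Unit (gradient u x).ofLp) := by
    ext i j
    simp [A, Matrix.mul_apply, Matrix.one_apply, sub_eq_add_neg]
  rw [h, Matrix.det_smul, Matrix.det_one_add_replicateCol_mul_replicateRow, Fintype.card_fin,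
    ← real_inner_self_eq_norm_sq, inner_eq_sum]
  simp [dotProduct, sub_eq_add_neg]

end Coordinates

/-! ### Expansion of `√(1 - |Du|²)` and `L` along a curve of gradients -/

section GradientCurve

variable {G : Type*} [NormedAddCommGroup G] [InnerProductSpace ℝ G]
  {P : ℝ → G} {p p1 p2 : G} {s ε : ℝ}

theorem Jet2.one_sub_norm_sq (hP : Jet2 P p p1 p2) :
    Jet2 (fun τ => 1 - ‖P τ‖ ^ 2) (1 - ‖p‖ ^ 2) (-2 * ⟪p, p1⟫)
      (-2 * (‖p1‖ ^ 2 + ⟪p, p2⟫)) := by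
  have h := (Jet2.const (1 : ℝ)).sub (hP.inner hP)
  simp only [real_inner_self_eq_norm_sq] at h
  convert h using 1
  · rw [real_inner_comm p1 p]; ring
  · rw [real_inner_comm p2 p]; ring

theorem Jet2.sqrt_one_sub_norm_sq (hP : Jet2 P p p1 p2) (hs : 0 < s) (hps : 1 - ‖p‖ ^ 2 = s ^ 2) :
    Jet2 (fun τ => Real.sqrt (1 - ‖P τ‖ ^ 2)) s (-⟪p, p1⟫ / s)
      (-(‖p1‖ ^ 2 + ⟪p, p2⟫) / s - ⟪p, p1⟫ ^ 2 / s ^ 3) := by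
  convert hP.one_sub_norm_sq.sqrt hs hps using 1
  · field_simp
  · field_simp; ring

theorem Jet2.lorentz (hP : Jet2 P p p1 p2) (hs : 0 < s) (hps : 1 - ‖p‖ ^ 2 = s ^ 2) :
    Jet2 (fun τ => ε / Real.sqrt (1 - ‖P τ‖ ^ 2)) (ε / s) (ε * ⟪p, p1⟫ / s ^ 3)
      (ε * (‖p1‖ ^ 2 + ⟪p, p2⟫) / s ^ 3 + 3 * ε * ⟪p, p1⟫ ^ 2 / s ^ 5) := by
  have h := (Jet2.const ε).mul ((hP.sqrt_one_sub_norm_sq hs hps).inv hs.ne')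
  simp only [div_eq_mul_inv ε]
  convert h using 1
  · field_simp; ring
  · field_simp; ring

end GradientCurve

/-! ### Contact points of `c_ε`-concave functions -/

section Contact

variable {n : ℕ} {ε : ℝ} {Ω Ωs : Set (E n)} {u : E n → ℝ} {x : E n}

/-- Almost optimal `y` for the infimum at `x` lie in a bounded set; a limit of them supports `u`
from above. The function `φ` drops out on comparing the values at `z` and `x`, so no regularity of
`φ` is needed. The limit lies a priori only in the closure of `Ωs`. -/
theorem IsCConcave.exists_contact (h : IsCConcave ε Ω Ωs u) (hΩs : Bornology.IsBounded Ωs)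
    (hx : x ∈ Ω) : ∃ y : E n, ∀ z ∈ Ω, u z ≤ u x + cost ε z y - cost ε x y := by
  obtain ⟨S, hS, φ, hφ⟩ := h
  have hex : ∀ k : ℕ, ∃ y ∈ S, cost ε x y - φ y < u x + 1 / ((k : ℝ) + 1) := by
    intro k
    have hk : u x < u x + 1 / ((k : ℝ) + 1) := by
      have : (0 : ℝ) < 1 / ((k : ℝ) + 1) := by positivity
      linarith
    obtain ⟨_, ⟨y, hy, rfl⟩, -, hlt⟩ := (hφ x hx).exists_between hk
    exact ⟨y, hy, hlt⟩
  choose Y hYS hY using hex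
  have hcpt : IsCompact (closure Ωs) := hΩs.isCompact_closure
  obtain ⟨y, -, σ, hσ, hlim⟩ := hcpt.tendsto_subseq fun k => subset_closure (hS (hYS k))
  refine ⟨y, fun z hz => ?_⟩
  have hc : ∀ z : E n, Continuous fun y => cost ε z y := fun z => by
    unfold cost; fun_prop
  have l1 : Tendsto (fun k => u x + cost ε z (Y (σ k)) - cost ε x (Y (σ k)) +
      1 / ((σ k : ℝ) + 1)) atTop (𝓝 (u x + cost ε z y - cost ε x y + 0)) := by
    refine ((((hc z).tendsto y).comp hlim).const_add (u x)).sub (((hc x).tendsto y).comp hlim)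
      |>.add ?_
    exact tendsto_one_div_add_atTop_nhds_zero_nat.comp hσ.tendsto_atTop
  rw [add_zero] at l1
  refine ge_of_tendsto' l1 fun k => ?_
  have h1 := (hφ z hz).1 ⟨Y (σ k), hYS _, rfl⟩
  have h2 := hY (σ k)
  simp only at h1
  linarith

theorem cost_pos (hε : 0 < ε) (x y : E n) : 0 < cost ε x y :=
  Real.sqrt_pos.2 (by positivity)

theorem cost_sq (x y : E n) : cost ε x y ^ 2 = ε ^ 2 + ‖x - y‖ ^ 2 :=
  Real.sq_sqrt (by positivity)

theorem jet2_cost (hε : 0 < ε) (x y ζ : E n) :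
    Jet2 (fun τ : ℝ => cost ε (x + τ • ζ) y) (cost ε x y) (⟪x - y, ζ⟫ / cost ε x y)
      ((‖ζ‖ ^ 2 - (⟪x - y, ζ⟫ / cost ε x y) ^ 2) / cost ε x y) := by
  have hl := (Jet2.line x ζ).sub (Jet2.const y)
  simp only [sub_zero] at hl
  have h := ((Jet2.const (ε ^ 2)).add (hl.inner hl)).sqrt (cost_pos hε x y)
    (by rw [cost_sq, real_inner_self_eq_norm_sq])
  simp only [real_inner_self_eq_norm_sq] at h
  have hc := (cost_pos hε x y).ne'
  convert h using 1
  · rfl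
  · rw [real_inner_comm (x - y) ζ]; field_simp; ring
  · rw [real_inner_comm (x - y) ζ]; simp only [inner_zero_left, inner_zero_right]
    field_simp; ring

theorem contDiff_cost {k : WithTop ℕ∞} (hε : 0 < ε) (y : E n) :
    ContDiff ℝ k (fun x => cost ε x y) := by
  unfold cost
  refine ContDiff.sqrt ?_ fun x => by positivity
  exact contDiff_const.add ((contDiff_id.sub contDiff_const).norm_sq ℝ)

theorem fderiv_cost (hε : 0 < ε) (x y ζ : E n) :
    fderiv ℝ (fun z => cost ε z y) x ζ = ⟪x - y, ζ⟫ / cost ε x y :=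
  ((ContDiffAt.jet2 (contDiff_cost hε y).contDiffAt ζ).unique (jet2_cost hε x y ζ)).2.1

theorem fderiv_fderiv_cost (hε : 0 < ε) (x y ζ : E n) :
    fderiv ℝ (fderiv ℝ (fun z => cost ε z y)) x ζ ζ =
      (‖ζ‖ ^ 2 - (⟪x - y, ζ⟫ / cost ε x y) ^ 2) / cost ε x y :=
  ((ContDiffAt.jet2 (contDiff_cost hε y).contDiffAt ζ).unique (jet2_cost hε x y ζ)).2.2

variable {y : E n}

theorem isLocalMin_cost_sub (hx : Ω ∈ 𝓝 x)
    (hy : ∀ z ∈ Ω, u z ≤ u x + cost ε z y - cost ε x y) :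
    IsLocalMin (fun z => cost ε z y - u z) x := by
  filter_upwards [hx] with z hz
  have := hy z hz
  linarith

theorem gradient_of_contact (hε : 0 < ε) (hx : Ω ∈ 𝓝 x) (hu : DifferentiableAt ℝ u x)
    (hy : ∀ z ∈ Ω, u z ≤ u x + cost ε z y - cost ε x y) :
    gradient u x = (cost ε x y)⁻¹ • (x - y) := by
  have hd : DifferentiableAt ℝ (fun z => cost ε z y) x :=
    (contDiff_cost (k := 1) hε y).contDiffAt.differentiableAt (by simp)
  have h0 := (isLocalMin_cost_sub hx hy).hasFDerivAt_eq_zero (hd.hasFDerivAt.sub hu.hasFDerivAt)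
  refine ext_inner_right ℝ fun v => ?_
  rw [inner_gradient_left, sub_eq_zero.1 h0 |>.symm, fderiv_cost hε, inner_smul_left]
  simp [div_eq_inv_mul]

theorem one_sub_norm_gradient_sq_of_contact (hε : 0 < ε) (hx : Ω ∈ 𝓝 x)
    (hu : DifferentiableAt ℝ u x) (hy : ∀ z ∈ Ω, u z ≤ u x + cost ε z y - cost ε x y) :
    1 - ‖gradient u x‖ ^ 2 = (ε / cost ε x y) ^ 2 := by
  have hc := cost_pos hε x y
  rw [gradient_of_contact hε hx hu hy, norm_smul, norm_inv, Real.norm_eq_abs, abs_of_pos hc,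
    mul_pow, inv_pow, div_pow, cost_sq]
  have := hc.ne'
  have h2 : ε ^ 2 + ‖x - y‖ ^ 2 ≠ 0 := by positivity
  field_simp
  ring

theorem L_of_contact (hε : 0 < ε) (hx : Ω ∈ 𝓝 x) (hu : DifferentiableAt ℝ u x)
    (hy : ∀ z ∈ Ω, u z ≤ u x + cost ε z y - cost ε x y) : L ε u x = cost ε x y := by
  have hc := cost_pos hε x y
  rw [L, one_sub_norm_gradient_sq_of_contact hε hx hu hy, Real.sqrt_sq (by positivity)]
  field_simp

/-- Solving `Du = (x - y)/c_ε(x,y)` for `y` shows that the contact point is determined by `Du(x)`.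
Once `T` is known to map into `Ωs`, so does the contact point lie there. -/
theorem T_of_contact (hε : 0 < ε) (hx : Ω ∈ 𝓝 x) (hu : DifferentiableAt ℝ u x)
    (hy : ∀ z ∈ Ω, u z ≤ u x + cost ε z y - cost ε x y) : T ε u x = y := by
  have hc := cost_pos hε x y
  rw [T, L_of_contact hε hx hu hy, gradient_of_contact hε hx hu hy, smul_smul,
    mul_inv_cancel₀ hc.ne', one_smul, sub_sub_cancel]

/-- At a contact point `A` is the Hessian of the cost in `x`, so `w` is the Hessian of `c_ε(·,y) -
u` at a local minimum. -/
theorem bil_w_nonneg_of_contact (hε : 0 < ε) (hx : Ω ∈ 𝓝 x) (hu : ContDiffAt ℝ 2 u x)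
    (hy : ∀ z ∈ Ω, u z ≤ u x + cost ε z y - cost ε x y) (ζ : E n) : 0 ≤ bil (w ε u x) ζ ζ := by
  have hd := hu.differentiableAt (by simp)
  have h := ((ContDiffAt.jet2 (contDiff_cost hε y).contDiffAt ζ).sub
    (ContDiffAt.jet2 hu ζ)).nonneg_of_isLocalMin (by
      filter_upwards [eventually_add_smul ζ (isLocalMin_cost_sub hx hy)] with τ hτ
      simpa using hτ)
  have h2 := h.2
  rw [fderiv_fderiv_cost hε] at h2
  rw [bil_w, bil_A, L_of_contact hε hx hd hy, gradient_of_contact hε hx hd hy, inner_smul_left,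
    real_inner_self_eq_norm_sq]
  convert h2 using 3
  simp only [conj_trivial]
  ring

end Contact

end MongeApprox

/-! ### Derivatives of `Du`, `T` and `A`; frames -/

namespace MongeApprox

theorem Jet2.clm {V W : Type*} [NormedAddCommGroup V] [NormedSpace ℝ V] [NormedAddCommGroup W]
    [NormedSpace ℝ W] {f : ℝ → V} {a b c : V} (h : Jet2 f a b c) (ℓ : V →L[ℝ] W) :
    Jet2 (fun τ => ℓ (f τ)) (ℓ a) (ℓ b) (ℓ c) := by
  obtain ⟨h0, f1, h1, h2, h3⟩ := h
  refine ⟨by simp only [h0], fun τ => ℓ (f1 τ), ?_, by simp only [h2], ℓ.hasFDerivAt.comp_hasDerivAt 0 h3⟩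
  filter_upwards [h1] with τ h using ℓ.hasFDerivAt.comp_hasDerivAt τ h

/-- `u` is of class `C³` near `x`, `|Du(x)| < 1` and `ε > 0`, so that `L`, `T` and `A` make sense. -/
structure Admissible {n : ℕ} (ε : ℝ) (u : E n → ℝ) (x : E n) : Prop where
  eps_pos : 0 < ε
  smooth : ContDiffAt ℝ 3 u x
  norm_sq_lt : ‖gradient u x‖ ^ 2 < 1

/-- The third derivative of `u`. -/
noncomputable abbrev third {n : ℕ} (u : E n → ℝ) (x a b c : E n) : ℝ :=
  fderiv ℝ (fderiv ℝ (fderiv ℝ u)) x a b c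

section Gradient

variable {n : ℕ} {u : E n → ℝ} {x : E n}

theorem gradient_eq_sum (u : E n → ℝ) :
    gradient u = fun x => ∑ i, fderiv ℝ u x (e i) • (e i : E n) := by
  funext x
  conv_lhs => rw [← sum_smul_e (gradient u x)]
  refine Finset.sum_congr rfl fun i _ => ?_
  rw [← inner_e, inner_gradient_left]

theorem ContDiffAt.gradient {k : WithTop ℕ∞} (hu : ContDiffAt ℝ (k + 1) u x) :
    ContDiffAt ℝ k (gradient u) x := by
  rw [gradient_eq_sum]
  have h1 : ContDiffAt ℝ k (fderiv ℝ u) x := hu.fderiv_right le_rfl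
  exact ContDiffAt.sum fun i _ => (h1.clm_apply contDiffAt_const).smul contDiffAt_const

theorem jet2_gradient (hu : ContDiffAt ℝ 3 u x) (ζ : E n) :
    ∃ p1 p2 : E n, Jet2 (fun τ : ℝ => gradient u (x + τ • ζ)) (gradient u x) p1 p2 ∧
      (∀ a, ⟪p1, a⟫ = fderiv ℝ (fderiv ℝ u) x ζ a) ∧ ∀ a, ⟪p2, a⟫ = third u x ζ ζ a := by
  have hG : ContDiffAt ℝ 2 (gradient u) x := ContDiffAt.gradient (by norm_num; exact hu)
  have hD : ContDiffAt ℝ 2 (fderiv ℝ u) x := hu.fderiv_right (by norm_num)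
  have j1 := ContDiffAt.jet2 hG ζ
  have j2 := ContDiffAt.jet2 hD ζ
  have key : ∀ a, _ := fun a => (j1.inner (Jet2.const a)).unique ((j2.clm
    (ContinuousLinearMap.apply ℝ ℝ a)).congr (Eventually.of_forall fun τ => by
      simp [inner_gradient_left]))
  refine ⟨_, _, j1, fun a => ?_, fun a => ?_⟩
  · simpa using (key a).2.1
  · simpa using (key a).2.2

theorem hess_symm (hu : ContDiffAt ℝ 2 u x) (a b : E n) :
    fderiv ℝ (fderiv ℝ u) x a b = fderiv ℝ (fderiv ℝ u) x b a :=
  (hu.isSymmSndFDerivAt (by simp)).eq a b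

theorem third_swap_left (hu : ContDiffAt ℝ 3 u x) (a b c : E n) :
    third u x a b c = third u x b a c := by
  have hD : ContDiffAt ℝ 2 (fderiv ℝ u) x := hu.fderiv_right (by norm_num)
  have := (hD.isSymmSndFDerivAt (by simp)).eq a b
  exact congrArg (fun ℓ => ℓ c) this

theorem hasFDerivAt_hess (hu : ContDiffAt ℝ 3 u x) (b c : E n) :
    ∃ ℓ : E n →L[ℝ] ℝ, HasFDerivAt (fun y => fderiv ℝ (fderiv ℝ u) y b c) ℓ x ∧
      ∀ a, ℓ a = third u x a b c := by
  have hD : ContDiffAt ℝ 2 (fderiv ℝ u) x := hu.fderiv_right (by norm_num)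
  have hH := ((hD.fderiv_right (m := 1) (by norm_num)).differentiableAt (by simp)).hasFDerivAt
  refine ⟨_, (hH.clm_apply (hasFDerivAt_const b x)).clm_apply (hasFDerivAt_const c x), fun a => ?_⟩
  simp

theorem third_swap_right (hu : ContDiffAt ℝ 3 u x) (a b c : E n) :
    third u x a b c = third u x a c b := by
  obtain ⟨ℓ, h1, h2⟩ := hasFDerivAt_hess hu b c
  obtain ⟨ℓ', h1', h2'⟩ := hasFDerivAt_hess hu c b
  have : (fun y => fderiv ℝ (fderiv ℝ u) y b c) =ᶠ[𝓝 x] fun y => fderiv ℝ (fderiv ℝ u) y c b := by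
    filter_upwards [hu.eventually (by simp)] with y hy
    exact hess_symm (hy.of_le (by norm_num)) b c
  rw [← h2, ← h2', h1.unique (h1'.congr_of_eventuallyEq this)]

theorem third_rotate (hu : ContDiffAt ℝ 3 u x) (a c : E n) :
    third u x a a c = third u x c a a := by
  rw [third_swap_right hu, third_swap_left hu]

end Gradient

namespace Admissible

variable {n : ℕ} {ε : ℝ} {u : E n → ℝ} {x : E n}

theorem sqrt_pos (h : Admissible ε u x) : 0 < Real.sqrt (1 - ‖gradient u x‖ ^ 2) :=
  Real.sqrt_pos.2 (by linarith [h.norm_sq_lt])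

theorem sqrt_sq (h : Admissible ε u x) :
    1 - ‖gradient u x‖ ^ 2 = Real.sqrt (1 - ‖gradient u x‖ ^ 2) ^ 2 :=
  (Real.sq_sqrt (by linarith [h.norm_sq_lt])).symm

theorem L_pos (h : Admissible ε u x) : 0 < L ε u x := div_pos h.eps_pos h.sqrt_pos

theorem one_sub_norm_sq (h : Admissible ε u x) :
    1 - ‖gradient u x‖ ^ 2 = ε ^ 2 / L ε u x ^ 2 := by
  have h1 := h.sqrt_pos
  have h2 := h.eps_pos
  rw [L, div_pow, ← h.sqrt_sq]
  have : 1 - ‖gradient u x‖ ^ 2 ≠ 0 := by linarith [h.norm_sq_lt]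
  field_simp

theorem eps_le_L (h : Admissible ε u x) : ε ≤ L ε u x := by
  have h1 := h.one_sub_norm_sq
  have h2 := h.L_pos
  have h3 := h.eps_pos
  by_contra! hlt
  have : 1 < ε ^ 2 / L ε u x ^ 2 := by
    rw [one_lt_div (by positivity)]
    gcongr
  nlinarith [sq_nonneg ‖gradient u x‖]

theorem bil_A_pos (h : Admissible ε u x) {a : E n} (ha : a ≠ 0) : 0 < bil (A ε u x) a a := by
  rw [bil_A]
  refine div_pos ?_ h.L_pos
  have h1 := abs_real_inner_le_norm (gradient u x) a
  have h2 : ⟪gradient u x, a⟫ ^ 2 ≤ ‖gradient u x‖ ^ 2 * ‖a‖ ^ 2 := by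
    rw [← mul_pow, ← sq_abs]; gcongr
  have h3 : 0 < ‖a‖ ^ 2 := by positivity
  rw [real_inner_self_eq_norm_sq]
  nlinarith [h.norm_sq_lt]

/-- By Cauchy–Schwarz `A` is bounded below by `(1 - |Du|²)/L`, which equals `ε²/L³`. -/
theorem norm_sq_le_bil_A (h : Admissible ε u x) (a : E n) :
    ‖a‖ ^ 2 ≤ L ε u x ^ 3 / ε ^ 2 * bil (A ε u x) a a := by
  have hL := h.L_pos
  have hε := h.eps_pos
  rw [bil_A]
  have h1 := abs_real_inner_le_norm (gradient u x) a
  have h2 : ⟪gradient u x, a⟫ ^ 2 ≤ ‖gradient u x‖ ^ 2 * ‖a‖ ^ 2 := by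
    rw [← mul_pow, ← sq_abs]; gcongr
  have h3 := h.one_sub_norm_sq
  rw [eq_div_iff (by positivity)] at h3
  rw [real_inner_self_eq_norm_sq, div_mul_div_comm, le_div_iff₀ (by positivity)]
  have h4 : 0 < L ε u x ^ 3 := by positivity
  calc ‖a‖ ^ 2 * (ε ^ 2 * L ε u x) = L ε u x ^ 3 * (‖a‖ ^ 2 - ‖gradient u x‖ ^ 2 * ‖a‖ ^ 2) := by
        rw [← h3]; ring
    _ ≤ _ := by
        exact mul_le_mul_of_nonneg_left (by nlinarith) h4.le

theorem posDef_A (h : Admissible ε u x) : (A ε u x).PosDef := by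
  refine Matrix.PosDef.of_dotProduct_mulVec_pos ?_ fun v hv => ?_
  · ext i j
    simp only [Matrix.conjTranspose_apply, star_trivial, A, Matrix.of_apply, eq_comm (a := i)]
    ring
  · rw [dotProduct_mulVec_eq_bil]
    refine h.bil_A_pos fun h0 => hv ?_
    simpa using congrArg WithLp.ofLp h0

/-- This is exactly the prefactor in the equation, so `det (A⁻¹w)` involves neither `ε` nor `L`
explicitly. -/
theorem det_A (h : Admissible ε u x) : (A ε u x).det = ε ^ 2 / L ε u x ^ (n + 2) := by
  have := h.L_pos
  rw [MongeApprox.det_A, h.one_sub_norm_sq, one_div, inv_pow, pow_add]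
  field_simp

theorem isHermitian_w (h : Admissible ε u x) : (w ε u x).IsHermitian := by
  refine h.posDef_A.isHermitian.sub ?_
  ext i j
  simp only [Matrix.conjTranspose_apply, star_trivial, hess, Matrix.of_apply]
  exact hess_symm (h.smooth.of_le (by norm_num)) _ _

theorem contDiffAt_gradient (h : Admissible ε u x) : ContDiffAt ℝ 2 (gradient u) x :=
  ContDiffAt.gradient (by norm_num; exact h.smooth)

theorem eventually (h : Admissible ε u x) : ∀ᶠ y in 𝓝 x, Admissible ε u y := by
  have : ContinuousAt (fun y => ‖gradient u y‖ ^ 2) x :=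
    h.contDiffAt_gradient.continuousAt.norm.pow 2
  filter_upwards [h.smooth.eventually (by simp), this.eventually (gt_mem_nhds h.norm_sq_lt)]
    with y h1 h2 using ⟨h.eps_pos, h1, h2⟩

theorem contDiffAt_sqrt (h : Admissible ε u x) :
    ContDiffAt ℝ 2 (fun y => Real.sqrt (1 - ‖gradient u y‖ ^ 2)) x :=
  (contDiffAt_const.sub (h.contDiffAt_gradient.norm_sq ℝ)).sqrt
    (by linarith [h.norm_sq_lt])

theorem contDiffAt_L (h : Admissible ε u x) : ContDiffAt ℝ 2 (L ε u) x :=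
  contDiffAt_const.div h.contDiffAt_sqrt h.sqrt_pos.ne'

theorem contDiffAt_T (h : Admissible ε u x) : ContDiffAt ℝ 2 (T ε u) x :=
  contDiffAt_id.sub (h.contDiffAt_L.smul h.contDiffAt_gradient)

theorem contDiffAt_bil_A (h : Admissible ε u x) (a b : E n) :
    ContDiffAt ℝ 2 (fun y => bil (A ε u y) a b) x := by
  simp only [bil_A]
  refine ContDiffAt.div ?_ h.contDiffAt_L h.L_pos.ne'
  exact contDiffAt_const.sub ((h.contDiffAt_gradient.inner ℝ contDiffAt_const).mul
    (h.contDiffAt_gradient.inner ℝ contDiffAt_const))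

theorem contDiffAt_A (h : Admissible ε u x) (i j : Fin n) :
    ContDiffAt ℝ 2 (fun y => A ε u y i j) x := by
  simpa only [bil_e] using h.contDiffAt_bil_A (e i) (e j)

theorem contDiffAt_w (h : Admissible ε u x) (i j : Fin n) :
    ContDiffAt ℝ 1 (fun y => w ε u y i j) x :=
  ((h.contDiffAt_A i j).of_le (by norm_num)).sub
    (ContDiffAt.hess (k := 1) (by norm_num; exact h.smooth) (e i) (e j))

theorem jet2_T (h : Admissible ε u x) {ζ p1 p2 : E n}
    (hP : Jet2 (fun τ : ℝ => gradient u (x + τ • ζ)) (gradient u x) p1 p2) :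
    Jet2 (fun τ : ℝ => T ε u (x + τ • ζ)) (T ε u x)
      (ζ - ((L ε u x ^ 3 / ε ^ 2 * ⟪gradient u x, p1⟫) • gradient u x + L ε u x • p1))
      (0 - ((L ε u x ^ 3 / ε ^ 2 * (‖p1‖ ^ 2 + ⟪gradient u x, p2⟫) +
          3 * L ε u x ^ 5 / ε ^ 4 * ⟪gradient u x, p1⟫ ^ 2) • gradient u x +
        (2 * (L ε u x ^ 3 / ε ^ 2 * ⟪gradient u x, p1⟫)) • p1 + L ε u x • p2)) := by
  have hs := h.sqrt_pos
  have hε := h.eps_pos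
  have hL := hP.lorentz (ε := ε) hs h.sqrt_sq
  have := (Jet2.line x ζ).sub (hL.smul hP)
  have e1 : ∀ I : ℝ, L ε u x ^ 3 / ε ^ 2 * I = ε * I / Real.sqrt (1 - ‖gradient u x‖ ^ 2) ^ 3 :=
    fun I => by rw [L]; field_simp
  have e2 : ∀ I : ℝ, 3 * L ε u x ^ 5 / ε ^ 4 * I =
      3 * ε * I / Real.sqrt (1 - ‖gradient u x‖ ^ 2) ^ 5 := fun I => by rw [L]; field_simp
  simp only [e1, e2]
  exact this

/-- This is the derivative of `D_x c_ε(x,T(x)) = Du(x)`: the mixed second derivative of the cost is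
`-A`, since the cost is a function of `x - y`. The proof is the direct expansion of `T`. -/
theorem bil_A_fderiv_T (h : Admissible ε u x) (ζ a : E n) :
    bil (A ε u x) (fderiv ℝ (T ε u) x ζ) a = bil (w ε u x) ζ a := by
  obtain ⟨p1, p2, hP, h1, h2⟩ := jet2_gradient h.smooth ζ
  have := ((ContDiffAt.jet2 h.contDiffAt_T ζ).unique (h.jet2_T hP)).2.1
  have hL := h.L_pos
  have hε := h.eps_pos
  have h3 := h.one_sub_norm_sq
  rw [this, bil_w, ← h1, bil_A, bil_A]
  simp only [inner_sub_left, inner_sub_right, inner_add_left, inner_add_right, inner_smul_left,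
    inner_smul_right, conj_trivial, real_inner_self_eq_norm_sq]
  have h4 : ‖gradient u x‖ ^ 2 = 1 - ε ^ 2 / L ε u x ^ 2 := by linarith
  rw [h4]
  field_simp
  ring

theorem jacobian_eq (h : Admissible ε u x) : jacobian ε u x = (A ε u x)⁻¹ * w ε u x := by
  have hmul : A ε u x * jacobian ε u x = w ε u x := by
    ext i j
    have h1 := h.bil_A_fderiv_T (e j) (e i)
    rw [bil_e] at h1
    have h2 : w ε u x j i = w ε u x i j := by
      simpa using congrFun (congrFun h.isHermitian_w.eq i) j
    rw [← h2, ← h1, Matrix.mul_apply, bil]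
    have hA : ∀ k l, A ε u x k l = A ε u x l k := fun k l => by
      simpa using congrFun (congrFun h.posDef_A.isHermitian.eq k) l |>.symm
    simp only [e_apply, mul_ite, mul_one, mul_zero, Finset.sum_ite_eq', Finset.mem_univ, if_true]
    refine Finset.sum_congr rfl fun k _ => ?_
    rw [hA i k]
    rfl
  rw [← hmul, Matrix.nonsing_inv_mul_cancel_left _ _ (isUnit_iff_ne_zero.2 h.posDef_A.det_pos.ne')]

/-- The second order expansion of `A a a` along a line. -/
theorem jet2_bil_A (h : Admissible ε u x) {ζ p1 p2 : E n}
    (hP : Jet2 (fun τ : ℝ => gradient u (x + τ • ζ)) (gradient u x) p1 p2) (a : E n) :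
    Jet2 (fun τ : ℝ => bil (A ε u (x + τ • ζ)) a a) (bil (A ε u x) a a)
      (-(L ε u x ^ 2 / ε ^ 2 * ⟪gradient u x, p1⟫) * bil (A ε u x) a a -
        2 / L ε u x * (⟪gradient u x, a⟫ * ⟪p1, a⟫))
      ((-(L ε u x ^ 2 / ε ^ 2 * (‖p1‖ ^ 2 + ⟪gradient u x, p2⟫)) -
          L ε u x ^ 4 / ε ^ 4 * ⟪gradient u x, p1⟫ ^ 2) * bil (A ε u x) a a +
        4 * L ε u x / ε ^ 2 * ⟪gradient u x, p1⟫ * (⟪gradient u x, a⟫ * ⟪p1, a⟫) -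
        2 / L ε u x * (⟪p1, a⟫ ^ 2 + ⟪gradient u x, a⟫ * ⟪p2, a⟫)) := by
  have hs := h.sqrt_pos
  have hε := h.eps_pos
  have hq := hP.inner (Jet2.const a)
  have hj := (((Jet2.const (⟪a, a⟫)).sub (hq.mul hq)).mul
    (hP.sqrt_one_sub_norm_sq hs h.sqrt_sq)).mul (Jet2.const ε⁻¹)
  -- Writing `1/L` as `√(1 - |Du|²)/ε` turns the quotient into a product of known jets.
  have e0 : (fun τ : ℝ => bil (A ε u (x + τ • ζ)) a a) = fun τ : ℝ =>
      (⟪a, a⟫ - ⟪gradient u (x + τ • ζ), a⟫ * ⟪gradient u (x + τ • ζ), a⟫) *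
        Real.sqrt (1 - ‖gradient u (x + τ • ζ)‖ ^ 2) * ε⁻¹ := by
    funext τ
    rw [bil_A, L, div_div_eq_mul_div, div_eq_mul_inv]
  rw [e0, bil_A, L]
  simp only [inner_zero_right] at hj
  convert hj using 1
  · field_simp
  · field_simp; ring
  · field_simp; ring

theorem jet2_log_sqrt (h : Admissible ε u x) {ζ p1 p2 : E n}
    (hP : Jet2 (fun τ : ℝ => gradient u (x + τ • ζ)) (gradient u x) p1 p2) :
    Jet2 (fun τ : ℝ => Real.log (Real.sqrt (1 - ‖gradient u (x + τ • ζ)‖ ^ 2)))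
      (Real.log (Real.sqrt (1 - ‖gradient u x‖ ^ 2)))
      (-(L ε u x ^ 2 / ε ^ 2 * ⟪gradient u x, p1⟫))
      (-(L ε u x ^ 2 / ε ^ 2 * (‖p1‖ ^ 2 + ⟪gradient u x, p2⟫)) -
        2 * L ε u x ^ 4 / ε ^ 4 * ⟪gradient u x, p1⟫ ^ 2) := by
  have hs := h.sqrt_pos
  have hε := h.eps_pos
  have hj := (hP.sqrt_one_sub_norm_sq hs h.sqrt_sq).log hs
  rw [L]
  convert hj using 1
  · field_simp
  · field_simp; ring

end Admissible

/-- A basis which diagonalizes `A` and `w` simultaneously. -/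
structure Frame {n : ℕ} (ε : ℝ) (u : E n → ℝ) (x : E n) (b : Fin n → E n) (lam : Fin n → ℝ) :
    Prop where
  bilA : ∀ i j, bil (A ε u x) (b i) (b j) = if i = j then 1 else 0
  bilw : ∀ i j, bil (w ε u x) (b i) (b j) = if i = j then lam i else 0
  expand : ∀ a, ∑ k, bil (A ε u x) (b k) a • b k = a
  pos : ∀ i, 0 < lam i
  sum_inv : ∀ X : Matrix (Fin n) (Fin n) ℝ,
    ∑ i, ∑ j, (w ε u x)⁻¹ i j * X i j = ∑ k, (lam k)⁻¹ * bil X (b k) (b k)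
  det : (w ε u x).det = (A ε u x).det * ∏ i, lam i

theorem exists_frame_of_posDef {n : ℕ} {ε : ℝ} {u : E n → ℝ} {x : E n} (hA : (A ε u x).PosDef)
    (hw : (w ε u x).PosDef) : ∃ b lam, Frame ε u x b lam ∧
      ∀ μ, Module.End.HasEigenvalue (Matrix.toLin' ((A ε u x)⁻¹ * w ε u x)) μ →
        ∃ j, μ = lam j := by
  obtain ⟨P, lam, h1, h2, hlam⟩ := exists_frame hA hw
  have hcol : ∀ M : Matrix (Fin n) (Fin n) ℝ, ∀ i j,
      bil M (WithLp.toLp 2 fun l => P l i) (WithLp.toLp 2 fun l => P l j) =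
        (P.transpose * M * P) i j := by
    intro M i j
    simp only [bil, Matrix.mul_apply, Matrix.transpose_apply, Finset.sum_mul]
    rw [Finset.sum_comm]
    refine Finset.sum_congr rfl fun k _ => Finset.sum_congr rfl fun l _ => ?_
    ring
  refine ⟨fun k => WithLp.toLp 2 fun l => P l k, lam, ⟨?_, ?_, ?_, hlam, ?_, ?_⟩,
    fun μ hμ => eigenvalue_mem_frame h1 h2 hμ⟩
  · intro i j
    rw [hcol, h1, Matrix.one_apply]
  · intro i j
    rw [hcol, h2, Matrix.diagonal_apply]
  · intro a
    have h3 : P * P.transpose * A ε u x = 1 := by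
      rw [Matrix.mul_assoc]; exact mul_eq_one_comm.1 h1
    ext i
    have h4 := congrFun (congrArg (fun M => Matrix.mulVec M a.ofLp) h3) i
    simp only [Matrix.one_mulVec] at h4
    conv_rhs => rw [← h4]
    rw [← Matrix.mulVec_mulVec, ← Matrix.mulVec_mulVec]
    simp only [bil, Matrix.mulVec, dotProduct, WithLp.ofLp_sum, WithLp.ofLp_smul, Finset.sum_apply,
      Pi.smul_apply, smul_eq_mul, Matrix.transpose_apply]
    refine Finset.sum_congr rfl fun k _ => ?_
    rw [mul_comm]
    congr 1
    refine Finset.sum_congr rfl fun l _ => ?_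
    rw [Finset.mul_sum]
    refine Finset.sum_congr rfl fun m _ => ?_
    ring
  · intro X
    rw [frame_inv_diagonal h2 hlam, sum_mul_eq_trace]
    have : (P * Matrix.diagonal (fun i => (lam i)⁻¹) * P.transpose * X.transpose).trace =
        (Matrix.diagonal (fun i => (lam i)⁻¹) * (P.transpose * X.transpose * P)).trace := by
      rw [Matrix.mul_assoc, Matrix.mul_assoc, Matrix.trace_mul_comm]
      simp only [Matrix.mul_assoc]
    rw [this, Matrix.trace]
    refine Finset.sum_congr rfl fun k _ => ?_
    have h5 : P.transpose * X.transpose * P = (P.transpose * X * P).transpose := by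
      simp [Matrix.transpose_mul, Matrix.mul_assoc]
    rw [Matrix.diag_apply, Matrix.diagonal_mul, h5, Matrix.transpose_apply, hcol]
  · exact frame_det h1 h2

end MongeApprox

/-! ### Derivatives of `A` and `T` in a frame, with bounds tracked in `ε` -/

namespace MongeApprox

/-- The component of `Du` along a vector of a frame, divided by `L`. -/
noncomputable def slope {n : ℕ} (ε : ℝ) (u : E n → ℝ) (x : E n) (b : Fin n → E n) (k : Fin n) : ℝ :=
  ⟪gradient u x, b k⟫ / L ε u x

namespace Frame

variable {n : ℕ} {ε : ℝ} {u : E n → ℝ} {x : E n} {b : Fin n → E n} {lam : Fin n → ℝ}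

theorem fderiv_fderiv (F : Frame ε u x b lam) (i j : Fin n) :
    fderiv ℝ (fderiv ℝ u) x (b i) (b j) = if i = j then 1 - lam i else 0 := by
  have h1 := F.bilA i j
  have h2 := F.bilw i j
  rw [bil_w, h1] at h2
  split_ifs at h2 ⊢ with h
  · linarith
  · linarith

theorem inner_expand (F : Frame ε u x b lam) (v a : E n) :
    ⟪v, a⟫ = ∑ k, bil (A ε u x) (b k) a * ⟪v, b k⟫ := by
  conv_lhs => rw [← F.expand a]
  simp [inner_sum, inner_smul_right]

theorem fderiv_fderiv_left (F : Frame ε u x b lam) (j : Fin n) (a : E n) :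
    fderiv ℝ (fderiv ℝ u) x (b j) a = (1 - lam j) * bil (A ε u x) (b j) a := by
  conv_lhs => rw [← F.expand a]
  simp [map_sum, F.fderiv_fderiv, mul_comm]

theorem bil_A_gradient (h : Admissible ε u x) (k : Fin n) :
    bil (A ε u x) (b k) (gradient u x) =
      ε ^ 2 / L ε u x ^ 2 * slope ε u x b k := by
  rw [bil_A, slope, ← h.one_sub_norm_sq, real_inner_self_eq_norm_sq, real_inner_comm]
  ring

theorem inner_gradient (h : Admissible ε u x) (F : Frame ε u x b lam) (v : E n) :
    ⟪gradient u x, v⟫ = ε ^ 2 / L ε u x ^ 2 * ∑ k, slope ε u x b k * ⟪v, b k⟫ := by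
  rw [real_inner_comm, F.inner_expand v (gradient u x), Finset.mul_sum]
  refine Finset.sum_congr rfl fun k _ => ?_
  rw [bil_A_gradient h]
  ring

theorem inner_b (h : Admissible ε u x) (k : Fin n) :
    ⟪gradient u x, b k⟫ = L ε u x * slope ε u x b k := by
  have := h.L_pos
  rw [slope]; field_simp

theorem norm_sq_le (h : Admissible ε u x) (F : Frame ε u x b lam) (k : Fin n) :
    ‖b k‖ ^ 2 ≤ L ε u x ^ 3 / ε ^ 2 := by
  have := h.norm_sq_le_bil_A (b k)
  simpa [F.bilA] using this

/-- The quantity `L/ε²`, later written `κ²`, is the scale of the whole estimate: slopes have size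
`κ`, and frame vectors have size `Lκ`. -/
theorem slope_sq_le (h : Admissible ε u x) (F : Frame ε u x b lam) (k : Fin n) :
    slope ε u x b k ^ 2 ≤ L ε u x / ε ^ 2 := by
  have h1 := F.norm_sq_le h k
  have h2 := abs_real_inner_le_norm (gradient u x) (b k)
  have hL := h.L_pos
  have hε := h.eps_pos
  have h3 : ⟪gradient u x, b k⟫ ^ 2 ≤ 1 * ‖b k‖ ^ 2 := by
    rw [← sq_abs]
    calc _ ≤ (‖gradient u x‖ * ‖b k‖) ^ 2 := by gcongr
      _ = ‖gradient u x‖ ^ 2 * ‖b k‖ ^ 2 := by ring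
      _ ≤ _ := by gcongr; exact h.norm_sq_lt.le
  rw [slope, div_pow, div_le_iff₀ (by positivity)]
  calc _ ≤ L ε u x ^ 3 / ε ^ 2 := by linarith
    _ = _ := by field_simp

theorem fderiv_T (h : Admissible ε u x) (F : Frame ε u x b lam) (k : Fin n) :
    fderiv ℝ (T ε u) x (b k) = lam k • b k := by
  rw [← F.expand (fderiv ℝ (T ε u) x (b k))]
  have hA : ∀ a c, bil (A ε u x) a c = bil (A ε u x) c a := fun a c => by
    rw [bil_A, bil_A, real_inner_comm]; ring
  simp only [fun j => hA (b j), h.bil_A_fderiv_T, F.bilw, ite_smul, zero_smul]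
  simp

/-- First and second derivatives of `Du` along a vector of a frame. -/
theorem jet2_gradient (h : Admissible ε u x) (F : Frame ε u x b lam) (j : Fin n) :
    ∃ p1 p2 : E n, Jet2 (fun τ : ℝ => gradient u (x + τ • b j)) (gradient u x) p1 p2 ∧
      (∀ i, ⟪p1, b i⟫ = if j = i then 1 - lam j else 0) ∧
      (∀ i, ⟪p2, b i⟫ = third u x (b j) (b j) (b i)) ∧
      ⟪gradient u x, p1⟫ = ε ^ 2 / L ε u x ^ 2 * (slope ε u x b j * (1 - lam j)) ∧
      ‖p1‖ ^ 2 = (1 - lam j) ^ 2 *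
        (1 / L ε u x - ε ^ 2 / L ε u x ^ 2 * slope ε u x b j ^ 2) ∧
      ⟪gradient u x, p2⟫ =
        ε ^ 2 / L ε u x ^ 2 * ∑ k, third u x (b j) (b j) (b k) * slope ε u x b k := by
  obtain ⟨p1, p2, hP, h1, h2⟩ := MongeApprox.jet2_gradient h.smooth (b j)
  have h1' : ∀ i, ⟪p1, b i⟫ = if j = i then 1 - lam j else 0 := fun i => by
    rw [h1, F.fderiv_fderiv]
  have h3 : ⟪gradient u x, p1⟫ = ε ^ 2 / L ε u x ^ 2 * (slope ε u x b j * (1 - lam j)) := by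
    rw [F.inner_gradient h]
    simp [h1']
  have hL := h.L_pos
  refine ⟨p1, p2, hP, h1', fun i => h2 _, h3, ?_, ?_⟩
  · rw [← real_inner_self_eq_norm_sq, h1, F.fderiv_fderiv_left, bil_A, h3, real_inner_comm, h1',
      inner_b h]
    simp only [if_true]
    field_simp
  · rw [F.inner_gradient h]
    congr 1
    refine Finset.sum_congr rfl fun k _ => ?_
    rw [h2]; ring

/-- First and second derivatives of `A` in a frame. -/
theorem jet2_A (h : Admissible ε u x) (F : Frame ε u x b lam) (i j : Fin n) :
    Jet2 (fun τ : ℝ => bil (A ε u (x + τ • b j)) (b i) (b i)) 1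
      (-((1 - lam j) * slope ε u x b j) - 2 * slope ε u x b i * (if j = i then 1 - lam j else 0))
      (-(L ε u x / ε ^ 2 * (1 - lam j) ^ 2) -
        ∑ k, third u x (b j) (b j) (b k) * slope ε u x b k +
        (if j = i then (1 - lam j) ^ 2 * (4 * slope ε u x b j ^ 2 - 2 / L ε u x) else 0) -
        2 * slope ε u x b i * third u x (b j) (b j) (b i)) := by
  obtain ⟨p1, p2, hP, e1, e2, e3, e4, e5⟩ := F.jet2_gradient h j
  have hj := h.jet2_bil_A hP (b i)
  have hL := h.L_pos
  have hε := h.eps_pos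
  rw [F.bilA, if_pos rfl, e1, e2, e3, e4, e5, inner_b h] at hj
  convert hj using 1
  · split_ifs <;> (field_simp; try ring)
  · by_cases hji : j = i
    · subst hji
      simp only [if_true]
      field_simp
      ring
    · simp only [if_neg hji]
      field_simp
      ring

theorem jet2_log_sqrt (h : Admissible ε u x) (F : Frame ε u x b lam) (j : Fin n) :
    Jet2 (fun τ : ℝ => Real.log (Real.sqrt (1 - ‖gradient u (x + τ • b j)‖ ^ 2)))
      (Real.log (Real.sqrt (1 - ‖gradient u x‖ ^ 2)))
      (-((1 - lam j) * slope ε u x b j))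
      (-(L ε u x / ε ^ 2 * (1 - lam j) ^ 2) -
        ∑ k, third u x (b j) (b j) (b k) * slope ε u x b k -
        (1 - lam j) ^ 2 * slope ε u x b j ^ 2) := by
  obtain ⟨p1, p2, hP, e1, e2, e3, e4, e5⟩ := F.jet2_gradient h j
  have hj := h.jet2_log_sqrt hP
  have hL := h.L_pos
  have hε := h.eps_pos
  rw [e3, e4, e5] at hj
  convert hj using 1
  · field_simp
  · field_simp
    ring

/-- Expand one factor of `⟪v, v⟫` in the frame; the coefficients satisfy `A(b_k,v)² ≤ A(v,v) ≤
|v|²/L`. The factor `L^{-1/2}` is what keeps the bound on `D²T` uniform in `ε`. -/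
theorem norm_le_of_inner (h : Admissible ε u x) (F : Frame ε u x b lam) (v : E n) :
    ‖v‖ ≤ (Real.sqrt (L ε u x))⁻¹ * ∑ k, |⟪v, b k⟫| := by
  have hL := h.L_pos
  have hb : ∀ k a, |bil (A ε u x) (b k) a| ≤ (Real.sqrt (L ε u x))⁻¹ * ‖a‖ := by
    intro k a
    have h0 : bil (A ε u x) a a = ∑ k, bil (A ε u x) (b k) a ^ 2 := by
      have e1 : ∀ c, bil (A ε u x) a c = ∑ k, bil (A ε u x) (b k) c * bil (A ε u x) (b k) a := by
        intro c
        have hc : ∀ v, bil (A ε u x) v c = ⟪(L ε u x)⁻¹ • (c - ⟪gradient u x, c⟫ • gradient u x), v⟫ := by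
          intro v
          rw [bil_A, inner_smul_left, inner_sub_left, inner_smul_left, real_inner_comm v c]
          simp only [conj_trivial]
          ring
        rw [hc, F.inner_expand _ a]
        refine Finset.sum_congr rfl fun k _ => ?_
        rw [← hc]; ring
      rw [e1 a]
      exact Finset.sum_congr rfl fun k _ => by ring
    have h1 : bil (A ε u x) (b k) a ^ 2 ≤ bil (A ε u x) a a := by
      rw [h0]
      exact Finset.single_le_sum (f := fun k => bil (A ε u x) (b k) a ^ 2)
        (fun i _ => sq_nonneg _) (Finset.mem_univ k)
    have h2 : bil (A ε u x) a a ≤ ((Real.sqrt (L ε u x))⁻¹ * ‖a‖) ^ 2 := by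
      rw [mul_pow, inv_pow, Real.sq_sqrt hL.le, bil_A, real_inner_self_eq_norm_sq, div_eq_inv_mul]
      gcongr
      nlinarith [sq_nonneg ⟪gradient u x, a⟫]
    exact abs_le_of_sq_le_sq (h1.trans h2) (by positivity)
  rcases eq_or_ne v 0 with rfl | hv
  · simp
  have hv' : 0 < ‖v‖ := norm_pos_iff.2 hv
  have h3 : ‖v‖ * ‖v‖ ≤ ((Real.sqrt (L ε u x))⁻¹ * ∑ k, |⟪v, b k⟫|) * ‖v‖ := by
    rw [← real_inner_self_eq_norm_mul_norm]
    rw [F.inner_expand v v, Finset.mul_sum, Finset.sum_mul]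
    refine Finset.sum_le_sum fun k _ => ?_
    calc _ ≤ |bil (A ε u x) (b k) v * ⟪v, b k⟫| := le_abs_self _
      _ = |bil (A ε u x) (b k) v| * |⟪v, b k⟫| := abs_mul _ _
      _ ≤ ((Real.sqrt (L ε u x))⁻¹ * ‖v‖) * |⟪v, b k⟫| := by gcongr; exact hb k v
      _ = _ := by ring
  exact le_of_mul_le_mul_right h3 hv'

/-- `T` enters the equation through `g∘T`. The negative powers of `ε` in its second derivative must
combine into `κ²` and `κ` times third derivatives, so that this term can be compared with the good
term of order `κ²`. -/
theorem norm_second_derivative_T_le (h : Admissible ε u x) (F : Frame ε u x b lam) (j : Fin n)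
    {κ : ℝ} (hκ : 0 < κ) (hκL : κ ^ 2 = L ε u x / ε ^ 2) :
    ‖fderiv ℝ (fderiv ℝ (T ε u)) x (b j) (b j)‖ ≤
      L ε u x * (6 * κ ^ 2 * (1 - lam j) ^ 2 +
        2 * κ * ∑ k, |third u x (b j) (b j) (b k)|) := by
  obtain ⟨p1, p2, hP, e1, e2, e3, e4, e5⟩ := F.jet2_gradient h j
  have hT := ((ContDiffAt.jet2 h.contDiffAt_T (b j)).unique (h.jet2_T hP)).2.2
  have hL := h.L_pos
  have hε := h.eps_pos
  have hεL := h.eps_le_L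
  have hy : ∀ k, |slope ε u x b k| ≤ κ := fun k =>
    abs_le_of_sq_le_sq (by rw [hκL]; exact F.slope_sq_le h k) hκ.le
  have hsq : Real.sqrt (L ε u x) = κ * ε := by
    rw [Real.sqrt_eq_iff_mul_self_eq hL.le (by positivity)]
    have : κ * ε * (κ * ε) = κ ^ 2 * ε ^ 2 := by ring
    rw [this, hκL]; field_simp
  have hLκ : L ε u x = κ ^ 2 * ε ^ 2 := by rw [hκL]; field_simp
  set Z := ∑ k, |third u x (b j) (b j) (b k)| with hZ
  have hZ0 : 0 ≤ Z := Finset.sum_nonneg fun k _ => abs_nonneg _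
  have hp : ‖gradient u x‖ ≤ 1 := by
    have := h.norm_sq_lt
    nlinarith [norm_nonneg (gradient u x)]
  -- Here `√L = κε`, and the last inequality uses `ε ≤ L`.
  have hp2 : L ε u x * ‖p2‖ ≤ L ε u x * (κ * Z) := by
    have := F.norm_le_of_inner h p2
    simp only [e2] at this
    rw [hsq] at this
    calc L ε u x * ‖p2‖ ≤ L ε u x * ((κ * ε)⁻¹ * Z) := by gcongr
      _ = (κ * ε) * Z := by rw [hLκ]; field_simp
      _ ≤ (κ * L ε u x) * Z := by gcongr
      _ = _ := by ring
  have hp1 : ‖p1‖ ^ 2 ≤ (1 - lam j) ^ 2 / L ε u x := by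
    rw [e4, mul_sub, mul_one_div]
    have : 0 ≤ (1 - lam j) ^ 2 * (ε ^ 2 / L ε u x ^ 2 * slope ε u x b j ^ 2) := by positivity
    linarith
  have hp1' : ‖p1‖ ≤ (κ * ε)⁻¹ * |1 - lam j| := by
    refine abs_le_of_sq_le_sq' (hp1.trans (le_of_eq ?_)) (by positivity) |>.2
    rw [mul_pow, sq_abs, inv_pow, hLκ, mul_pow]
    field_simp
  have hS : |∑ k, third u x (b j) (b j) (b k) * slope ε u x b k| ≤ κ * Z := by
    rw [hZ, Finset.mul_sum]
    refine (Finset.abs_sum_le_sum_abs _ _).trans (Finset.sum_le_sum fun k _ => ?_)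
    rw [abs_mul, mul_comm]
    gcongr
    exact hy k
  have hc := sq_abs (1 - lam j)
  have t1 : |L ε u x ^ 3 / ε ^ 2 * (‖p1‖ ^ 2 + ⟪gradient u x, p2⟫) +
      3 * L ε u x ^ 5 / ε ^ 4 * ⟪gradient u x, p1⟫ ^ 2| ≤
      L ε u x * (4 * κ ^ 2 * (1 - lam j) ^ 2 + κ * Z) := by
    rw [e3, e5]
    have r1 : L ε u x ^ 3 / ε ^ 2 * (‖p1‖ ^ 2 + ε ^ 2 / L ε u x ^ 2 *
        ∑ k, third u x (b j) (b j) (b k) * slope ε u x b k) +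
        3 * L ε u x ^ 5 / ε ^ 4 * (ε ^ 2 / L ε u x ^ 2 * (slope ε u x b j * (1 - lam j))) ^ 2 =
        L ε u x * (κ ^ 2 * (L ε u x * ‖p1‖ ^ 2) +
          (∑ k, third u x (b j) (b j) (b k) * slope ε u x b k) +
          3 * (slope ε u x b j ^ 2 * (1 - lam j) ^ 2)) := by
      rw [hκL]
      field_simp
    rw [r1, abs_mul, abs_of_pos hL]
    refine mul_le_mul_of_nonneg_left ?_ hL.le
    have r2 : L ε u x * ‖p1‖ ^ 2 ≤ (1 - lam j) ^ 2 := by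
      rw [le_div_iff₀ hL] at hp1; linarith
    have r3 : slope ε u x b j ^ 2 ≤ κ ^ 2 := by rw [hκL]; exact F.slope_sq_le h j
    calc _ ≤ |κ ^ 2 * (L ε u x * ‖p1‖ ^ 2)| +
          |∑ k, third u x (b j) (b j) (b k) * slope ε u x b k| +
          |3 * (slope ε u x b j ^ 2 * (1 - lam j) ^ 2)| := abs_add_three _ _ _
      _ ≤ κ ^ 2 * (1 - lam j) ^ 2 + κ * Z + 3 * (κ ^ 2 * (1 - lam j) ^ 2) := by
          rw [abs_of_nonneg (by positivity : 0 ≤ κ ^ 2 * (L ε u x * ‖p1‖ ^ 2)),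
            abs_of_nonneg (by positivity : 0 ≤ 3 * (slope ε u x b j ^ 2 * (1 - lam j) ^ 2))]
          gcongr
      _ = _ := by ring
  have t2 : |2 * (L ε u x ^ 3 / ε ^ 2 * ⟪gradient u x, p1⟫)| * ‖p1‖ ≤
      L ε u x * (2 * κ ^ 2 * (1 - lam j) ^ 2) := by
    have r1 : 2 * (L ε u x ^ 3 / ε ^ 2 * ⟪gradient u x, p1⟫) =
        2 * L ε u x * (slope ε u x b j * (1 - lam j)) := by
      rw [e3]; field_simp
    rw [r1, abs_mul, abs_mul (slope _ _ _ _ _), abs_of_pos (by positivity : 0 < 2 * L ε u x)]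
    calc _ ≤ 2 * L ε u x * (κ * |1 - lam j|) * ((κ * ε)⁻¹ * |1 - lam j|) := by
          gcongr
          exact hy j
      _ = 2 * κ ^ 2 * ε * |1 - lam j| ^ 2 := by
          rw [hLκ]; field_simp
      _ ≤ 2 * κ ^ 2 * L ε u x * |1 - lam j| ^ 2 := by gcongr
      _ = _ := by rw [hc]; ring
  rw [hT, zero_sub, norm_neg]
  refine (norm_add₃_le ..).trans ?_
  rw [norm_smul, norm_smul, norm_smul, Real.norm_eq_abs, Real.norm_eq_abs, Real.norm_eq_abs,
    abs_of_pos hL]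
  have t1' := mul_le_of_le_one_right (abs_nonneg (L ε u x ^ 3 / ε ^ 2 *
    (‖p1‖ ^ 2 + ⟪gradient u x, p2⟫) + 3 * L ε u x ^ 5 / ε ^ 4 * ⟪gradient u x, p1⟫ ^ 2)) hp
  calc _ ≤ L ε u x * (4 * κ ^ 2 * (1 - lam j) ^ 2 + κ * Z) +
        L ε u x * (2 * κ ^ 2 * (1 - lam j) ^ 2) + L ε u x * (κ * Z) :=
        add_le_add (add_le_add (t1'.trans t1) t2) hp2
    _ = _ := by ring

end Frame

end MongeApprox

namespace MongeApprox

/-! ### The algebraic inequality at a maximum point -/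

section Algebra

variable {n : ℕ} {m : Fin n} {lam y θ θ2 q : Fin n → ℝ} {z : Fin n → Fin n → ℝ} {κ ℓ R : ℝ}

/-- The third derivatives cancel in the differential inequality at a maximum point. -/
theorem cancel_third (hlam : ∀ i, 0 < lam i)
    (h1 : ∀ k, ∑ i, (lam i)⁻¹ * ((-((1 - lam k) * y k) -
      2 * y i * (if k = i then 1 - lam k else 0)) - z i k) = q k)
    (h2 : ∀ k, z m k = (-((1 - lam k) * y k) - 2 * y m * (if k = m then 1 - lam k else 0)) *
      (1 - lam m) - θ k)
    (h3 : ∑ i, (lam i)⁻¹ * ((-(κ ^ 2 * (1 - lam i) ^ 2) - ∑ k, z i k * y k +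
        (if i = m then (1 - lam i) ^ 2 * (4 * y i ^ 2 - 2 * ℓ) else 0) - 2 * y m * z i m) *
          (1 - lam m) -
        2 * (-((1 - lam i) * y i) - 2 * y m * (if i = m then 1 - lam i else 0)) * θ i - θ2 i) ≤
      ∑ i, (lam i)⁻¹ * (-(κ ^ 2 * (1 - lam m) ^ 2) - ∑ k, z m k * y k +
        (if m = i then (1 - lam m) ^ 2 * (4 * y m ^ 2 - 2 * ℓ) else 0) - 2 * y i * z m i) + R) :
    κ ^ 2 * (1 - lam m) ^ 2 * ∑ i, (lam i)⁻¹ +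
        (lam m - 1) * κ ^ 2 * ∑ i, (lam i)⁻¹ * (1 - lam i) ^ 2 ≤
      (lam m - 1) * ∑ k, (y k + 2 * y m * (if k = m then 1 else 0)) * q k +
      ∑ i, (lam i)⁻¹ * ∑ k, (y k + 2 * y i * (if k = i then 1 else 0)) * θ k +
      (1 - lam m) ^ 2 * (4 * y m ^ 2 - 2 * ℓ) +
      ∑ i, (lam i)⁻¹ * (2 * (-((1 - lam i) * y i) -
        2 * y m * (if i = m then 1 - lam i else 0)) * θ i + θ2 i) + R := by
  -- The same coefficients occur twice: the derivative of `A(b_i,b_i)` along `b_k` is `-(1 - λ_k) B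
  -- i k`, and third derivatives enter the second derivatives of `A` through `∑ z · B`. This
  -- coincidence makes the cancellation possible.
  set B : Fin n → Fin n → ℝ := fun i k => y k + 2 * y i * (if k = i then 1 else 0) with hB
  have hBc : ∀ i k, -((1 - lam k) * y k) - 2 * y i * (if k = i then 1 - lam k else 0) =
      -((1 - lam k) * B i k) := by
    intro i k
    simp only [hB]
    split_ifs <;> ring
  have hBz : ∀ i j, ∑ k, z i k * y k + 2 * y j * z i j = ∑ k, z i k * B j k := by
    intro i j
    simp only [hB, mul_add, Finset.sum_add_distrib]
    congr 1
    simp only [mul_ite, mul_one, mul_zero, Finset.sum_ite_eq', Finset.mem_univ, if_true]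
    ring
  simp only [hBc] at h1 h2 h3 ⊢
  have hl : ∀ i, (-(κ ^ 2 * (1 - lam i) ^ 2) - ∑ k, z i k * y k +
        (if i = m then (1 - lam i) ^ 2 * (4 * y i ^ 2 - 2 * ℓ) else 0) - 2 * y m * z i m) =
      -(κ ^ 2 * (1 - lam i) ^ 2) +
        (if i = m then (1 - lam i) ^ 2 * (4 * y i ^ 2 - 2 * ℓ) else 0) - ∑ k, z i k * B m k := by
    intro i; rw [← hBz]; ring
  have hr : ∀ i, (-(κ ^ 2 * (1 - lam m) ^ 2) - ∑ k, z m k * y k +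
        (if m = i then (1 - lam m) ^ 2 * (4 * y m ^ 2 - 2 * ℓ) else 0) - 2 * y i * z m i) =
      -(κ ^ 2 * (1 - lam m) ^ 2) +
        (if m = i then (1 - lam m) ^ 2 * (4 * y m ^ 2 - 2 * ℓ) else 0) - ∑ k, z m k * B i k := by
    intro i; rw [← hBz]; ring
  simp only [hl, hr] at h3
  have el : ∑ i, (lam i)⁻¹ * ((-(κ ^ 2 * (1 - lam i) ^ 2) +
        (if i = m then (1 - lam i) ^ 2 * (4 * y i ^ 2 - 2 * ℓ) else 0) - ∑ k, z i k * B m k) *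
          (1 - lam m) - 2 * (-((1 - lam i) * B m i)) * θ i - θ2 i) =
      (lam m - 1) * κ ^ 2 * (∑ i, (lam i)⁻¹ * (1 - lam i) ^ 2) +
      (1 - lam m) * ((lam m)⁻¹ * ((1 - lam m) ^ 2 * (4 * y m ^ 2 - 2 * ℓ))) -
      (1 - lam m) * (∑ i, (lam i)⁻¹ * ∑ k, z i k * B m k) -
      ∑ i, (lam i)⁻¹ * (2 * (-((1 - lam i) * B m i)) * θ i + θ2 i) := by
    have : (lam m)⁻¹ * ((1 - lam m) ^ 2 * (4 * y m ^ 2 - 2 * ℓ)) = ∑ i, (lam i)⁻¹ *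
        (if i = m then (1 - lam i) ^ 2 * (4 * y i ^ 2 - 2 * ℓ) else 0) := by
      simp
    rw [this, Finset.mul_sum, Finset.mul_sum, Finset.mul_sum, ← Finset.sum_add_distrib,
      ← Finset.sum_sub_distrib, ← Finset.sum_sub_distrib]
    refine Finset.sum_congr rfl fun i _ => ?_
    ring
  have er : ∑ i, (lam i)⁻¹ * (-(κ ^ 2 * (1 - lam m) ^ 2) +
        (if m = i then (1 - lam m) ^ 2 * (4 * y m ^ 2 - 2 * ℓ) else 0) - ∑ k, z m k * B i k) =
      -(κ ^ 2 * (1 - lam m) ^ 2) * (∑ i, (lam i)⁻¹) +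
      (lam m)⁻¹ * ((1 - lam m) ^ 2 * (4 * y m ^ 2 - 2 * ℓ)) -
      ∑ i, (lam i)⁻¹ * ∑ k, z m k * B i k := by
    have : (lam m)⁻¹ * ((1 - lam m) ^ 2 * (4 * y m ^ 2 - 2 * ℓ)) = ∑ i, (lam i)⁻¹ *
        (if m = i then (1 - lam m) ^ 2 * (4 * y m ^ 2 - 2 * ℓ) else 0) := by
      simp
    rw [this, Finset.mul_sum, ← Finset.sum_add_distrib, ← Finset.sum_sub_distrib]
    refine Finset.sum_congr rfl fun i _ => ?_
    ring
  rw [el, er] at h3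
  -- The differentiated equation `h1` removes the third derivatives here, and the first-order
  -- condition `h2` removes those in `ez2`. Both leave the same sum over `B i k * B m k`, and it
  -- drops out once the first is multiplied by `1 - lam m`.
  have ez1 : ∑ i, (lam i)⁻¹ * ∑ k, z i k * B m k =
      -∑ k, B m k * q k - ∑ i, (lam i)⁻¹ * ∑ k, (1 - lam k) * B i k * B m k := by
    simp only [← h1, Finset.mul_sum, ← Finset.sum_neg_distrib]
    rw [Finset.sum_comm, Finset.sum_comm (s := Finset.univ) (t := Finset.univ)
      (f := fun i k => (lam i)⁻¹ * ((1 - lam k) * B i k * B m k)), ← Finset.sum_sub_distrib]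
    refine Finset.sum_congr rfl fun k _ => ?_
    rw [← Finset.sum_sub_distrib]
    refine Finset.sum_congr rfl fun i _ => ?_
    ring
  have ez2 : ∑ i, (lam i)⁻¹ * ∑ k, z m k * B i k =
      -((1 - lam m) * ∑ i, (lam i)⁻¹ * ∑ k, (1 - lam k) * B i k * B m k) -
      ∑ i, (lam i)⁻¹ * ∑ k, B i k * θ k := by
    simp only [h2, Finset.mul_sum, ← Finset.sum_neg_distrib]
    rw [← Finset.sum_sub_distrib]
    refine Finset.sum_congr rfl fun i _ => ?_
    rw [← Finset.sum_sub_distrib]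
    refine Finset.sum_congr rfl fun k _ => ?_
    ring
  rw [ez1, ez2] at h3
  -- The diagonal correction appears with factor `1 - lam m` on one side and `1` on the other; the
  -- difference `lam m` cancels the weight `(lam m)⁻¹`.
  have hm : (lam m)⁻¹ * ((1 - lam m) ^ 2 * (4 * y m ^ 2 - 2 * ℓ)) * lam m =
      (1 - lam m) ^ 2 * (4 * y m ^ 2 - 2 * ℓ) := by
    have := (hlam m).ne'
    field_simp
  linarith

/-- The constant in the estimate at a maximum point. -/
noncomputable def algConst (n : ℕ) (K : ℝ) : ℝ :=
  3 * n * (n + 2 + K) + 9 * n + 11 + (n + 2) * (4 * n + 2) + K * (4 * n + 2)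

set_option maxHeartbeats 800000 in
theorem le_of_cancel_third {τ K : ℝ} (hκ : 0 < κ) (hℓ : 0 < ℓ)
    (hlam : ∀ i, 0 < lam i) (hmax : ∀ i, lam i ≤ lam m) (hm1 : 1 ≤ lam m) (hτ : 1 ≤ τ)
    (hK : 0 ≤ K) {Fk : Fin n → ℝ} {R' : ℝ}
    (hy : ∀ k, |y k| ≤ κ) (hθ : ∀ k, |θ k| ≤ κ * lam m * τ)
    (hθ2 : ∀ k, |θ2 k| ≤ κ ^ 2 * lam m * τ ^ 2)
    (hF : ∀ k, |Fk k| ≤ κ * lam m * K)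
    (hq : ∀ k, q k = (n + 2) * (-((1 - lam k) * y k)) + Fk k)
    (hR : R = -((n + 2) * (-(κ ^ 2 * (1 - lam m) ^ 2) - ∑ k, z m k * y k -
      (1 - lam m) ^ 2 * y m ^ 2)) + R')
    (hR' : R' ≤ K * (κ ^ 2 * lam m ^ 2 + κ * ∑ k, |z m k|))
    (h2 : ∀ k, z m k = (-((1 - lam k) * y k) - 2 * y m * (if k = m then 1 - lam k else 0)) *
      (1 - lam m) - θ k)
    (h : κ ^ 2 * (1 - lam m) ^ 2 * ∑ i, (lam i)⁻¹ +
        (lam m - 1) * κ ^ 2 * ∑ i, (lam i)⁻¹ * (1 - lam i) ^ 2 ≤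
      (lam m - 1) * ∑ k, (y k + 2 * y m * (if k = m then 1 else 0)) * q k +
      ∑ i, (lam i)⁻¹ * ∑ k, (y k + 2 * y i * (if k = i then 1 else 0)) * θ k +
      (1 - lam m) ^ 2 * (4 * y m ^ 2 - 2 * ℓ) +
      ∑ i, (lam i)⁻¹ * (2 * (-((1 - lam i) * y i) -
        2 * y m * (if i = m then 1 - lam i else 0)) * θ i + θ2 i) + R) :
    (1 - lam m) ^ 2 * ∑ i, (lam i)⁻¹ ≤
      algConst n K * (lam m ^ 2 + lam m * τ ^ 2 * (∑ i, (lam i)⁻¹ + 1)) := by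
  set Λ := lam m with hΛ
  set S := ∑ i, (lam i)⁻¹ with hS
  have hS0 : 0 ≤ S := Finset.sum_nonneg fun i _ => (inv_pos.2 (hlam i)).le
  have hc : ∀ i, |1 - lam i| ≤ Λ := fun i => abs_le.2 ⟨by linarith [hmax i], by linarith [hlam i]⟩
  have hc2 : (1 - Λ) ^ 2 ≤ Λ ^ 2 := by nlinarith
  have hB : ∀ i k, |y k + 2 * y i * (if k = i then (1 : ℝ) else 0)| ≤ 3 * κ := by
    intro i k
    refine (abs_add_le _ _).trans ?_
    rw [abs_mul, abs_mul, abs_two]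
    have : |(if k = i then (1 : ℝ) else 0)| ≤ 1 := by split_ifs <;> simp
    calc _ ≤ κ + 2 * κ * 1 := by gcongr; exacts [hy k, hy i]
      _ = _ := by ring
  have hBc : ∀ i k, -((1 - lam k) * y k) - 2 * y i * (if k = i then 1 - lam k else 0) =
      -((1 - lam k) * (y k + 2 * y i * (if k = i then (1 : ℝ) else 0))) := by
    intro i k
    split_ifs <;> ring
  simp only [hBc] at h h2
  -- Since `1 ≤ τ`, all powers of the cutoff gradient may be absorbed into `τ²`.
  have hΛτ : Λ * τ ≤ Λ * τ ^ 2 := mul_le_mul_of_nonneg_left (by nlinarith) (by linarith)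
  have hz : ∀ k, |z m k| ≤ κ * (3 * Λ ^ 2 + Λ * τ) := by
    intro k
    rw [h2]
    refine (abs_sub _ _).trans ?_
    rw [abs_mul, abs_neg, abs_mul]
    calc _ ≤ Λ * (3 * κ) * Λ + κ * Λ * τ := by
          gcongr
          exacts [hc k, hB m k, hc m, hθ k]
      _ = _ := by ring
  have hzs : ∑ k, |z m k| ≤ n * (κ * (3 * Λ ^ 2 + Λ * τ)) := by
    refine (Finset.sum_le_sum fun k _ => hz k).trans (le_of_eq ?_)
    simp
  have hqb : ∀ k, |q k| ≤ κ * Λ * (n + 2 + K) := by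
    intro k
    rw [hq]
    refine (abs_add_le _ _).trans ?_
    rw [abs_mul, abs_neg, abs_mul, abs_of_nonneg (by positivity : (0 : ℝ) ≤ n + 2)]
    calc _ ≤ (n + 2) * (Λ * κ) + κ * Λ * K := by
          gcongr
          exacts [hc k, hy k, hF k]
      _ = _ := by ring
  have T1 : (Λ - 1) * ∑ k, (y k + 2 * y m * (if k = m then 1 else 0)) * q k ≤
      κ ^ 2 * (3 * n * (n + 2 + K) * Λ ^ 2) := by
    have : ∑ k, (y k + 2 * y m * (if k = m then 1 else 0)) * q k ≤
        n * (3 * κ * (κ * Λ * (n + 2 + K))) := by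
      refine (Finset.sum_le_sum (g := fun _ => 3 * κ * (κ * Λ * (n + 2 + K))) fun k _ => ?_).trans
        (le_of_eq (by simp))
      refine (le_abs_self _).trans ?_
      rw [abs_mul]
      gcongr
      exacts [hB m k, hqb k]
    calc _ ≤ (Λ - 1) * (n * (3 * κ * (κ * Λ * (n + 2 + K)))) :=
          mul_le_mul_of_nonneg_left this (by linarith)
      _ ≤ Λ * (n * (3 * κ * (κ * Λ * (n + 2 + K)))) := by gcongr; linarith
      _ = _ := by ring
  have T2 : ∑ i, (lam i)⁻¹ * ∑ k, (y k + 2 * y i * (if k = i then 1 else 0)) * θ k ≤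
      κ ^ 2 * (3 * n * (Λ * τ * S)) := by
    calc _ ≤ ∑ i, (lam i)⁻¹ * (n * (3 * κ * (κ * Λ * τ))) := by
          refine Finset.sum_le_sum fun i _ =>
            mul_le_mul_of_nonneg_left ?_ (inv_pos.2 (hlam i)).le
          refine (Finset.sum_le_sum (g := fun _ => 3 * κ * (κ * Λ * τ)) fun k _ => ?_).trans
            (le_of_eq (by simp))
          refine (le_abs_self _).trans ?_
          rw [abs_mul]
          gcongr
          exacts [hB i k, hθ k]
      _ = _ := by rw [← Finset.sum_mul]; ring
  have T3 : (1 - Λ) ^ 2 * (4 * y m ^ 2 - 2 * ℓ) ≤ κ ^ 2 * (4 * Λ ^ 2) := by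
    have h1 : y m ^ 2 ≤ κ ^ 2 := by rw [← sq_abs]; gcongr; exact hy m
    calc _ ≤ (1 - Λ) ^ 2 * (4 * κ ^ 2) := by gcongr; linarith
      _ ≤ Λ ^ 2 * (4 * κ ^ 2) := by gcongr
      _ = _ := by ring
  have T4 : ∑ i, (lam i)⁻¹ * (2 * (-((1 - lam i) * (y i + 2 * y m * (if i = m then 1 else 0)))) *
      θ i + θ2 i) ≤ κ ^ 2 * (6 * (Λ * τ * (S + n)) + Λ * τ ^ 2 * S) := by
    have hi : ∀ i, (lam i)⁻¹ * (2 * (-((1 - lam i) * (y i + 2 * y m * (if i = m then 1 else 0)))) *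
        θ i + θ2 i) ≤ κ ^ 2 * (6 * (Λ * τ * ((lam i)⁻¹ + 1)) + Λ * τ ^ 2 * (lam i)⁻¹) := by
      intro i
      have hli := hlam i
      have e1 : |(lam i)⁻¹ * (1 - lam i)| ≤ (lam i)⁻¹ + 1 := by
        rw [mul_sub, mul_one, inv_mul_cancel₀ hli.ne']
        refine (abs_sub _ _).trans ?_
        rw [abs_of_pos (inv_pos.2 hli), abs_one]
      have e2 : (lam i)⁻¹ * θ2 i ≤ (lam i)⁻¹ * (κ ^ 2 * Λ * τ ^ 2) := by
        gcongr
        exact (le_abs_self _).trans (hθ2 i)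
      have e3 : -(2 * ((lam i)⁻¹ * (1 - lam i)) * (y i + 2 * y m * (if i = m then 1 else 0)) *
          θ i) ≤ 2 * ((lam i)⁻¹ + 1) * (3 * κ) * (κ * Λ * τ) := by
        refine (neg_le_abs _).trans ?_
        rw [abs_mul, abs_mul, abs_mul, abs_two]
        have := inv_pos.2 hli
        gcongr
        exacts [hB m i, hθ i]
      calc _ = -(2 * ((lam i)⁻¹ * (1 - lam i)) * (y i + 2 * y m * (if i = m then 1 else 0)) *
          θ i) + (lam i)⁻¹ * θ2 i := by ring
        _ ≤ _ := add_le_add e3 e2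
        _ = _ := by ring
    refine (Finset.sum_le_sum fun i _ => hi i).trans (le_of_eq ?_)
    rw [← Finset.mul_sum, Finset.sum_add_distrib, ← Finset.mul_sum, ← Finset.mul_sum,
      ← Finset.mul_sum, Finset.sum_add_distrib]
    simp [hS]
  have hzy : ∑ k, z m k * y k ≤ κ * ∑ k, |z m k| := by
    rw [Finset.mul_sum]
    refine Finset.sum_le_sum fun k _ => ?_
    refine (le_abs_self _).trans ?_
    rw [abs_mul, mul_comm]
    gcongr
    exact hy k
  have hnκ : κ * ∑ k, |z m k| ≤ κ ^ 2 * (n * (3 * Λ ^ 2 + Λ * τ)) := by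
    calc _ ≤ κ * (n * (κ * (3 * Λ ^ 2 + Λ * τ))) := by gcongr
      _ = _ := by ring
  have T5 : R ≤ κ ^ 2 * ((n + 2) * (2 * Λ ^ 2 + n * (3 * Λ ^ 2 + Λ * τ)) +
      K * (Λ ^ 2 + n * (3 * Λ ^ 2 + Λ * τ))) := by
    have h1 : y m ^ 2 ≤ κ ^ 2 := by rw [← sq_abs]; gcongr; exact hy m
    have h4 : (1 - Λ) ^ 2 * y m ^ 2 ≤ Λ ^ 2 * κ ^ 2 := by gcongr
    have h5 : κ ^ 2 * (1 - Λ) ^ 2 ≤ κ ^ 2 * Λ ^ 2 := by gcongr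
    rw [hR]
    calc _ = (n + 2) * (κ ^ 2 * (1 - Λ) ^ 2 + ∑ k, z m k * y k + (1 - Λ) ^ 2 * y m ^ 2) + R' := by
          ring
      _ ≤ (n + 2) * (κ ^ 2 * Λ ^ 2 + κ ^ 2 * (n * (3 * Λ ^ 2 + Λ * τ)) + Λ ^ 2 * κ ^ 2) +
          K * (κ ^ 2 * Λ ^ 2 + κ ^ 2 * (n * (3 * Λ ^ 2 + Λ * τ))) := by
          refine add_le_add ?_ (hR'.trans ?_)
          · gcongr
            exact hzy.trans hnκ
          · gcongr
      _ = _ := by ring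
  -- The second term on the left has a good sign because `1 ≤ Λ`, and is dropped. Everything else
  -- carries the factor `κ²`, which is then divided out.
  have hT0 : 0 ≤ (Λ - 1) * κ ^ 2 * ∑ i, (lam i)⁻¹ * (1 - lam i) ^ 2 := by
    refine mul_nonneg (mul_nonneg (by linarith) (by positivity)) (Finset.sum_nonneg fun i _ => ?_)
    have := (inv_pos.2 (hlam i)).le
    positivity
  have hfin : κ ^ 2 * ((1 - Λ) ^ 2 * S) ≤ κ ^ 2 * (3 * n * (n + 2 + K) * Λ ^ 2 +
      3 * n * (Λ * τ * S) + 4 * Λ ^ 2 + (6 * (Λ * τ * (S + n)) + Λ * τ ^ 2 * S) +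
      ((n + 2) * (2 * Λ ^ 2 + n * (3 * Λ ^ 2 + Λ * τ)) +
      K * (Λ ^ 2 + n * (3 * Λ ^ 2 + Λ * τ)))) := by
    linarith
  have h7 := le_of_mul_le_mul_left hfin (by positivity)
  refine h7.trans ?_
  have hn : (0 : ℝ) ≤ n := Nat.cast_nonneg n
  have g1 : Λ * τ * S ≤ Λ * τ ^ 2 * S := by gcongr
  set X := Λ ^ 2
  set Y := Λ * τ ^ 2
  have hX : 0 ≤ X := by positivity
  have hY : 0 ≤ Y := by positivity
  have hYS : 0 ≤ Y * S := by positivity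
  calc _ ≤ 3 * n * (n + 2 + K) * X + 3 * n * (Y * S) + 4 * X +
        (6 * (Y * S + n * Y) + Y * S) + ((n + 2) * (2 * X + n * (3 * X + Y)) +
      K * (X + n * (3 * X + Y))) := by
        have g2 : Λ * τ * (S + n) ≤ Y * S + n * Y := by
          nlinarith
        gcongr
    _ = (3 * n * (n + 2 + K) + 4 + (n + 2) * (2 + 3 * n) + K * (1 + 3 * n)) * X +
        (6 * n + (n + 2) * n + K * n) * Y + (3 * n + 7) * (Y * S) := by ring
    -- `algConst` dominates the sum of the three coefficients, hence each of them.
    _ ≤ algConst n K * X + algConst n K * Y + algConst n K * (Y * S) := by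
        have p1 : 0 ≤ (n : ℝ) * K := by positivity
        have p2 : 0 ≤ (n : ℝ) * n := by positivity
        gcongr <;> (rw [algConst]; nlinarith)
    _ = _ := by ring

end Algebra

end MongeApprox

namespace MongeApprox

/-! ### Second differences of `C^{1,1}` functions composed with `C²` maps -/

section SemiconcaveComposition

variable {n : ℕ}

/-- `G` is differentiable near `y` with `K`-Lipschitz derivative, and `‖DG(y)‖ ≤ B`. -/
structure C11At (G : E n → ℝ) (y : E n) (B K : ℝ) : Prop where
  exists_ball : ∃ ρ > 0, (∀ a ∈ Metric.ball y ρ, DifferentiableAt ℝ G a) ∧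
    ∀ a ∈ Metric.ball y ρ, ∀ c ∈ Metric.ball y ρ, ‖fderiv ℝ G a - fderiv ℝ G c‖ ≤ K * ‖a - c‖
  norm_fderiv_le : ‖fderiv ℝ G y‖ ≤ B

theorem C11At.neg {G : E n → ℝ} {y : E n} {B K : ℝ} (h : C11At G y B K) :
    C11At (fun x => -G x) y B K := by
  obtain ⟨⟨ρ, hρ, h1, h2⟩, h3⟩ := h
  refine ⟨⟨ρ, hρ, fun a ha => (h1 a ha).neg, fun a ha c hc => ?_⟩, ?_⟩
  · rw [fderiv_fun_neg, fderiv_fun_neg, neg_sub_neg, norm_sub_rev]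
    exact h2 a ha c hc
  · rwa [fderiv_fun_neg, norm_neg]

theorem C11At.differentiableAt {G : E n → ℝ} {y : E n} {B K : ℝ} (h : C11At G y B K) :
    DifferentiableAt ℝ G y := by
  obtain ⟨⟨ρ, hρ, h1, -⟩, -⟩ := h
  exact h1 y (Metric.mem_ball_self hρ)

/-- The second-order chain rule with the missing Hessian of `G` replaced by its Lipschitz bound. The
factor `2` comes from the two increments `±ξ`, each estimated by a Taylor inequality without the
factor `1/2`. -/
theorem C11At.secondDiff_comp_le {G : E n → ℝ} {x ξ : E n} {B K : ℝ} {Φ : E n → E n}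
    (hG : C11At G (Φ x) B K) (hΦ : ContDiffAt ℝ 2 Φ x) {δ : ℝ} (hδ : 0 < δ) :
    ∀ᶠ z in 𝓝 x ×ˢ 𝓝[≠] 0, secondDiff (fun y => G (Φ y)) ξ z ≤
      B * ‖fderiv ℝ (fderiv ℝ Φ) x ξ ξ‖ + 2 * K * ‖fderiv ℝ Φ x ξ‖ ^ 2 + δ := by
  obtain ⟨⟨ρ, hρ, h1, h2⟩, h3⟩ := hG
  have hΦ1 : ContDiffAt ℝ 1 Φ x := hΦ.of_le (by norm_num)
  have l1 := tendsto_difference_quotient hΦ1 ξ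
  have l2 := tendsto_difference_quotient hΦ1 (-ξ)
  have l3 := tendsto_secondDiff hΦ ξ
  have lΦ : Tendsto (fun z : E n × ℝ => Φ z.1) (𝓝 x ×ˢ 𝓝[≠] 0) (𝓝 (Φ x)) :=
    hΦ.continuousAt.tendsto.comp tendsto_fst
  have ldG : Tendsto (fun z : E n × ℝ => fderiv ℝ G (Φ z.1)) (𝓝 x ×ˢ 𝓝[≠] 0)
      (𝓝 (fderiv ℝ G (Φ x))) := by
    have hc : Tendsto (fderiv ℝ G) (𝓝 (Φ x)) (𝓝 (fderiv ℝ G (Φ x))) := by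
      rw [tendsto_iff_norm_sub_tendsto_zero]
      have lb : Tendsto (fun a => K * ‖a - Φ x‖) (𝓝 (Φ x)) (𝓝 0) := by
        have : Continuous fun a => K * ‖a - Φ x‖ := by fun_prop
        simpa using this.tendsto (Φ x)
      refine squeeze_zero' (Eventually.of_forall fun _ => norm_nonneg _) ?_ lb
      filter_upwards [Metric.ball_mem_nhds _ hρ] with a ha
      exact h2 a ha _ (Metric.mem_ball_self hρ)
    exact hc.comp lΦ
  have llim : Tendsto (fun z : E n × ℝ => fderiv ℝ G (Φ z.1) (secondDiff Φ ξ z) +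
      K * (‖z.2⁻¹ • (Φ (z.1 + z.2 • ξ) - Φ z.1)‖ ^ 2 +
        ‖z.2⁻¹ • (Φ (z.1 + z.2 • (-ξ)) - Φ z.1)‖ ^ 2)) (𝓝 x ×ˢ 𝓝[≠] 0)
      (𝓝 (fderiv ℝ G (Φ x) (fderiv ℝ (fderiv ℝ Φ) x ξ ξ) +
        K * (‖fderiv ℝ Φ x ξ‖ ^ 2 + ‖fderiv ℝ Φ x (-ξ)‖ ^ 2))) :=
    (((isBoundedBilinearMap_apply (𝕜 := ℝ) (E := E n) (F := ℝ)).continuous.tendsto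
      (fderiv ℝ G (Φ x), fderiv ℝ (fderiv ℝ Φ) x ξ ξ)).comp (ldG.prodMk_nhds l3)).add (((l1.norm.pow 2).add (l2.norm.pow 2)).const_mul K)
  have hlt : fderiv ℝ G (Φ x) (fderiv ℝ (fderiv ℝ Φ) x ξ ξ) +
      K * (‖fderiv ℝ Φ x ξ‖ ^ 2 + ‖fderiv ℝ Φ x (-ξ)‖ ^ 2) <
      B * ‖fderiv ℝ (fderiv ℝ Φ) x ξ ξ‖ + 2 * K * ‖fderiv ℝ Φ x ξ‖ ^ 2 + δ := by
    have := ((fderiv ℝ G (Φ x)).le_opNorm (fderiv ℝ (fderiv ℝ Φ) x ξ ξ)).trans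
      (mul_le_mul_of_nonneg_right h3 (norm_nonneg _))
    have h4 := (le_abs_self _).trans this
    rw [map_neg, norm_neg]
    linarith
  have hline : ∀ v : E n, Tendsto (fun z : E n × ℝ => z.1 + z.2 • v) (𝓝 x ×ˢ 𝓝[≠] 0) (𝓝 x) := by
    intro v
    have : Continuous fun z : E n × ℝ => z.1 + z.2 • v := by fun_prop
    have h2 := this.tendsto (x, 0)
    simp only [zero_smul, add_zero, nhds_prod_eq] at h2
    exact h2.mono_left (Filter.prod_mono le_rfl nhdsWithin_le_nhds)
  have hne : ∀ᶠ z : E n × ℝ in 𝓝 x ×ˢ 𝓝[≠] 0, z.2 ≠ 0 :=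
    tendsto_snd.eventually eventually_mem_nhdsWithin
  have hball := Metric.ball_mem_nhds (Φ x) hρ
  filter_upwards [llim.eventually (gt_mem_nhds hlt), hne, lΦ.eventually hball,
    (hΦ.continuousAt.tendsto.comp (hline ξ)).eventually hball,
    (hΦ.continuousAt.tendsto.comp (hline (-ξ))).eventually hball] with z hz hz0 b0 b1 b2
  simp only [Function.comp] at b1 b2
  refine le_trans ?_ hz.le
  have htaylor : ∀ a ∈ Metric.ball (Φ x) ρ, ∀ c ∈ Metric.ball (Φ x) ρ,
      G c - G a ≤ fderiv ℝ G a (c - a) + K * ‖c - a‖ ^ 2 := by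
    intro a ha c hc
    have hseg : ∀ y ∈ segment ℝ a c, y ∈ Metric.ball (Φ x) ρ ∧ ‖y - a‖ ≤ ‖c - a‖ := fun y hy =>
      ⟨(convex_ball (Φ x) ρ).segment_subset ha hc hy, by
        obtain ⟨t, ht, rfl⟩ := (segment_eq_image' ℝ a c) ▸ hy
        simp only [add_sub_cancel_left, norm_smul, Real.norm_eq_abs, abs_of_nonneg ht.1]
        exact mul_le_of_le_one_left (norm_nonneg _) ht.2⟩
    have hK0 : 0 ≤ K * ‖c - a‖ := (norm_nonneg _).trans (h2 c hc a ha)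
    rcases eq_or_ne c a with rfl | hca
    · simp
    have hK : 0 ≤ K := nonneg_of_mul_nonneg_left hK0 (norm_pos_iff.2 (sub_ne_zero.2 hca))
    have := (convex_segment a c).norm_image_sub_le_of_norm_hasFDerivWithin_le
      (f := fun y => G y - fderiv ℝ G a y) (f' := fun y => fderiv ℝ G y - fderiv ℝ G a)
      (C := K * ‖c - a‖)
      (fun y hy => ((h1 y (hseg y hy).1).hasFDerivAt.sub
        (fderiv ℝ G a).hasFDerivAt).hasFDerivWithinAt)
      (fun y hy => (h2 y (hseg y hy).1 a ha).trans (by gcongr; exact (hseg y hy).2))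
      (left_mem_segment ℝ a c) (right_mem_segment ℝ a c)
    have h5 := (le_abs_self _).trans this
    rw [map_sub]
    linarith
  have p1 := htaylor _ b0 _ b1
  have p2 := htaylor _ b0 _ b2
  have hz2 : 0 < z.2 ^ 2 := by positivity
  have e1 : z.1 + z.2 • (-ξ) = z.1 - z.2 • ξ := by rw [smul_neg, sub_eq_add_neg]
  rw [e1] at p2 ⊢
  simp only [secondDiff, norm_smul, norm_inv, map_smul, smul_eq_mul, mul_pow, inv_pow,
    Real.norm_eq_abs, sq_abs]
  have e2 : Φ (z.1 + z.2 • ξ) + Φ (z.1 - z.2 • ξ) - (2 : ℝ) • Φ z.1 =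
      (Φ (z.1 + z.2 • ξ) - Φ z.1) + (Φ (z.1 - z.2 • ξ) - Φ z.1) := by module
  rw [e2, map_add]
  calc _ ≤ (z.2 ^ 2)⁻¹ * ((fderiv ℝ G (Φ z.1) (Φ (z.1 + z.2 • ξ) - Φ z.1) +
        K * ‖Φ (z.1 + z.2 • ξ) - Φ z.1‖ ^ 2) + (fderiv ℝ G (Φ z.1) (Φ (z.1 - z.2 • ξ) - Φ z.1) +
        K * ‖Φ (z.1 - z.2 • ξ) - Φ z.1‖ ^ 2)) := by
        gcongr
        linarith
    _ = _ := by ring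

end SemiconcaveComposition

/-! ### The equation differentiated once and twice -/

section Equation

variable {n : ℕ} {ε : ℝ} {u : E n → ℝ} {x : E n} {b : Fin n → E n} {lam : Fin n → ℝ}
  {Q : E n → ℝ}

/-- The derivative of the equation `log det w = Q` in a frame. -/
theorem Frame.derivative_log_det (h : Admissible ε u x) (F : Frame ε u x b lam)
    (hw : ∀ᶠ y in 𝓝 x, (w ε u y).PosDef) (hQ : ∀ᶠ y in 𝓝 x, Real.log (w ε u y).det = Q y)
    (j : Fin n) {q : ℝ} (hq : HasDerivAt (fun τ : ℝ => Q (x + τ • b j)) q 0) :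
    ∑ i, (lam i)⁻¹ * ((-((1 - lam j) * slope ε u x b j) -
      2 * slope ε u x b i * (if j = i then 1 - lam j else 0)) - third u x (b i) (b i) (b j)) =
      q := by
  have hd : ∀ i, HasDerivAt (fun τ : ℝ => bil (w ε u (x + τ • b j)) (b i) (b i))
      ((-((1 - lam j) * slope ε u x b j) -
      2 * slope ε u x b i * (if j = i then 1 - lam j else 0)) - third u x (b i) (b i) (b j)) 0 := by
    intro i
    simp only [bil_w]
    refine (F.jet2_A h i j).hasDerivAt.sub ?_
    obtain ⟨ℓ, hℓ, hℓ'⟩ := hasFDerivAt_hess h.smooth (b i) (b i)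
    rw [third_rotate h.smooth, ← hℓ' (b j)]
    have hl : HasDerivAt (fun τ : ℝ => x + τ • b j) (b j) 0 := by
      simpa using ((hasDerivAt_id (0 : ℝ)).smul_const (b j)).const_add x
    have hℓ0 : HasFDerivAt (fun y => fderiv ℝ (fderiv ℝ u) y (b i) (b i)) ℓ (x + (0 : ℝ) • b j) := by
      simpa using hℓ
    exact hℓ0.comp_hasDerivAt (0 : ℝ) hl
  have hsum := HasDerivAt.fun_sum (u := Finset.univ) fun i _ => (hd i).const_mul ((lam i)⁻¹)
  -- By concavity of `log det`, the linearization minus `Q` is minimal at `0`. Its derivative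
  -- vanishes, which gives the differentiated equation without a formula for the derivative of a
  -- determinant.
  have hmin : IsLocalMin (fun τ : ℝ => ∑ i, (lam i)⁻¹ * bil (w ε u (x + τ • b j)) (b i) (b i) -
      Q (x + τ • b j)) 0 := by
    filter_upwards [eventually_add_smul (b j) hw, eventually_add_smul (b j) hQ] with τ h1 h2
    have h3 := log_det_le hw.self_of_nhds h1
    rw [h2, hQ.self_of_nhds] at h3
    have h4 := F.sum_inv (w ε u (x + τ • b j))
    have h5 := F.sum_inv (w ε u x)
    simp only [mul_sub, Finset.sum_sub_distrib, h4, h5] at h3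
    simp only [zero_smul, add_zero]
    linarith
  exact sub_eq_zero.1 (hmin.hasDerivAt_eq_zero (hsum.sub hq))

theorem Admissible.continuousAt_w (h : Admissible ε u x) : ContinuousAt (w ε u) x :=
  continuousAt_pi.2 fun i => continuousAt_pi.2 fun j => (h.contDiffAt_w i j).continuousAt

theorem continuousAt_w_inv (h : Admissible ε u x) (hw : (w ε u x).PosDef) :
    ContinuousAt (fun y => (w ε u y)⁻¹) x := by
  have hc := h.continuousAt_w
  simp only [Matrix.inv_def, Ring.inverse_eq_inv']
  have h1 : ContinuousAt (fun y => (w ε u y).det) x :=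
    (continuous_id.matrix_det (A := fun M : Matrix (Fin n) (Fin n) ℝ => M)).continuousAt.comp hc
  have h2 : ContinuousAt (fun y => (w ε u y).adjugate) x :=
    (continuous_id.matrix_adjugate (A := fun M : Matrix (Fin n) (Fin n) ℝ => M)).continuousAt.comp hc
  exact (h1.inv₀ hw.det_pos.ne').smul h2

theorem bil_secondDiff (M : E n → Matrix (Fin n) (Fin n) ℝ) (ξ a c : E n) (z : E n × ℝ) :
    bil (Matrix.of fun i j => secondDiff (fun y => M y i j) ξ z) a c =
      secondDiff (fun y => bil (M y) a c) ξ z := by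
  simp only [bil, secondDiff, Matrix.of_apply, smul_eq_mul, Finset.mul_sum,
    ← Finset.sum_add_distrib, ← Finset.sum_sub_distrib]
  refine Finset.sum_congr rfl fun i _ => Finset.sum_congr rfl fun j _ => ?_
  ring

/-- The second derivative of the equation `log det w = Q` in the direction `ξ`, tested against a
function touching `D²u ξ ξ` from below. -/
theorem Frame.second_derivative_log_det (h : Admissible ε u x) (F : Frame ε u x b lam)
    (hw : ∀ᶠ y in 𝓝 x, (w ε u y).PosDef) (hQ : ∀ᶠ y in 𝓝 x, Real.log (w ε u y).det = Q y)
    {ξ : E n} {RQ : ℝ}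
    (hRQ : ∀ δ > 0, ∀ᶠ z in 𝓝 x ×ˢ 𝓝[≠] 0, -secondDiff Q ξ z ≤ RQ + δ)
    {ψ : E n → ℝ} (hψ : ContDiffAt ℝ 2 ψ x)
    (hle : ∀ᶠ y in 𝓝 x, ψ y ≤ fderiv ℝ (fderiv ℝ u) y ξ ξ)
    (heq : ψ x = fderiv ℝ (fderiv ℝ u) x ξ ξ) :
    ∑ i, (lam i)⁻¹ * fderiv ℝ (fderiv ℝ ψ) x (b i) (b i) ≤
      ∑ i, (lam i)⁻¹ * fderiv ℝ (fderiv ℝ (fun y => bil (A ε u y) (b i) (b i))) x ξ ξ + RQ := by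
  have hres := sum_hess_le_of_touching (a := fun y => (w ε u y)⁻¹) (u := u) (ξ := ξ)
    (R := ∑ i, (lam i)⁻¹ * fderiv ℝ (fderiv ℝ (fun y => bil (A ε u y) (b i) (b i))) x ξ ξ + RQ)
    (h.eventually.mono fun y hy => hy.smooth.of_le (by norm_num)) hψ hle heq
    (hw.mono fun y hy => hy.inv.posSemidef) (continuousAt_w_inv h hw.self_of_nhds) ?_
  · rw [F.sum_inv] at hres
    simpa only [bil_hess] using hres
  intro δ hδ
  set X : Matrix (Fin n) (Fin n) ℝ :=
    Matrix.of fun i j => fderiv ℝ (fderiv ℝ (fun y => A ε u y i j)) x ξ ξ with hX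
  have hlimA : ∀ i j, Tendsto (secondDiff (fun y => A ε u y i j) ξ) (𝓝 x ×ˢ 𝓝[≠] 0)
      (𝓝 (X i j)) := fun i j => tendsto_secondDiff (h.contDiffAt_A i j) ξ
  have hXb : ∀ a c, bil X a c = fderiv ℝ (fderiv ℝ (fun y => bil (A ε u y) a c)) x ξ ξ := by
    intro a c
    refine tendsto_nhds_unique (f := fun z => secondDiff (fun y => bil (A ε u y) a c) ξ z)
      (l := 𝓝 x ×ˢ 𝓝[≠] 0) ?_ (tendsto_secondDiff (h.contDiffAt_bil_A a c) ξ)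
    simp only [← bil_secondDiff]
    exact tendsto_finsetSum _ fun i _ => tendsto_finsetSum _ fun j _ =>
      (hlimA i j).mul_const _
  have hlim : Tendsto (fun z : E n × ℝ => ∑ i, ∑ j, (w ε u z.1)⁻¹ i j *
      secondDiff (fun y => A ε u y i j) ξ z) (𝓝 x ×ˢ 𝓝[≠] 0)
      (𝓝 (∑ i, (lam i)⁻¹ * fderiv ℝ (fderiv ℝ (fun y => bil (A ε u y) (b i) (b i))) x ξ ξ)) := by
    have e1 : ∑ i, (lam i)⁻¹ * fderiv ℝ (fderiv ℝ (fun y => bil (A ε u y) (b i) (b i))) x ξ ξ =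
        ∑ i, ∑ j, (w ε u x)⁻¹ i j * X i j := by
      rw [F.sum_inv]
      simp only [hXb]
    rw [e1]
    refine tendsto_finsetSum _ fun i _ => tendsto_finsetSum _ fun j _ => Tendsto.mul ?_ (hlimA i j)
    exact (((continuous_apply_apply i j).tendsto _).comp
      (continuousAt_w_inv h hw.self_of_nhds).tendsto).comp tendsto_fst
  have hline : ∀ v : E n, Tendsto (fun z : E n × ℝ => z.1 + z.2 • v) (𝓝 x ×ˢ 𝓝[≠] 0) (𝓝 x) := by
    intro v
    have : Continuous fun z : E n × ℝ => z.1 + z.2 • v := by fun_prop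
    have h2 := this.tendsto (x, 0)
    simp only [zero_smul, add_zero, nhds_prod_eq] at h2
    exact h2.mono_left (Filter.prod_mono le_rfl nhdsWithin_le_nhds)
  have hwQ := hw.and hQ
  have hne : ∀ᶠ z : E n × ℝ in 𝓝 x ×ˢ 𝓝[≠] 0, z.2 ≠ 0 :=
    tendsto_snd.eventually eventually_mem_nhdsWithin
  filter_upwards [hlim.eventually (gt_mem_nhds (lt_add_of_pos_right _ (half_pos hδ))),
    hRQ _ (half_pos hδ), tendsto_fst.eventually hwQ, (hline ξ).eventually hwQ,
    (hline (-ξ)).eventually hwQ, hne] with z h1 h2 h3 h4 h5 hz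
  rw [smul_neg, ← sub_eq_add_neg] at h5
  -- Concavity at the two points `z.1 ± z.2 • ξ`, added, bounds the second difference of `Q` by the
  -- linearized operator applied to the second difference of `w`.
  have k1 := log_det_le h3.1 h4.1
  have k2 := log_det_le h3.1 h5.1
  rw [h3.2, h4.2] at k1
  rw [h3.2, h5.2] at k2
  have hz2 : 0 < (z.2 ^ 2)⁻¹ := by positivity
  have e2 : ∑ i, ∑ j, (w ε u z.1)⁻¹ i j * secondDiff (fun y => hess u y i j) ξ z =
      ∑ i, ∑ j, (w ε u z.1)⁻¹ i j * secondDiff (fun y => A ε u y i j) ξ z -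
      (z.2 ^ 2)⁻¹ * (∑ i, ∑ j, (w ε u z.1)⁻¹ i j * (w ε u (z.1 + z.2 • ξ) i j - w ε u z.1 i j) +
        ∑ i, ∑ j, (w ε u z.1)⁻¹ i j * (w ε u (z.1 - z.2 • ξ) i j - w ε u z.1 i j)) := by
    simp only [Finset.mul_sum, mul_add, ← Finset.sum_add_distrib, ← Finset.sum_sub_distrib]
    refine Finset.sum_congr rfl fun i _ => Finset.sum_congr rfl fun j _ => ?_
    simp only [secondDiff, w, Matrix.sub_apply, smul_eq_mul]
    ring
  rw [e2]
  have k3 : secondDiff Q ξ z ≤ (z.2 ^ 2)⁻¹ *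
      (∑ i, ∑ j, (w ε u z.1)⁻¹ i j * (w ε u (z.1 + z.2 • ξ) i j - w ε u z.1 i j) +
        ∑ i, ∑ j, (w ε u z.1)⁻¹ i j * (w ε u (z.1 - z.2 • ξ) i j - w ε u z.1 i j)) := by
    rw [secondDiff, smul_eq_mul, smul_eq_mul]
    gcongr
    linarith
  linarith

end Equation

end MongeApprox

/-! ### The estimate at an interior maximum -/

namespace MongeApprox

variable {n : ℕ}

theorem hasDerivAt_comp_line {V W : Type*} [NormedAddCommGroup V] [NormedSpace ℝ V]
    [NormedAddCommGroup W] [NormedSpace ℝ W] {h : V → W} {ℓ : V →L[ℝ] W} {x : V}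
    (hℓ : HasFDerivAt h ℓ x) (v : V) : HasDerivAt (fun τ : ℝ => h (x + τ • v)) (ℓ v) 0 := by
  have hl : HasDerivAt (fun τ : ℝ => x + τ • v) v 0 := by
    simpa using ((hasDerivAt_id (0 : ℝ)).smul_const v).const_add x
  have h0 : HasFDerivAt h ℓ (x + (0 : ℝ) • v) := by simpa using hℓ
  exact h0.comp_hasDerivAt (0 : ℝ) hl

theorem jet2_cutoff (x c v : E n) {r M : ℝ} (hζ : 0 < r ^ 2 - ‖x - c‖ ^ 2) :
    Jet2 (fun τ : ℝ => M / (r ^ 2 - ‖x + τ • v - c‖ ^ 2) ^ 2)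
      (M / (r ^ 2 - ‖x - c‖ ^ 2) ^ 2)
      (M / (r ^ 2 - ‖x - c‖ ^ 2) ^ 2 * (4 * ⟪x - c, v⟫ / (r ^ 2 - ‖x - c‖ ^ 2)))
      (M / (r ^ 2 - ‖x - c‖ ^ 2) ^ 2 * (24 * ⟪x - c, v⟫ ^ 2 / (r ^ 2 - ‖x - c‖ ^ 2) ^ 2 +
        4 * ‖v‖ ^ 2 / (r ^ 2 - ‖x - c‖ ^ 2))) := by
  have hl := (Jet2.line x v).sub (Jet2.const c)
  simp only [sub_zero] at hl
  have h1 := (Jet2.const (r ^ 2)).sub (hl.inner hl)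
  have h2 := (Jet2.const M).mul ((h1.mul h1).inv (by
    rw [real_inner_self_eq_norm_sq]; positivity))
  simp only [real_inner_self_eq_norm_sq, real_inner_comm (x - c) v, inner_zero_left,
    inner_zero_right] at h2
  set D := r ^ 2 - ‖x - c‖ ^ 2
  convert h2 using 1
  · funext τ
    rw [div_eq_mul_inv, pow_two (r ^ 2 - _)]
  · field_simp
  · field_simp
    ring
  · field_simp
    ring

theorem contDiffAt_cutoff (x c : E n) {r M : ℝ} (hζ : 0 < r ^ 2 - ‖x - c‖ ^ 2) :
    ContDiffAt ℝ 2 (fun y : E n => M / (r ^ 2 - ‖y - c‖ ^ 2) ^ 2) x := by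
  refine contDiffAt_const.div ?_ (by positivity)
  exact (contDiffAt_const.sub ((contDiffAt_id.sub contDiffAt_const).norm_sq ℝ)).pow 2

/-- The zeroth order terms of the logarithm of the equation. -/
noncomputable def logRhs (ε : ℝ) (u : E n → ℝ) (F G : E n → ℝ) (c₀ : ℝ) (x : E n) : ℝ :=
  (n + 2) * Real.log (Real.sqrt (1 - ‖gradient u x‖ ^ 2)) + (F x - G (T ε u x)) + c₀

section Max

variable {ε : ℝ} {u F G : E n → ℝ} {x : E n} {b : Fin n → E n} {lam : Fin n → ℝ} {m : Fin n}
  {c₀ Bf Kf Bg Kg : ℝ}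

theorem Frame.hasDerivAt_logRhs (h : Admissible ε u x) (hb : Frame ε u x b lam)
    (hF : C11At F x Bf Kf) (hG : C11At G (T ε u x) Bg Kg) (j : Fin n) :
    HasDerivAt (fun τ : ℝ => logRhs ε u F G c₀ (x + τ • b j))
      ((n + 2) * (-((1 - lam j) * slope ε u x b j)) +
        (fderiv ℝ F x (b j) - fderiv ℝ G (T ε u x) (lam j • b j))) 0 := by
  have d1 := (hb.jet2_log_sqrt h j).hasDerivAt.const_mul ((n : ℝ) + 2)
  have d2 := hasDerivAt_comp_line hF.differentiableAt.hasFDerivAt (b j)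
  have hT := (h.contDiffAt_T.differentiableAt (by simp)).hasFDerivAt
  have d4 := hasDerivAt_comp_line (hG.differentiableAt.hasFDerivAt.comp x hT) (b j)
  rw [ContinuousLinearMap.comp_apply, hb.fderiv_T h j] at d4
  exact (d1.add (d2.sub d4)).add_const c₀

/-- The term in `Du` has a genuine limit, the terms in `F` and `G ∘ T` only one-sided bounds; each
of the three takes a third of `δ`. -/
theorem Frame.neg_secondDiff_logRhs_le (h : Admissible ε u x) (hb : Frame ε u x b lam)
    (hF : C11At F x Bf Kf) (hG : C11At G (T ε u x) Bg Kg) {δ : ℝ} (hδ : 0 < δ) :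
    ∀ᶠ z in 𝓝 x ×ˢ 𝓝[≠] 0, -secondDiff (logRhs ε u F G c₀) (b m) z ≤
      -((n + 2) * (-(L ε u x / ε ^ 2 * (1 - lam m) ^ 2) -
        ∑ k, third u x (b m) (b m) (b k) * slope ε u x b k -
        (1 - lam m) ^ 2 * slope ε u x b m ^ 2)) +
      (2 * Kf * ‖b m‖ ^ 2 + (Bg * ‖fderiv ℝ (fderiv ℝ (T ε u)) x (b m) (b m)‖ +
        2 * Kg * ‖lam m • b m‖ ^ 2)) + δ := by
  have hδ3 : 0 < δ / 3 := by positivity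
  have hlog : ContDiffAt ℝ 2 (fun y => Real.log (Real.sqrt (1 - ‖gradient u y‖ ^ 2))) x :=
    h.contDiffAt_sqrt.log h.sqrt_pos.ne'
  have e1 := ((ContDiffAt.jet2 hlog (b m)).unique (hb.jet2_log_sqrt h m)).2.2
  have l1 := (tendsto_secondDiff hlog (b m)).const_mul (-((n : ℝ) + 2))
  have l2 := hF.neg.secondDiff_comp_le (Φ := fun y => y) (ξ := b m) contDiffAt_id hδ3
  have l3 := hG.secondDiff_comp_le (ξ := b m) h.contDiffAt_T hδ3
  have e2 : fderiv ℝ (fun y : E n => y) = fun _ => ContinuousLinearMap.id ℝ (E n) :=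
    funext fun y => fderiv_fun_id
  rw [e2] at l2
  simp only [fderiv_fun_const, Pi.zero_apply, zero_apply, norm_zero, mul_zero, zero_add,
    ContinuousLinearMap.id_apply] at l2
  rw [hb.fderiv_T h m] at l3
  filter_upwards [l1.eventually (gt_mem_nhds (lt_add_of_pos_right _ hδ3)), l2, l3] with z h1 h2 h3
  rw [e1] at h1
  have e3 : -secondDiff (logRhs ε u F G c₀) (b m) z = -((n : ℝ) + 2) *
      secondDiff (fun y => Real.log (Real.sqrt (1 - ‖gradient u y‖ ^ 2))) (b m) z +
      secondDiff (fun y => -F y) (b m) z + secondDiff (fun y => G (T ε u y)) (b m) z := by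
    simp only [secondDiff, logRhs, smul_eq_mul]
    ring
  rw [e3]
  linarith

set_option maxHeartbeats 1600000 in
/-- The main estimate at a maximum point of `ζ²` times the largest eigenvalue. -/
theorem Frame.estimate_at_max (h : Admissible ε u x) (hb : Frame ε u x b lam)
    (hw : ∀ᶠ y in 𝓝 x, (w ε u y).PosDef)
    (hQ : ∀ᶠ y in 𝓝 x, Real.log (w ε u y).det = logRhs ε u F G c₀ y)
    (hF : C11At F x Bf Kf) (hG : C11At G (T ε u x) Bg Kg)
    (hmax : ∀ i, lam i ≤ lam m) (hm1 : 1 ≤ lam m) {c : E n} {r M Λ K τ : ℝ} (hr : 0 < r)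
    (hζ : 0 < r ^ 2 - ‖x - c‖ ^ 2) (hM : lam m = M / (r ^ 2 - ‖x - c‖ ^ 2) ^ 2)
    (htouch : ∀ᶠ y in 𝓝 x, bil (A ε u y) (b m) (b m) * (1 - M / (r ^ 2 - ‖y - c‖ ^ 2) ^ 2) ≤
      fderiv ℝ (fderiv ℝ u) y (b m) (b m))
    (hLΛ : L ε u x ≤ Λ) (hBf : 0 ≤ Bf) (hBg : 0 ≤ Bg) (hKf : 0 ≤ Kf) (hKg : 0 ≤ Kg)
    (hK1 : Λ * (Bf + Bg) ≤ K) (hK2 : 2 * Kf * Λ ^ 2 + 6 * Bg * Λ + 2 * Kg * Λ ^ 2 ≤ K)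
    (hτ : τ = (r ^ 2 + 6 * r * Λ) / (r ^ 2 - ‖x - c‖ ^ 2)) :
    (1 - lam m) ^ 2 * ∑ i, (lam i)⁻¹ ≤
      algConst n K * (lam m ^ 2 + lam m * τ ^ 2 * (∑ i, (lam i)⁻¹ + 1)) := by
  have hL := h.L_pos
  have hε := h.eps_pos
  have hΛ : 0 < Λ := hL.trans_le hLΛ
  -- The only quantity here that is unbounded as `ε → 0`; all bounds below are arranged to be
  -- homogeneous in it.
  set κ := Real.sqrt (L ε u x) / ε with hκdef
  have hκ : 0 < κ := div_pos (Real.sqrt_pos.2 hL) hε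
  have hκL : κ ^ 2 = L ε u x / ε ^ 2 := by
    rw [hκdef, div_pow, Real.sq_sqrt hL.le]
  set ζ := r ^ 2 - ‖x - c‖ ^ 2 with hζdef
  have hζr : ζ ≤ r ^ 2 := by nlinarith [sq_nonneg ‖x - c‖]
  have hxr : ‖x - c‖ ≤ r := by
    refine abs_le_of_sq_le_sq' ?_ hr.le |>.2
    linarith
  have hbn : ∀ k, ‖b k‖ ≤ Λ * κ := fun k => by
    have h1 : ‖b k‖ ^ 2 ≤ (L ε u x * κ) ^ 2 := by
      refine (hb.norm_sq_le h k).trans (le_of_eq ?_)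
      rw [mul_pow, hκL]; field_simp
    have h2 := abs_le_of_sq_le_sq' h1 (by positivity) |>.2
    exact h2.trans (by gcongr)
  have hy : ∀ k, |slope ε u x b k| ≤ κ := fun k =>
    abs_le_of_sq_le_sq (by rw [hκL]; exact hb.slope_sq_le h k) hκ.le
  have hlm := hb.pos m
  have hin : ∀ k, |⟪x - c, b k⟫| ≤ r * (Λ * κ) := fun k =>
    (abs_real_inner_le_norm _ _).trans (by gcongr; exact hbn k)
  have hτ1 : 1 ≤ τ := by
    rw [hτ, one_le_div hζ]
    have : 0 < 6 * r * Λ := by positivity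
    linarith
  set θ : Fin n → ℝ := fun k => lam m * (4 * ⟪x - c, b k⟫ / ζ) with hθdef
  set θ2 : Fin n → ℝ := fun k => lam m * (24 * ⟪x - c, b k⟫ ^ 2 / ζ ^ 2 + 4 * ‖b k‖ ^ 2 / ζ)
    with hθ2def
  set z : Fin n → Fin n → ℝ := fun i k => third u x (b i) (b i) (b k) with hz
  set ψ : E n → ℝ := fun y => bil (A ε u y) (b m) (b m) * (1 - M / (r ^ 2 - ‖y - c‖ ^ 2) ^ 2)
    with hψ
  have hψC : ContDiffAt ℝ 2 ψ x :=
    (h.contDiffAt_bil_A _ _).mul (contDiffAt_const.sub (contDiffAt_cutoff x c hζ))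
  have hψx : ψ x = fderiv ℝ (fderiv ℝ u) x (b m) (b m) := by
    simp only [hψ]
    rw [hb.bilA, hb.fderiv_fderiv, ← hζdef, ← hM]
    simp
  have hψjet : ∀ i, Jet2 (fun τ : ℝ => ψ (x + τ • b i)) (1 - lam m)
      ((-((1 - lam i) * slope ε u x b i) - 2 * slope ε u x b m *
        (if i = m then 1 - lam i else 0)) * (1 - lam m) - θ i)
      ((-(κ ^ 2 * (1 - lam i) ^ 2) - ∑ k, z i k * slope ε u x b k +
        (if i = m then (1 - lam i) ^ 2 * (4 * slope ε u x b i ^ 2 - 2 * (1 / L ε u x)) else 0) -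
        2 * slope ε u x b m * z i m) * (1 - lam m) -
        2 * (-((1 - lam i) * slope ε u x b i) - 2 * slope ε u x b m *
          (if i = m then 1 - lam i else 0)) * θ i - θ2 i) := by
    intro i
    have hj := (hb.jet2_A h m i).mul ((Jet2.const (1 : ℝ)).sub (jet2_cutoff (M := M) x c (b i) hζ))
    rw [← hζdef, ← hM] at hj
    rw [hκL, mul_one_div]
    convert hj using 1
    · ring
    · simp only [hθdef]; ring
    · simp only [hθdef, hθ2def, hz]; ring
  have hmin : IsLocalMin (fun y => fderiv ℝ (fderiv ℝ u) y (b m) (b m) - ψ y) x := by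
    filter_upwards [htouch] with y hy
    rw [← hψx, sub_self]
    exact sub_nonneg.2 hy
  -- First-order condition: `D²u(b_m,b_m) - ψ` has a local minimum at `x`, so the third derivatives
  -- along `b_m` equal the derivatives of `ψ`.
  have h2 : ∀ k, z m k = (-((1 - lam k) * slope ε u x b k) -
      2 * slope ε u x b m * (if k = m then 1 - lam k else 0)) * (1 - lam m) - θ k := by
    intro k
    obtain ⟨ℓ, hℓ, hℓ'⟩ := hasFDerivAt_hess h.smooth (b m) (b m)
    have hd := hasDerivAt_comp_line hℓ (b k)
    have hmin' : IsLocalMin (fun τ : ℝ => fderiv ℝ (fderiv ℝ u) (x + τ • b k) (b m) (b m) -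
        ψ (x + τ • b k)) 0 := by
      filter_upwards [eventually_add_smul (b k) hmin] with τ hτ
      simpa using hτ
    have := hmin'.hasDerivAt_eq_zero (hd.sub (hψjet k).hasDerivAt)
    simp only [hz]
    rw [third_rotate h.smooth, ← hℓ']
    linarith
  have h1 := fun k => hb.derivative_log_det h hw hQ k (hb.hasDerivAt_logRhs (c₀ := c₀) h hF hG k)
  set R' : ℝ := 2 * Kf * ‖b m‖ ^ 2 + (Bg * ‖fderiv ℝ (fderiv ℝ (T ε u)) x (b m) (b m)‖ +
        2 * Kg * ‖lam m • b m‖ ^ 2) with hR'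
  set R : ℝ := -((n + 2) * (-(κ ^ 2 * (1 - lam m) ^ 2) - ∑ k, z m k * slope ε u x b k -
      (1 - lam m) ^ 2 * slope ε u x b m ^ 2)) + R' with hR
  have h3 := hb.second_derivative_log_det h hw hQ (ξ := b m) (RQ := R)
    (fun δ hδ => by
      rw [hR, hκL]
      exact hb.neg_secondDiff_logRhs_le h hF hG hδ) hψC htouch hψx
  have e1 : ∀ i, fderiv ℝ (fderiv ℝ ψ) x (b i) (b i) = _ := fun i =>
    ((ContDiffAt.jet2 hψC (b i)).unique (hψjet i)).2.2
  have e2 : ∀ i, fderiv ℝ (fderiv ℝ (fun y => bil (A ε u y) (b i) (b i))) x (b m) (b m) = _ :=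
    fun i => ((ContDiffAt.jet2 (h.contDiffAt_bil_A (b i) (b i)) (b m)).unique
      (hb.jet2_A h i m)).2.2
  simp only [e1, e2, ← hκL] at h3
  have h3' := cancel_third (κ := κ) (ℓ := 1 / L ε u x) (z := z) (y := slope ε u x b) (θ := θ)
    (θ2 := θ2) (R := R) (m := m) hb.pos h1 h2 (by simpa only [mul_one_div] using h3)
  have hKΛ : 0 ≤ K := le_trans (by positivity) hK1
  refine le_of_cancel_third (κ := κ) (ℓ := 1 / L ε u x) (z := z) (y := slope ε u x b) (θ := θ)
    (θ2 := θ2) (R := R) (R' := R') (K := K) (τ := τ) hκ (by positivity) hb.pos hmax hm1 hτ1 hKΛ hy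
    ?_ ?_ ?_ (fun k => rfl) rfl ?_ h2 h3'
  · intro k
    simp only [hθdef]
    rw [abs_mul, abs_of_pos hlm, abs_div, abs_of_pos hζ, abs_mul, abs_of_pos (by norm_num : (0:ℝ) < 4)]
    calc lam m * (4 * |⟪x - c, b k⟫| / ζ) ≤ lam m * (4 * (r * (Λ * κ)) / ζ) := by
          gcongr; exact hin k
      _ = κ * lam m * ((4 * r * Λ) / ζ) := by ring
      _ ≤ κ * lam m * τ := by
          rw [hτ]
          gcongr
          have : 0 < r * Λ := by positivity
          linarith [sq_nonneg r]
  · intro k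
    simp only [hθ2def]
    have hb2 : ‖b k‖ ^ 2 ≤ (Λ * κ) ^ 2 := by gcongr; exact hbn k
    have hi2 : ⟪x - c, b k⟫ ^ 2 ≤ (r * (Λ * κ)) ^ 2 := by
      rw [← sq_abs]; gcongr; exact hin k
    rw [abs_of_nonneg (by positivity)]
    have h5 : 4 * ‖b k‖ ^ 2 / ζ ≤ 4 * (Λ * κ) ^ 2 * r ^ 2 / ζ ^ 2 := by
      rw [div_le_div_iff₀ hζ (by positivity)]
      calc 4 * ‖b k‖ ^ 2 * ζ ^ 2 = (4 * ‖b k‖ ^ 2 * ζ) * ζ := by ring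
        _ ≤ (4 * (Λ * κ) ^ 2 * r ^ 2) * ζ := by gcongr
    calc _ ≤ lam m * (24 * (r * (Λ * κ)) ^ 2 / ζ ^ 2 + 4 * (Λ * κ) ^ 2 * r ^ 2 / ζ ^ 2) := by
          gcongr
      _ = κ ^ 2 * lam m * ((28 * (r * Λ) ^ 2) / ζ ^ 2) := by ring
      _ ≤ κ ^ 2 * lam m * τ ^ 2 := by
          -- The two terms of the cutoff's second derivative contribute `24 + 4 = 28 ≤ 6²`, hence
          -- the `6` in `τ`; the summand `r²` there ensures `1 ≤ τ`.
          have h28 : 28 * (r * Λ) ^ 2 ≤ (r ^ 2 + 6 * r * Λ) ^ 2 := by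
            have : 0 ≤ r ^ 4 + 12 * r ^ 3 * Λ + 8 * (r * Λ) ^ 2 := by positivity
            linarith
          rw [hτ, div_pow (r ^ 2 + 6 * r * Λ)]
          exact mul_le_mul_of_nonneg_left
            (div_le_div_of_nonneg_right h28 (by positivity)) (by positivity)
  · intro k
    have f1 : |fderiv ℝ F x (b k)| ≤ Bf * (Λ * κ) :=
      ((fderiv ℝ F x).le_opNorm (b k)).trans (by
        gcongr
        exacts [hF.norm_fderiv_le, hbn k])
    have f2 : |fderiv ℝ G (T ε u x) (lam k • b k)| ≤ Bg * (lam m * (Λ * κ)) :=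
      ((fderiv ℝ G (T ε u x)).le_opNorm _).trans (by
        rw [norm_smul, Real.norm_eq_abs, abs_of_pos (hb.pos k)]
        have := hb.pos k
        gcongr
        exacts [hG.norm_fderiv_le, hmax k, hbn k])
    calc _ ≤ |fderiv ℝ F x (b k)| + |fderiv ℝ G (T ε u x) (lam k • b k)| := abs_sub _ _
      _ ≤ Bf * (Λ * κ) + Bg * (lam m * (Λ * κ)) := add_le_add f1 f2
      _ ≤ (lam m * Bf) * (Λ * κ) + Bg * (lam m * (Λ * κ)) := by
          gcongr
          exact le_mul_of_one_le_left hBf hm1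
      _ = κ * lam m * (Λ * (Bf + Bg)) := by ring
      _ ≤ _ := by gcongr
  · have hTT := hb.norm_second_derivative_T_le h m hκ hκL
    have hb2 : ‖b m‖ ^ 2 ≤ (Λ * κ) ^ 2 := by gcongr; exact hbn m
    set Z := ∑ k, |z m k| with hZ
    have hZ0 : 0 ≤ Z := Finset.sum_nonneg fun k _ => abs_nonneg _
    have hc2 : (1 - lam m) ^ 2 ≤ lam m ^ 2 := by nlinarith
    have hl2 : 1 ≤ lam m ^ 2 := by nlinarith
    have hTT' : ‖fderiv ℝ (fderiv ℝ (T ε u)) x (b m) (b m)‖ ≤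
        Λ * (6 * κ ^ 2 * lam m ^ 2 + 2 * κ * Z) :=
      hTT.trans (by gcongr)
    rw [hR', norm_smul, Real.norm_eq_abs, abs_of_pos hlm, mul_pow]
    calc _ ≤ 2 * Kf * (Λ * κ) ^ 2 + (Bg * (Λ * (6 * κ ^ 2 * lam m ^ 2 + 2 * κ * Z)) +
          2 * Kg * (lam m ^ 2 * (Λ * κ) ^ 2)) := by gcongr
      _ ≤ 2 * Kf * ((Λ * κ) ^ 2 * lam m ^ 2) + (Bg * (Λ * (6 * κ ^ 2 * lam m ^ 2 + 6 * κ * Z)) +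
          2 * Kg * (lam m ^ 2 * (Λ * κ) ^ 2)) := by
          gcongr
          · exact le_mul_of_one_le_right (by positivity) hl2
          · norm_num
      _ = (2 * Kf * Λ ^ 2 + 6 * Bg * Λ + 2 * Kg * Λ ^ 2) * (κ ^ 2 * lam m ^ 2) +
          (6 * Bg * Λ) * (κ * Z) := by ring
      _ ≤ K * (κ ^ 2 * lam m ^ 2) + K * (κ * Z) := by
          gcongr
          have : 0 ≤ 2 * Kf * Λ ^ 2 := by positivity
          have : 0 ≤ 2 * Kg * Λ ^ 2 := by positivity
          linarith
      _ = _ := by ring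

end Max

end MongeApprox

namespace MongeApprox

/-! ### Consequences of `c_ε`-concavity and of the equation -/

namespace IsCConcaveSolution

variable {n : ℕ} {ε : ℝ} {Ω Ωs : Set (E n)} {f g u : E n → ℝ} {x : E n}

theorem admissible (h : IsCConcaveSolution ε Ω Ωs f g u) (hε : 0 < ε) (hΩ : IsOpen Ω)
    (hΩs : Bornology.IsBounded Ωs) (hx : x ∈ Ω) : Admissible ε u x := by
  obtain ⟨y, hy⟩ := h.cConcave.exists_contact hΩs hx
  have hxΩ := hΩ.mem_nhds hx
  have hsm : ContDiffAt ℝ 3 u x := h.regular.1.contDiffAt hxΩ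
  refine ⟨hε, hsm, ?_⟩
  have h1 := one_sub_norm_gradient_sq_of_contact hε hxΩ (hsm.differentiableAt (by simp)) hy
  have h2 := cost_pos hε x y
  have h3 : 0 < (ε / cost ε x y) ^ 2 := by positivity
  linarith

/-- `L` is the cost of moving `x` to `T(x)`, so it is controlled by the domains alone. This amounts
to the gradient bound. -/
theorem L_le (h : IsCConcaveSolution ε Ω Ωs f g u) (hε : 0 < ε) (hε1 : ε ≤ 1) (hΩ : IsOpen Ω)
    (hΩs : Bornology.IsBounded Ωs) (hx : x ∈ Ω) {R : ℝ} (hR : ∀ a ∈ Ω, ∀ y ∈ Ωs, ‖a - y‖ ≤ R) :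
    L ε u x ≤ Real.sqrt (1 + R ^ 2) := by
  obtain ⟨y, hy⟩ := h.cConcave.exists_contact hΩs hx
  have hxΩ := hΩ.mem_nhds hx
  have hd := (h.admissible hε hΩ hΩs hx).smooth.differentiableAt (by simp)
  have hyΩ : y ∈ Ωs := T_of_contact hε hxΩ hd hy ▸ h.mapsTo hx
  rw [L_of_contact hε hxΩ hd hy, cost]
  have := hR x hx y hyΩ
  gcongr
  exact pow_le_one₀ hε.le hε1

/-- Contact gives semidefiniteness; the equation excludes a zero determinant. -/
theorem posDef_w (h : IsCConcaveSolution ε Ω Ωs f g u) (hε : 0 < ε) (hΩ : IsOpen Ω)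
    (hΩs : Bornology.IsBounded Ωs) (hf : ∀ a ∈ Ω, 0 < f a) (hg : ∀ y ∈ Ωs, 0 < g y) (hx : x ∈ Ω) :
    (w ε u x).PosDef := by
  have ha := h.admissible hε hΩ hΩs hx
  obtain ⟨y, hy⟩ := h.cConcave.exists_contact hΩs hx
  have hpos : (w ε u x).PosSemidef := by
    refine Matrix.PosSemidef.of_dotProduct_mulVec_nonneg ha.isHermitian_w fun v => ?_
    rw [dotProduct_mulVec_eq_bil]
    exact bil_w_nonneg_of_contact hε (hΩ.mem_nhds hx) (ha.smooth.of_le (by norm_num)) hy _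
  rw [hpos.posDef_iff_det_ne_zero, h.equation x hx]
  have := ha.L_pos
  have := hf x hx
  have := hg _ (h.mapsTo hx)
  positivity

theorem prod_eq (h : IsCConcaveSolution ε Ω Ωs f g u) (hx : x ∈ Ω) (ha : Admissible ε u x)
    {b : Fin n → E n} {lam : Fin n → ℝ} (hb : Frame ε u x b lam) :
    ∏ i, lam i = f x / g (T ε u x) := by
  have h1 := hb.det
  have h2 := ha.L_pos
  have h3 := ha.eps_pos
  rw [h.equation x hx, ha.det_A] at h1
  exact (mul_left_cancel₀ (by positivity) h1).symm

theorem log_det_eq (h : IsCConcaveSolution ε Ω Ωs f g u) (hx : x ∈ Ω) (ha : Admissible ε u x)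
    (hf : 0 < f x) (hg : 0 < g (T ε u x)) :
    Real.log (w ε u x).det = logRhs ε u (fun a => Real.log (f a)) (fun a => Real.log (g a))
      (-(n * Real.log ε)) x := by
  have hs := ha.sqrt_pos
  have hε := ha.eps_pos
  have hL := ha.L_pos
  rw [h.equation x hx, logRhs, Real.log_mul (by positivity) (by positivity),
    Real.log_div (by positivity) (by positivity), Real.log_div hf.ne' hg.ne', Real.log_pow,
    Real.log_pow, L, Real.log_div hε.ne' hs.ne']
  push_cast
  ring

end IsCConcaveSolution

section Eigenvalues

variable {n : ℕ} {ε : ℝ} {u : E n → ℝ} {x : E n}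

theorem exists_eigenbasis (hA : (A ε u x).PosDef) (hw : (w ε u x).PosDef) :
    ∃ (b : Module.Basis (Fin n) ℝ (Fin n → ℝ)) (lam : Fin n → ℝ),
      (∀ i, ((A ε u x)⁻¹ * w ε u x).mulVec (b i) = lam i • b i) ∧ (∀ i, 0 < lam i) ∧
        ∑ i, lam i = W ε u x := by
  obtain ⟨P, lam, h1, h2, h3⟩ := exists_frame hA hw
  obtain ⟨b, hb⟩ := exists_basis_of_frame h1 h2
  refine ⟨b, lam, hb, h3, ?_⟩
  have hs : (w ε u x).transpose = w ε u x := by simpa using hw.isHermitian.eq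
  rw [W, sum_mul_eq_trace, hs, frame_inv h1, trace_frame h2]

theorem Frame.bil_A_self {b : Fin n → E n} {lam : Fin n → ℝ} (F : Frame ε u x b lam) (a : E n) :
    bil (A ε u x) a a = ∑ k, bil (A ε u x) (b k) a ^ 2 := by
  have h1 := F.inner_expand a a
  have h2 := F.inner_expand (gradient u x) a
  have h3 : bil (A ε u x) a a = ∑ k, bil (A ε u x) (b k) a *
      ((⟪a, b k⟫ - ⟪gradient u x, b k⟫ * ⟪gradient u x, a⟫) / L ε u x) := by
    have : ∑ k, bil (A ε u x) (b k) a *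
        ((⟪a, b k⟫ - ⟪gradient u x, b k⟫ * ⟪gradient u x, a⟫) / L ε u x) =
        (∑ k, bil (A ε u x) (b k) a * ⟪a, b k⟫ -
          (∑ k, bil (A ε u x) (b k) a * ⟪gradient u x, b k⟫) * ⟪gradient u x, a⟫) / L ε u x := by
      rw [Finset.sum_mul, ← Finset.sum_sub_distrib, Finset.sum_div]
      exact Finset.sum_congr rfl fun k _ => by ring
    rw [this, ← h1, ← h2, bil_A]
  rw [h3]
  refine Finset.sum_congr rfl fun k _ => ?_
  rw [pow_two, bil_A ε u x (b k) a, real_inner_comm]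

theorem Frame.bil_w_le {b : Fin n → E n} {lam : Fin n → ℝ} (F : Frame ε u x b lam) {c : ℝ}
    (hc : ∀ i, lam i ≤ c) (a : E n) : bil (w ε u x) a a ≤ c * bil (A ε u x) a a := by
  have h1 : fderiv ℝ (fderiv ℝ u) x a a = ∑ k, (1 - lam k) * bil (A ε u x) (b k) a ^ 2 := by
    have : fderiv ℝ (fderiv ℝ u) x a a =
        fderiv ℝ (fderiv ℝ u) x (∑ k, bil (A ε u x) (b k) a • b k) a := by rw [F.expand]
    rw [this, map_sum, sum_apply]
    refine Finset.sum_congr rfl fun k _ => ?_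
    rw [map_smul, smul_apply, F.fderiv_fderiv_left, smul_eq_mul]
    ring
  rw [bil_w, h1, F.bil_A_self, ← Finset.sum_sub_distrib, Finset.mul_sum]
  refine Finset.sum_le_sum fun k _ => ?_
  nlinarith [mul_le_mul_of_nonneg_right (hc k) (sq_nonneg (bil (A ε u x) (b k) a))]

end Eigenvalues

/-! ### `C^{1,1}` bounds for `log f` and `log g` -/

section C11

variable {n : ℕ} {h : E n → ℝ}

theorem norm_fderiv_sub_le (a c : E n) :
    ‖fderiv ℝ h a - fderiv ℝ h c‖ ≤ ‖iteratedFDeriv ℝ 1 h a - iteratedFDeriv ℝ 1 h c‖ := by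
  refine ContinuousLinearMap.opNorm_le_bound _ (norm_nonneg _) fun v => ?_
  have := (iteratedFDeriv ℝ 1 h a - iteratedFDeriv ℝ 1 h c).le_opNorm fun _ => v
  simpa [iteratedFDeriv_one_apply] using this

/-- The logarithm of a `C^{1,1}` function with a positive lower bound. -/
theorem C11At.log_of_ball {y : E n} {ρ m B K : ℝ} (hρ : 0 < ρ) (hm : 0 < m) (hB : 0 ≤ B)
    (hd : ∀ a ∈ Metric.ball y ρ, DifferentiableAt ℝ h a)
    (hlow : ∀ a ∈ Metric.ball y ρ, m ≤ h a)
    (hbd : ∀ a ∈ Metric.ball y ρ, ‖fderiv ℝ h a‖ ≤ B)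
    (hK : ∀ a ∈ Metric.ball y ρ, ∀ c ∈ Metric.ball y ρ,
      ‖fderiv ℝ h a - fderiv ℝ h c‖ ≤ K * ‖a - c‖) :
    C11At (fun a => Real.log (h a)) y (m⁻¹ * B) (m⁻¹ * K + m⁻¹ ^ 2 * B ^ 2) := by
  have hpos : ∀ a ∈ Metric.ball y ρ, 0 < h a := fun a ha => hm.trans_le (hlow a ha)
  have hinv : ∀ a ∈ Metric.ball y ρ, (h a)⁻¹ ≤ m⁻¹ := fun a ha => inv_anti₀ hm (hlow a ha)
  have hfd : ∀ a ∈ Metric.ball y ρ,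
      fderiv ℝ (fun a => Real.log (h a)) a = (h a)⁻¹ • fderiv ℝ h a := fun a ha =>
    ((hd a ha).hasFDerivAt.log (hpos a ha).ne').fderiv
  have hm' : 0 < m⁻¹ := by positivity
  refine ⟨⟨ρ, hρ, fun a ha => (hd a ha).log (hpos a ha).ne', fun a ha c hc => ?_⟩, ?_⟩
  · rw [hfd a ha, hfd c hc]
    have h1 : |h c - h a| ≤ B * ‖a - c‖ := by
      have := (convex_ball y ρ).norm_image_sub_le_of_norm_fderiv_le (𝕜 := ℝ) hd hbd ha hc
      rwa [norm_sub_rev c a] at this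
    have h2 : |(h a)⁻¹ - (h c)⁻¹| ≤ m⁻¹ ^ 2 * (B * ‖a - c‖) := by
      have e : (h a)⁻¹ - (h c)⁻¹ = ((h a)⁻¹ * (h c)⁻¹) * (h c - h a) := by
        have := (hpos a ha).ne'
        have := (hpos c hc).ne'
        field_simp
      have p1 := inv_pos.2 (hpos a ha)
      have p2 := inv_pos.2 (hpos c hc)
      rw [e, abs_mul, abs_of_pos (mul_pos p1 p2), pow_two]
      exact mul_le_mul (mul_le_mul (hinv a ha) (hinv c hc) p2.le hm'.le) h1 (abs_nonneg _)
        (by positivity)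
    have e : (h a)⁻¹ • fderiv ℝ h a - (h c)⁻¹ • fderiv ℝ h c =
        (h a)⁻¹ • (fderiv ℝ h a - fderiv ℝ h c) + ((h a)⁻¹ - (h c)⁻¹) • fderiv ℝ h c := by
      module
    have p1 := inv_pos.2 (hpos a ha)
    rw [e]
    refine (norm_add_le _ _).trans ?_
    rw [norm_smul, norm_smul, Real.norm_eq_abs, Real.norm_eq_abs, abs_of_pos p1]
    calc _ ≤ m⁻¹ * (K * ‖a - c‖) + m⁻¹ ^ 2 * (B * ‖a - c‖) * B :=
          add_le_add (mul_le_mul (hinv a ha) (hK a ha c hc) (norm_nonneg _) hm'.le)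
            (mul_le_mul h2 (hbd c hc) (norm_nonneg _) (by positivity))
      _ = _ := by ring
  · have hy := Metric.mem_ball_self hρ (x := y)
    have p1 := inv_pos.2 (hpos y hy)
    rw [hfd y hy, norm_smul, Real.norm_eq_abs, abs_of_pos p1]
    exact mul_le_mul (hinv y hy) (hbd y hy) (norm_nonneg _) hm'.le

/-- Used for `g`: nothing keeps `T(x)` away from the boundary of `Ωs`, so the constants must be
uniform up to that boundary. For `f` the cutoff allows local constants. -/
theorem IsCk1.exists_c11At_log {Ω : Set (E n)} {m : ℝ} (hh : IsCk1 1 Ω h) (hΩ : IsOpen Ω)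
    (hm : 0 < m) (hlow : ∀ a ∈ Ω, m ≤ h a) :
    ∃ B K : ℝ, 0 ≤ B ∧ 0 ≤ K ∧ ∀ y ∈ Ω, C11At (fun a => Real.log (h a)) y B K := by
  obtain ⟨hc, K, hb, hl⟩ := hh
  refine ⟨m⁻¹ * K, m⁻¹ * K + m⁻¹ ^ 2 * (K : ℝ) ^ 2, by positivity, by positivity, fun y hy => ?_⟩
  obtain ⟨ρ, hρ, hsub⟩ := Metric.isOpen_iff.1 hΩ y hy
  refine C11At.log_of_ball hρ hm K.2 (fun a ha => ?_) (fun a ha => hlow a (hsub ha))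
    (fun a ha => (norm_iteratedFDeriv_one h).symm.le.trans (hb 1 le_rfl a (hsub ha)))
    (fun a ha c hc => (norm_fderiv_sub_le a c).trans ?_)
  · exact (hc.contDiffAt (hΩ.mem_nhds (hsub ha))).differentiableAt (by simp)
  · exact hl.norm_sub_le (hsub ha) (hsub hc)

theorem IsLocallyCk1.exists_c11At_log {Ω S : Set (E n)} {m δ : ℝ} (hh : IsLocallyCk1 1 Ω h)
    (hΩ : IsOpen Ω) (hm : 0 < m) (hlow : ∀ a ∈ Ω, m ≤ h a) (hδ : 0 < δ)
    (hS : Bornology.IsBounded S) (hSΩ : Metric.cthickening δ S ⊆ Ω) :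
    ∃ B K : ℝ, 0 ≤ B ∧ 0 ≤ K ∧ ∀ y ∈ S, C11At (fun a => Real.log (h a)) y B K := by
  obtain ⟨hc, hl⟩ := hh
  have hcomp : IsCompact (Metric.cthickening δ S) :=
    Metric.isCompact_of_isClosed_isBounded Metric.isClosed_cthickening hS.cthickening
  obtain ⟨K, hK⟩ := (hl.mono hSΩ).exists_lipschitzOnWith_of_compact hcomp
  have hcd : ContinuousOn (fderiv ℝ h) Ω := hc.continuousOn_fderiv_of_isOpen hΩ (by simp)
  obtain ⟨B, hB⟩ := hcomp.exists_bound_of_continuousOn (hcd.mono hSΩ)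
  refine ⟨m⁻¹ * max B 0, m⁻¹ * K + m⁻¹ ^ 2 * (max B 0) ^ 2, by positivity, by positivity,
    fun y hy => ?_⟩
  have hsub : Metric.ball y δ ⊆ Metric.cthickening δ S := fun a ha =>
    Metric.mem_cthickening_of_dist_le a y δ S hy (Metric.mem_ball.1 ha).le
  refine C11At.log_of_ball hδ hm (le_max_right _ _) (fun a ha => ?_)
    (fun a ha => hlow a (hSΩ (hsub ha))) (fun a ha => (hB a (hsub ha)).trans (le_max_left _ _))
    (fun a ha c hc => (norm_fderiv_sub_le a c).trans ?_)
  · exact (hc.contDiffAt (hΩ.mem_nhds (hSΩ (hsub ha)))).differentiableAt (by simp)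
  · exact hK.norm_sub_le (hsub ha) (hsub hc)

end C11

end MongeApprox

/-! ### The interior eigenvalue estimate -/

namespace MongeApprox

theorem bil_smul {n : ℕ} (M : Matrix (Fin n) (Fin n) ℝ) (t : ℝ) (a : E n) :
    bil M (t • a) (t • a) = t ^ 2 * bil M a a := by
  simp only [bil, Finset.mul_sum, PiLp.smul_apply, smul_eq_mul]
  refine Finset.sum_congr rfl fun i _ => Finset.sum_congr rfl fun j _ => ?_
  ring

theorem continuousAt_bil {n : ℕ} {X : Type*} [TopologicalSpace X]
    {M : X → Matrix (Fin n) (Fin n) ℝ} {a : X → E n} {p : X}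
    (hM : ∀ i j, ContinuousAt (fun q => M q i j) p) (ha : ContinuousAt a p) :
    ContinuousAt (fun q => bil (M q) (a q) (a q)) p := by
  have hi : ∀ i, ContinuousAt (fun q => a q i) p := fun i =>
    (EuclideanSpace.proj (𝕜 := ℝ) i).continuous.continuousAt.comp ha
  exact tendsto_finsetSum _ fun i _ => tendsto_finsetSum _ fun j _ =>
    (hM i j).mul ((hi i).mul (hi j))

/-- The quotient of the quadratic forms of `w` and `A`, weighted with a cutoff function, attains
its maximum over a ball. -/
theorem exists_max_quotient {n : ℕ} (hn : 0 < n) {ε : ℝ} {u : E n → ℝ} {c : E n} {r : ℝ}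
    (hr : 0 < r) (ha : ∀ x ∈ Metric.closedBall c r, Admissible ε u x) :
    ∃ x₀ ∈ Metric.closedBall c r, ∃ M : ℝ, ∃ ξ : E n, ξ ≠ 0 ∧
      (r ^ 2 - ‖x₀ - c‖ ^ 2) ^ 2 * bil (w ε u x₀) ξ ξ = M * bil (A ε u x₀) ξ ξ ∧
      ∀ x ∈ Metric.closedBall c r, ∀ a : E n,
        (r ^ 2 - ‖x - c‖ ^ 2) ^ 2 * bil (w ε u x) a a ≤ M * bil (A ε u x) a a := by
  have : Nonempty (Fin n) := ⟨⟨0, hn⟩⟩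
  have : Nontrivial (E n) := inferInstance
  -- Maximizing a Rayleigh quotient over points and unit vectors avoids differentiating the largest
  -- eigenvalue, which need not be smooth where it is multiple.
  let Φ : E n × E n → ℝ := fun p =>
    (r ^ 2 - ‖p.1 - c‖ ^ 2) ^ 2 * bil (w ε u p.1) p.2 p.2 / bil (A ε u p.1) p.2 p.2
  have hne : ∀ p ∈ Metric.closedBall c r ×ˢ Metric.sphere (0 : E n) 1, p.2 ≠ 0 := fun p hp =>
    ne_zero_of_mem_unit_sphere (⟨p.2, hp.2⟩ : Metric.sphere (0 : E n) 1)
  have hΦ : ContinuousOn Φ (Metric.closedBall c r ×ˢ Metric.sphere (0 : E n) 1) := by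
    intro p hp
    have h := ha p.1 hp.1
    refine ContinuousAt.continuousWithinAt ?_
    refine ContinuousAt.div (ContinuousAt.mul ?_ ?_) ?_ (h.bil_A_pos (hne p hp)).ne'
    · fun_prop
    · exact continuousAt_bil (fun i j => ContinuousAt.comp (f := Prod.fst)
        (h.contDiffAt_w i j).continuousAt continuousAt_fst) continuousAt_snd
    · exact continuousAt_bil (fun i j => ContinuousAt.comp (f := Prod.fst)
        (h.contDiffAt_A i j).continuousAt continuousAt_fst) continuousAt_snd
  obtain ⟨ξ₁, hξ₁⟩ := NormedSpace.sphere_nonempty (x := (0 : E n)) (r := 1).2 zero_le_one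
  obtain ⟨p, hp, hmax⟩ := ((isCompact_closedBall c r).prod (isCompact_sphere (0 : E n) 1)).exists_isMaxOn
    ⟨(c, ξ₁), Metric.mem_closedBall_self hr.le, hξ₁⟩ hΦ
  refine ⟨p.1, hp.1, Φ p, p.2, hne p hp, ?_, fun x hx a => ?_⟩
  · exact (div_mul_cancel₀ _ ((ha p.1 hp.1).bil_A_pos (hne p hp)).ne').symm
  · by_cases h0 : a = 0
    · simp [h0, bil]
    have hna : 0 < ‖a‖ := norm_pos_iff.2 h0
    have hs : ‖a‖⁻¹ • a ∈ Metric.sphere (0 : E n) 1 := by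
      simp [norm_smul, hna.ne']
    have h1 : Φ (x, ‖a‖⁻¹ • a) ≤ Φ p := hmax (Set.mk_mem_prod hx hs)
    have h2 : Φ (x, ‖a‖⁻¹ • a) =
        (r ^ 2 - ‖x - c‖ ^ 2) ^ 2 * bil (w ε u x) a a / bil (A ε u x) a a := by
      simp only [Φ, bil_smul]
      field_simp
    rw [h2, div_le_iff₀ ((ha x hx).bil_A_pos h0)] at h1
    exact h1

/-- The bound for the greatest eigenvalue which follows from the differential inequality at a
maximum and a bound for the product of the eigenvalues. -/
theorem eigenvalue_le {n : ℕ} {lam : Fin n → ℝ} {m : Fin n} {C τ ρ : ℝ} (hpos : ∀ i, 0 < lam i)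
    (hC : 0 ≤ C) (hprod : ∏ i, lam i ≤ ρ)
    (h : 1 ≤ lam m → (1 - lam m) ^ 2 * ∑ i, (lam i)⁻¹ ≤
      C * (lam m ^ 2 + lam m * τ ^ 2 * (∑ i, (lam i)⁻¹ + 1))) :
    lam m ≤ 2 + 16 * C * τ ^ 2 + ρ * (8 * C + 1) ^ (n - 1) := by
  have hρ : 0 ≤ ρ := (Finset.prod_nonneg fun i _ => (hpos i).le).trans hprod
  have t1 : 0 ≤ 16 * C * τ ^ 2 := by positivity
  have t2 : 0 ≤ ρ * (8 * C + 1) ^ (n - 1) := by positivity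
  have hm := hpos m
  rcases le_or_gt (lam m) 2 with h2 | h2
  · linarith
  have h3 := h (by linarith)
  set S := ∑ i, (lam i)⁻¹ with hS
  have hle : ∀ i, (lam i)⁻¹ ≤ S := fun i =>
    Finset.single_le_sum (f := fun i => (lam i)⁻¹) (fun j _ => (inv_pos.2 (hpos j)).le)
      (Finset.mem_univ i)
  have hS0 : 0 < S := (inv_pos.2 hm).trans_le (hle m)
  -- If `S` is large, the left side, at least `λ_m² S/4` as `λ_m > 2`, absorbs `C λ_m² ≤ λ_m² S/8`,
  -- and `λ_m ≤ 16Cτ²` remains. If `S` is small, all `λ_i` are bounded below, and the product bounds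
  -- `λ_m`.
  rcases le_or_gt (8 * C + 1) S with h4 | h4
  · have h5 : lam m ^ 2 / 4 ≤ (1 - lam m) ^ 2 := by nlinarith
    have h6 : lam m ^ 2 / 4 * S ≤ (1 - lam m) ^ 2 * S := by gcongr
    have h7 : C * lam m ^ 2 ≤ S / 8 * lam m ^ 2 := by gcongr; linarith
    have h8 : C * (lam m * τ ^ 2 * (S + 1)) ≤ C * (lam m * τ ^ 2 * (2 * S)) := by
      gcongr; linarith
    have h9 : lam m * (lam m * S) ≤ 16 * C * τ ^ 2 * (lam m * S) := by
      nlinarith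
    have := le_of_mul_le_mul_right h9 (by positivity)
    linarith
  · have h5 : ∀ i, 1 ≤ lam i * (8 * C + 1) := fun i => by
      have := (hle i).trans h4.le
      rwa [inv_le_iff_one_le_mul₀' (hpos i)] at this
    have h6 : lam m ≤ ρ * (8 * C + 1) ^ (n - 1) := by
      have hcard : (Finset.univ.erase m).card = n - 1 := by
        rw [Finset.card_erase_of_mem (Finset.mem_univ m), Finset.card_univ, Fintype.card_fin]
      calc lam m = lam m * ∏ i ∈ Finset.univ.erase m, (1 : ℝ) := by simp
        _ ≤ lam m * ∏ i ∈ Finset.univ.erase m, (lam i * (8 * C + 1)) := by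
          gcongr with i _
          exact h5 i
        _ = (∏ i, lam i) * (8 * C + 1) ^ (n - 1) := by
          rw [Finset.prod_mul_distrib, Finset.prod_const, hcard, ← mul_assoc,
            Finset.mul_prod_erase _ _ (Finset.mem_univ m)]
        _ ≤ _ := by gcongr
    linarith

/-- A lower bound for each factor of a product of positive numbers which are bounded above. -/
theorem div_pow_le_of_prod {n : ℕ} {lam : Fin n → ℝ} {B k : ℝ} (hpos : ∀ i, 0 < lam i)
    (hB : 0 < B) (hle : ∀ i, lam i ≤ B) (hk : k ≤ ∏ i, lam i) (j : Fin n) :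
    k / B ^ (n - 1) ≤ lam j := by
  have hcard : (Finset.univ.erase j).card = n - 1 := by
    rw [Finset.card_erase_of_mem (Finset.mem_univ j), Finset.card_univ, Fintype.card_fin]
  rw [div_le_iff₀ (by positivity)]
  refine hk.trans ?_
  rw [← Finset.mul_prod_erase _ _ (Finset.mem_univ j), ← hcard, ← Finset.prod_const]
  have := hpos j
  gcongr with i _
  · exact fun i _ => (hpos i).le
  · exact hle i

theorem closedBall_subset_of_infDist_frontier {n : ℕ} {Ω : Set (E n)} {x : E n}
    {r : ℝ} (hx : x ∈ Ω) (hr : r < Metric.infDist x (frontier Ω)) : Metric.closedBall x r ⊆ Ω := by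
  intro y hy
  by_contra hyΩ
  -- The distance from `x` to the complement is attained at a frontier point, so a point of the ball
  -- outside `Ω` would be too close.
  have hne : Ω ≠ Set.univ := fun h => hyΩ (h ▸ Set.mem_univ y)
  obtain ⟨z, hzf, hz⟩ := exists_mem_frontier_infDist_compl_eq_dist hx hne
  have h1 := Metric.infDist_le_dist_of_mem (x := x) hzf
  have h2 := Metric.infDist_le_dist_of_mem (x := x) (s := Ωᶜ) hyΩ
  have h3 := Metric.mem_closedBall'.1 hy
  linarith

namespace IsCConcaveSolution

variable {n : ℕ} {ε : ℝ} {Ω Ωs : Set (E n)} {f g u : E n → ℝ}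

/-- The interior estimate for the eigenvalues of `A⁻¹w` at the center of a ball. -/
theorem eigenvalue_le_of_closedBall (h : IsCConcaveSolution ε Ω Ωs f g u) (hε : 0 < ε)
    (hΩ : IsOpen Ω) (hΩs : Bornology.IsBounded Ωs) (hf : ∀ a ∈ Ω, 0 < f a)
    (hg : ∀ y ∈ Ωs, 0 < g y) {c : E n} {r Λ Bf Bg Kf Kg K ρ : ℝ} (hr : 0 < r)
    (hball : Metric.closedBall c r ⊆ Ω)
    (hF : ∀ a ∈ Metric.closedBall c r, C11At (fun a => Real.log (f a)) a Bf Kf)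
    (hG : ∀ y ∈ Ωs, C11At (fun a => Real.log (g a)) y Bg Kg) (hΛ : 0 ≤ Λ)
    (hL : ∀ a ∈ Ω, L ε u a ≤ Λ) (hBf : 0 ≤ Bf) (hBg : 0 ≤ Bg) (hKf : 0 ≤ Kf) (hKg : 0 ≤ Kg)
    (hK1 : Λ * (Bf + Bg) ≤ K) (hK2 : 2 * Kf * Λ ^ 2 + 6 * Bg * Λ + 2 * Kg * Λ ^ 2 ≤ K)
    (hρ : ∀ a ∈ Ω, f a / g (T ε u a) ≤ ρ) {b : Fin n → E n} {lam : Fin n → ℝ}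
    (hb : Frame ε u c b lam) (j : Fin n) :
    lam j ≤ 2 + 16 * algConst n K * ((r ^ 2 + 6 * r * Λ) / r ^ 2) ^ 2 +
      ρ * (8 * algConst n K + 1) ^ (n - 1) := by
  have hcball := Metric.mem_closedBall_self (x := c) hr.le
  have ha : ∀ x ∈ Ω, Admissible ε u x := fun x hx => h.admissible hε hΩ hΩs hx
  have hw : ∀ x ∈ Ω, (w ε u x).PosDef := fun x hx => h.posDef_w hε hΩ hΩs hf hg hx
  obtain ⟨x₀, hx₀, M, ξ, hξ, heq, hM⟩ := exists_max_quotient j.pos hr fun x hx => ha x (hball hx)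
  have hx₀Ω := hball hx₀
  have hj : r ^ 4 * lam j ≤ M := by
    have := hM c hcball (b j)
    rw [hb.bilA, hb.bilw] at this
    simp only [sub_self, norm_zero, if_true] at this
    linarith
  have hMpos : 0 < M := lt_of_lt_of_le (by have := hb.pos j; positivity) hj
  have hζ0 : 0 ≤ r ^ 2 - ‖x₀ - c‖ ^ 2 := by
    have := Metric.mem_closedBall.1 hx₀
    rw [dist_eq_norm] at this
    have : ‖x₀ - c‖ ^ 2 ≤ r ^ 2 := by gcongr
    linarith
  have hζ : 0 < r ^ 2 - ‖x₀ - c‖ ^ 2 := by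
    refine hζ0.lt_of_ne fun h0 => ?_
    have hAξ := (ha x₀ hx₀Ω).bil_A_pos hξ
    have := mul_pos hMpos hAξ
    rw [← heq, ← h0] at this
    simp at this
  obtain ⟨b₀, lam₀, hb₀, -⟩ := exists_frame_of_posDef (ha x₀ hx₀Ω).posDef_A (hw x₀ hx₀Ω)
  have : Nonempty (Fin n) := ⟨j⟩
  obtain ⟨m, hm⟩ := Finite.exists_max lam₀
  set ζ := r ^ 2 - ‖x₀ - c‖ ^ 2 with hζdef
  -- The maximal Rayleigh quotient is the largest eigenvalue, so `b₀ m` may replace the abstract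
  -- maximizer `ξ`.
  have hMeq : M = ζ ^ 2 * lam₀ m := by
    apply le_antisymm
    · have h1 := hb₀.bil_w_le hm ξ
      have hAξ := (ha x₀ hx₀Ω).bil_A_pos hξ
      refine le_of_mul_le_mul_right ?_ hAξ
      rw [← heq, mul_assoc]
      gcongr
    · have := hM x₀ hx₀ (b₀ m)
      rw [hb₀.bilA, hb₀.bilw] at this
      simpa using this
  have hnhds : ∀ᶠ y in 𝓝 x₀, y ∈ Ω := hΩ.mem_nhds hx₀Ω
  have hballn : ∀ᶠ y in 𝓝 x₀, 0 < r ^ 2 - ‖y - c‖ ^ 2 := by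
    have : ContinuousAt (fun y : E n => r ^ 2 - ‖y - c‖ ^ 2) x₀ := by fun_prop
    exact this.eventually (lt_mem_nhds hζ)
  set C := algConst n K with hC
  have hK0 : 0 ≤ K := le_trans (by positivity) hK1
  have hC0 : 0 ≤ C := by rw [hC, algConst]; positivity
  set τ := (r ^ 2 + 6 * r * Λ) / ζ with hτ
  have hest := eigenvalue_le (τ := τ) (C := C) (ρ := ρ) hb₀.pos hC0
    ((h.prod_eq hx₀Ω (ha x₀ hx₀Ω) hb₀).trans_le (hρ x₀ hx₀Ω)) fun hm1 => by
    refine hb₀.estimate_at_max (ha x₀ hx₀Ω) (hnhds.mono fun y hy => hw y hy)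
      (hnhds.mono fun y hy => h.log_det_eq hy (ha y hy) (hf y hy) (hg _ (h.mapsTo hy)))
      (hF x₀ hx₀) (hG _ (h.mapsTo hx₀Ω)) hm hm1 hr hζ (M := M) ?_ ?_ (hL x₀ hx₀Ω) hBf hBg hKf hKg
      hK1 hK2 hτ
    · rw [← hζdef, hMeq]; field_simp
    · filter_upwards [hballn] with y hy
      have hyb : y ∈ Metric.closedBall c r := by
        rw [Metric.mem_closedBall, dist_eq_norm]
        exact abs_le_of_sq_le_sq' (by linarith) hr.le |>.2
      have h1 := hM y hyb (b₀ m)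
      rw [bil_w] at h1
      have h2 : bil (A ε u y) (b₀ m) (b₀ m) - fderiv ℝ (fderiv ℝ u) y (b₀ m) (b₀ m) ≤
          M * bil (A ε u y) (b₀ m) (b₀ m) / (r ^ 2 - ‖y - c‖ ^ 2) ^ 2 := by
        rw [le_div_iff₀ (by positivity)]
        linarith
      have e : bil (A ε u y) (b₀ m) (b₀ m) * (1 - M / (r ^ 2 - ‖y - c‖ ^ 2) ^ 2) =
          bil (A ε u y) (b₀ m) (b₀ m) -
            M * bil (A ε u y) (b₀ m) (b₀ m) / (r ^ 2 - ‖y - c‖ ^ 2) ^ 2 := by ring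
      linarith
  have hζr : ζ ≤ r ^ 2 := by rw [hζdef]; linarith [sq_nonneg ‖x₀ - c‖]
  have hζr2 : ζ ^ 2 ≤ r ^ 4 := by
    calc ζ ^ 2 ≤ (r ^ 2) ^ 2 := by gcongr
      _ = r ^ 4 := by ring
  have hρ0 : 0 ≤ ρ := (div_pos (hf c (hball hcball)) (hg _ (h.mapsTo (hball hcball)))).le.trans
    (hρ c (hball hcball))
  -- The cutoff is squared so that `ζ²` exactly compensates `τ²`, which blows up like `ζ⁻²`.
  have hτζ : ζ ^ 2 * τ ^ 2 = r ^ 4 * ((r ^ 2 + 6 * r * Λ) / r ^ 2) ^ 2 := by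
    rw [hτ]; field_simp
  refine le_of_mul_le_mul_left ?_ (by positivity : 0 < r ^ 4)
  calc r ^ 4 * lam j ≤ ζ ^ 2 * lam₀ m := hj.trans_eq hMeq
    _ ≤ ζ ^ 2 * (2 + 16 * C * τ ^ 2 + ρ * (8 * C + 1) ^ (n - 1)) := by gcongr
    _ = ζ ^ 2 * 2 + 16 * C * (ζ ^ 2 * τ ^ 2) + ζ ^ 2 * (ρ * (8 * C + 1) ^ (n - 1)) := by ring
    _ ≤ r ^ 4 * 2 + 16 * C * (ζ ^ 2 * τ ^ 2) + r ^ 4 * (ρ * (8 * C + 1) ^ (n - 1)) := by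
      gcongr
    _ = _ := by rw [hτζ]; ring

end IsCConcaveSolution

end MongeApprox

/-! ### Uniform constants and conclusion -/

namespace MongeApprox

theorem exists_L_le {n : ℕ} {Ω Ωs : Set (E n)} {f g : E n → ℝ} (hΩ : IsOpen Ω)
    (hΩb : Bornology.IsBounded Ω) (hΩs : Bornology.IsBounded Ωs) :
    ∃ Λ : ℝ, 0 ≤ Λ ∧ ∀ ε : ℝ, 0 < ε → ε ≤ 1 → ∀ u : E n → ℝ, IsCConcaveSolution ε Ω Ωs f g u →
      ∀ x ∈ Ω, L ε u x ≤ Λ := by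
  obtain ⟨R, hR⟩ := Metric.isBounded_iff.1 (hΩb.union hΩs)
  refine ⟨Real.sqrt (1 + R ^ 2), Real.sqrt_nonneg _, fun ε hε hε1 u hu x hx =>
    hu.L_le hε hε1 hΩ hΩs hx fun a ha y hy => ?_⟩
  rw [← dist_eq_norm]
  exact hR (Or.inl ha) (Or.inr hy)

/-- All balls of radius `d/4` about points at distance at least `d` from the frontier lie in one set
whose `d/4`-thickening is compact in `Ω`. The constants thus depend on `d` and not on the subdomain.
-/
theorem IsLocallyCk1.exists_c11At_log_of_infDist_frontier {n : ℕ} {h : E n → ℝ} {Ω : Set (E n)}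
    {m d : ℝ} (hh : IsLocallyCk1 1 Ω h) (hΩ : IsOpen Ω) (hΩb : Bornology.IsBounded Ω) (hm : 0 < m)
    (hlow : ∀ a ∈ Ω, m ≤ h a) (hd : 0 < d) :
    ∃ B K : ℝ, 0 ≤ B ∧ 0 ≤ K ∧ ∀ x ∈ Ω, d ≤ Metric.infDist x (frontier Ω) →
      ∀ a ∈ Metric.closedBall x (d / 4), C11At (fun a => Real.log (h a)) a B K := by
  set S : Set (E n) := {a | ∃ x ∈ Ω, d ≤ Metric.infDist x (frontier Ω) ∧ dist a x ≤ d / 4} with hS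
  have hthick : Metric.cthickening (d / 4) S ⊆ Ω := by
    intro z hz
    have hz' := Metric.cthickening_subset_thickening' (by positivity : 0 < d / 2)
      (by linarith : d / 4 < d / 2) S hz
    obtain ⟨a, ⟨x, hx, hxd, hax⟩, hza⟩ := Metric.mem_thickening_iff.1 hz'
    refine closedBall_subset_of_infDist_frontier hx (r := 3 * d / 4) (by linarith) ?_
    rw [Metric.mem_closedBall]
    linarith [dist_triangle z a x]
  obtain ⟨B, K, hB, hK, hC⟩ := hh.exists_c11At_log hΩ hm hlow (by positivity : 0 < d / 4)
    (hΩb.subset ((Metric.self_subset_cthickening S).trans hthick)) hthick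
  exact ⟨B, K, hB, hK, fun x hx hxd a ha => hC a ⟨x, hx, hxd, Metric.mem_closedBall.1 ha⟩⟩

end MongeApprox

theorem corollary1 (n : ℕ) (hn : 2 ≤ n) (Ω Ωs : Set (MongeApprox.E n))
    (hΩ : MongeApprox.IsBoundedDomain Ω) (hΩs : MongeApprox.IsBoundedDomain Ωs)
    (f g : MongeApprox.E n → ℝ)
    (hf : MongeApprox.IsLocallyCk1 1 Ω f) (hg : MongeApprox.IsCk1 1 Ωs g)
    (hf_bounds : MongeApprox.HasPositiveBounds Ω f)
    (hg_bounds : MongeApprox.HasPositiveBounds Ωs g)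
    (hmass : ∫ x in Ω, f x = ∫ y in Ωs, g y) :
    (∀ ε : ℝ, 0 < ε → ε ≤ 1 → ∀ u : MongeApprox.E n → ℝ,
      MongeApprox.IsCConcaveSolution ε Ω Ωs f g u → ∀ x ∈ Ω,
        DifferentiableAt ℝ (MongeApprox.T ε u) x ∧
        (MongeApprox.A ε u x).PosDef ∧ (MongeApprox.w ε u x).PosDef ∧
        MongeApprox.jacobian ε u x = (MongeApprox.A ε u x)⁻¹ * MongeApprox.w ε u x ∧
        ∃ (b : Module.Basis (Fin n) ℝ (Fin n → ℝ)) (lam : Fin n → ℝ),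
          (∀ i, (MongeApprox.jacobian ε u x).mulVec (b i) = lam i • b i) ∧
          (∀ i, 0 < lam i) ∧ ∑ i, lam i = MongeApprox.W ε u x) ∧
    (∀ d : ℝ, 0 < d → ∃ C : ℝ, 0 < C ∧
      ∀ ε : ℝ, 0 < ε → ε ≤ 1 → ∀ u : MongeApprox.E n → ℝ,
        MongeApprox.IsCConcaveSolution ε Ω Ωs f g u →
        ∀ Ω' : Set (MongeApprox.E n), MongeApprox.CompactlyContained Ω' Ω →
          (∀ x ∈ Ω', d ≤ Metric.infDist x (frontier Ω)) →
          ∀ x ∈ Ω', ∀ μ : ℝ,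
            Module.End.HasEigenvalue (Matrix.toLin' (MongeApprox.jacobian ε u x)) μ →
              C⁻¹ ≤ μ ∧ μ ≤ C) := by
  obtain ⟨hΩo, hΩc, hΩb⟩ := hΩ
  obtain ⟨hΩso, hΩsc, hΩsb⟩ := hΩs
  obtain ⟨mf, Mf, hmf, hfb⟩ := hf_bounds
  obtain ⟨mg, Mg, hmg, hgb⟩ := hg_bounds
  have hfpos : ∀ a ∈ Ω, 0 < f a := fun a ha => hmf.trans_le (hfb a ha).1
  have hgpos : ∀ y ∈ Ωs, 0 < g y := fun y hy => hmg.trans_le (hgb y hy).1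
  refine ⟨fun ε hε hε1 u hu x hx => ?_, fun d hd => ?_⟩
  · have ha := hu.admissible hε hΩo hΩsb hx
    have hw := hu.posDef_w hε hΩo hΩsb hfpos hgpos hx
    refine ⟨ha.contDiffAt_T.differentiableAt (by simp), ha.posDef_A, hw, ha.jacobian_eq, ?_⟩
    rw [ha.jacobian_eq]
    exact MongeApprox.exists_eigenbasis ha.posDef_A hw
  · obtain ⟨Λ, hΛ, hL⟩ := MongeApprox.exists_L_le hΩo hΩb hΩsb (f := f) (g := g)
    obtain ⟨Bf, Kf, hBf, hKf, hF⟩ := hf.exists_c11At_log_of_infDist_frontier hΩo hΩb hmf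
      (fun a ha => (hfb a ha).1) hd
    obtain ⟨Bg, Kg, hBg, hKg, hG⟩ := hg.exists_c11At_log hΩso hmg fun a ha => (hgb a ha).1
    obtain ⟨y₀, hy₀⟩ := hΩsc.nonempty
    obtain ⟨x₀, hx₀⟩ := hΩc.nonempty
    have hMg : 0 < Mg := (hgpos y₀ hy₀).trans_le (hgb y₀ hy₀).2
    have hMf : 0 < Mf := (hfpos x₀ hx₀).trans_le (hfb x₀ hx₀).2
    set K := Λ * (Bf + Bg) + (2 * Kf * Λ ^ 2 + 6 * Bg * Λ + 2 * Kg * Λ ^ 2) with hK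
    have hK0 : 0 ≤ K := by positivity
    have hK1 : Λ * (Bf + Bg) ≤ K := le_add_of_nonneg_right (by positivity)
    have hK2 : 2 * Kf * Λ ^ 2 + 6 * Bg * Λ + 2 * Kg * Λ ^ 2 ≤ K :=
      le_add_of_nonneg_left (by positivity)
    set r := d / 4 with hr
    have hC0 : 0 ≤ MongeApprox.algConst n K := by rw [MongeApprox.algConst]; positivity
    set U := 2 + 16 * MongeApprox.algConst n K * ((r ^ 2 + 6 * r * Λ) / r ^ 2) ^ 2 +
      Mf / mg * (8 * MongeApprox.algConst n K + 1) ^ (n - 1) with hU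
    have hUpos : 0 < U := by positivity
    -- The product of the eigenvalues is at least `mf / Mg` and the other `n - 1` factors are at
    -- most `U`.
    set ℓ := mf / Mg / U ^ (n - 1) with hℓ
    have hℓpos : 0 < ℓ := by positivity
    refine ⟨U + ℓ⁻¹, by positivity, fun ε hε hε1 u hu Ω' hΩ' hdist x hx μ hμ => ?_⟩
    have hxΩ : x ∈ Ω := hΩ'.2 (subset_closure hx)
    have ha := hu.admissible hε hΩo hΩsb hxΩ
    have hw := hu.posDef_w hε hΩo hΩsb hfpos hgpos hxΩ
    obtain ⟨b, lam, hb, heig⟩ := MongeApprox.exists_frame_of_posDef ha.posDef_A hw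
    rw [ha.jacobian_eq] at hμ
    obtain ⟨j, rfl⟩ := heig μ hμ
    have hle : ∀ i, lam i ≤ U := fun i =>
      hu.eigenvalue_le_of_closedBall hε hΩo hΩsb hfpos hgpos (by positivity)
        (MongeApprox.closedBall_subset_of_infDist_frontier hxΩ
          (by rw [hr]; linarith [hdist x hx]))
        (fun a ha => hF x hxΩ (hdist x hx) a ha) hG hΛ (fun a ha => hL ε hε hε1 u hu a ha)
        hBf hBg hKf hKg hK1 hK2
        (fun a ha => div_le_div₀ hMf.le (hfb a ha).2 hmg (hgb _ (hu.mapsTo ha)).1) hb i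
    have hlow : ℓ ≤ lam j := MongeApprox.div_pow_le_of_prod hb.pos hUpos hle (by
      rw [hu.prod_eq hxΩ ha hb]
      have hT := hu.mapsTo hxΩ
      exact div_le_div₀ (hfpos x hxΩ).le (hfb x hxΩ).1 (hgpos _ hT) (hgb _ hT).2) j
    constructor
    · refine le_trans ?_ hlow
      rw [inv_le_comm₀ (by positivity) hℓpos]
      linarith
    · have := inv_pos.2 hℓpos
      linarith [hle j]
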